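/- Let $k$ be an algebraically closed field of characteristic $0$; a variety over $k$ is a separated $k$-scheme of finite type. Let $K_0(\mathrm{Var}_k)$ be the Grothendieck ring of varieties over $k$ (generated by the isomorphism classes $[X]$ of varieties, with the relations $[X]=[U]+[Z]$ for $Z\subseteq X$ closed with open complement $U$, and with multiplication given by the product over $k$), let $q=[\mathbb A^1_k]$ and $M_q=K_0(\mathrm{Var}_k)[q^{-1}]$. For $n\in\mathbb Z$ let $F_nM_q\subseteq M_q$ be the subgroup generated by the elements $[X]/q^s$, where $s\ge 0$ and $X$ is an irreducible variety of dimension at most $s+n$, and let $\widehat{M_q}$ be the completion of $M_q$ with respect to the filtration $(F_nM_q)_{n\in\mathbb Z}$ (the $F_nM_q$ being a basis of neighbourhoods of $0$). For $r\ge 0$, a presentation of the space of conjugacy classes of $\mathrm{GL}_r(k)$ is a finite partition of the variety $\mathrm{GL}_r$ into reduced locally closed subvarieties $S_1,\dots,S_n$, stable under conjugation, together with, for every $i$, a morphism of varieties $\pi_i:S_i\to X_i$ which admits a section $\sigma_i:X_i\to S_i$ ($\pi_i\circ\sigma_i=\mathrm{id}$) and whose fibres on $k$-points are exactly the conjugacy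 classes of $\mathrm{GL}_r(k)$ that are contained in $S_i$. **Theorem.** For every $r\ge 0$ the space of conjugacy classes of $\mathrm{GL}_r(k)$ has a presentation; the element $[\mathcal C_r]:=\sum_i [X_i]\in K_0(\mathrm{Var}_k)$ does not depend on the presentation, and neither does $\dim\mathcal C_r:=\max_i\dim X_i$, which equals $r$. The sequence of virtual classes $[\mathcal C_r]$ of the spaces of all conjugacy classes of $\mathrm{GL}_r(k)$ is motivically stable, that is, $[\mathcal C_r]/q^{\dim \mathcal C_r}$ converges in $\widehat{M_q}$ as $r\to\infty$, and $$\lim_{r\to\infty}\frac{[\mathcal C_r]}{q^{r}}=1\quad\text{in }\widehat{M_q}.$$ -/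

import Mathlib

open CategoryTheory MonoidalCategory AlgebraicGeometry Filter Topology

universe u

noncomputable section

namespace MotivicConj

/-! ### Varieties and the Grothendieck ring of varieties -/

/-- The `k`-schemes that are separated and of finite type over `k`. -/
def isVariety (k : Type u) [Field k] : ObjectProperty (Over (Spec (CommRingCat.of k))) :=
  fun X => LocallyOfFiniteType X.hom ∧ QuasiCompact X.hom ∧ IsSeparated X.hom

/-- The category of varieties over `k`: separated `k`-schemes of finite type and
`k`-morphisms. -/
abbrev Var (k : Type u) [Field k] := (isVariety k).FullSubcategory

variable (k : Type u) [Field k]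

/-- Varieties are closed under finite products over `k`; so `Var k` is a symmetric monoidal
category under the fibre product over `k`. -/
instance isVariety_isMonoidal : (isVariety k).IsMonoidal where
  prop_unit := by
    exact ⟨inferInstanceAs (LocallyOfFiniteType (𝟙 (Spec (CommRingCat.of k)))),
      inferInstanceAs (QuasiCompact (𝟙 (Spec (CommRingCat.of k)))),
      inferInstanceAs (IsSeparated (𝟙 (Spec (CommRingCat.of k))))⟩
  prop_tensor X Y hX hY := by
    obtain ⟨_, _, _⟩ := hX
    obtain ⟨_, _, _⟩ := hY
    refine ⟨?_, ?_, ?_⟩ <;> (rw [Over.tensorObj_hom]; infer_instance)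

variable {k}

/-- The underlying scheme of a variety. -/
abbrev Var.scheme (X : Var k) : Scheme.{u} := X.obj.left

/-- The morphism of schemes underlying a morphism of varieties. -/
abbrev Var.mor {X Y : Var k} (f : X ⟶ Y) : X.scheme ⟶ Y.scheme := f.hom.left

/-- The variety `Spec A`, for a finitely generated `k`-algebra `A`. -/
def Var.spec (k : Type u) [Field k] (A : Type u) [CommRing A] [Algebra k A]
    [hA : Algebra.FiniteType k A] : Var k :=
  ⟨Over.mk (Spec.map (CommRingCat.ofHom (algebraMap k A))), by
    refine ⟨?_, ?_, ?_⟩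
    · change LocallyOfFiniteType (Spec.map (CommRingCat.ofHom (algebraMap k A)))
      rw [HasRingHomProperty.Spec_iff (P := @LocallyOfFiniteType)]
      exact RingHom.finiteType_algebraMap.mpr hA
    · change QuasiCompact (Spec.map (CommRingCat.ofHom (algebraMap k A)))
      infer_instance
    · change IsSeparated (Spec.map (CommRingCat.ofHom (algebraMap k A)))
      infer_instance⟩

variable (k)

/-- The free abelian group on isomorphism classes of varieties, with the multiplication given
by the product of varieties. -/
abbrev FreeVar := MonoidAlgebra ℤ (Skeleton (Var k))

/-- The generator of `FreeVar k` given by the isomorphism class of `X`. -/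
def FreeVar.of {k : Type u} [Field k] (X : Var k) : FreeVar k :=
  MonoidAlgebra.of ℤ (Skeleton (Var k)) (toSkeleton X)

/-- The scissor relations `[X] - ([U] + [Z])`, for `Z` a closed subvariety of `X` with open
complement `U`. -/
def scissor : Set (FreeVar k) :=
  {a | ∃ (X Z U : Var k) (i : Z ⟶ X) (j : U ⟶ X),
    IsClosedImmersion (Var.mor i) ∧ IsOpenImmersion (Var.mor j) ∧
    Set.range (Var.mor j) = (Set.range (Var.mor i))ᶜ ∧
    a = FreeVar.of X - (FreeVar.of U + FreeVar.of Z)}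

/-- The Grothendieck ring of varieties over `k`. The additive group generated by
the scissor relations is already an ideal, as they are stable under products with a variety. -/
abbrev K0Var := FreeVar k ⧸ Ideal.span (scissor k)

variable {k} in
/-- The virtual class `[X]` of a variety. -/
def cls (X : Var k) : K0Var k := Ideal.Quotient.mk _ (FreeVar.of X)

/-- The affine line over `k`. -/
def affineLine : Var k := Var.spec k (MvPolynomial PUnit.{u + 1} k)

/-- The class `q` of the affine line. -/
def q : K0Var k := cls (affineLine k)

/-! ### The localization at `q`, its dimension filtration, and the completion -/

/-- The localized Grothendieck ring `M_q = K_0(Var_k)[q⁻¹]`. -/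
def Mq := Localization.Away (q k)

instance : CommRing (Mq k) := inferInstanceAs (CommRing (Localization.Away (q k)))

instance : Algebra (K0Var k) (Mq k) :=
  inferInstanceAs (Algebra (K0Var k) (Localization.Away (q k)))

instance : IsLocalization.Away (q k) (Mq k) :=
  inferInstanceAs (IsLocalization.Away (q k) (Localization.Away (q k)))

variable {k} in
/-- The fraction `c / q ^ s` in `M_q`. -/
def divQ (c : K0Var k) (s : ℕ) : Mq k :=
  algebraMap (K0Var k) (Mq k) c * IsLocalization.Away.invSelf (q k) ^ s

/-- The subgroup `F_n M_q` generated by the `[X] / q ^ s` with `X` an irreducible variety of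
dimension at most `s + n`. -/
def filtration (n : ℤ) : AddSubgroup (Mq k) :=
  AddSubgroup.closure {a | ∃ (X : Var k) (s d : ℕ), IrreducibleSpace X.scheme ∧
    topologicalKrullDim X.scheme ≤ d ∧ (d : ℤ) ≤ s + n ∧ a = divQ (cls X) s}

theorem filtration_mono : Monotone (filtration k) := by
  intro m n hmn
  refine AddSubgroup.closure_mono ?_
  rintro a ⟨X, s, d, h₁, h₂, h₃, h₄⟩
  exact ⟨X, s, d, h₁, h₂, by omega, h₄⟩

/-- The subgroups `F_n M_q`, for `n` an integer, as a neighbourhood basis of `0`. -/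
@[reducible] def filterBasis : AddGroupFilterBasis (Mq k) :=
  addGroupFilterBasisOfComm (Set.range fun n : ℤ => (filtration k n : Set (Mq k)))
    (Set.range_nonempty _)
    (by
      rintro _ _ ⟨m, rfl⟩ ⟨n, rfl⟩
      exact ⟨_, ⟨min m n, rfl⟩, Set.subset_inter (filtration_mono k (min_le_left m n))
        (filtration_mono k (min_le_right m n))⟩)
    (by rintro _ ⟨n, rfl⟩; exact (filtration k n).zero_mem)
    (by
      rintro _ ⟨n, rfl⟩
      refine ⟨_, ⟨n, rfl⟩, ?_⟩
      rintro _ ⟨a, ha, b, hb, rfl⟩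
      exact (filtration k n).add_mem ha hb)
    (by
      rintro _ ⟨n, rfl⟩
      exact ⟨_, ⟨n, rfl⟩, fun a ha => (filtration k n).neg_mem ha⟩)

instance : TopologicalSpace (Mq k) := (filterBasis k).topology

instance : IsTopologicalAddGroup (Mq k) := (filterBasis k).isTopologicalAddGroup

instance : UniformSpace (Mq k) := IsTopologicalAddGroup.rightUniformSpace (Mq k)

instance : IsUniformAddGroup (Mq k) := isUniformAddGroup_of_addCommGroup

/-- The completion of `M_q` with respect to the dimension filtration. -/
abbrev MqHat := UniformSpace.Completion (Mq k)

/-! ### The general linear group as a variety -/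

/-- The coordinate ring `k[x_{ij}][1 / det]` of `GL_r`. -/
abbrev GLRing (r : ℕ) :=
  Localization.Away (Matrix.det (Matrix.mvPolynomialX (Fin r) (Fin r) k))

/-- The universal invertible `r × r` matrix. -/
def GLRing.universal (r : ℕ) : GL (Fin r) (GLRing k r) :=
  Matrix.GeneralLinearGroup.mk''
    ((Matrix.mvPolynomialX (Fin r) (Fin r) k).map (algebraMap _ (GLRing k r)))
    (by
      have h := IsLocalization.Away.algebraMap_isUnit (S := GLRing k r)
        (Matrix.det (Matrix.mvPolynomialX (Fin r) (Fin r) k))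
      rwa [RingHom.map_det] at h)

instance (r : ℕ) : Algebra.FiniteType k (GLRing k r) :=
  Algebra.FiniteType.trans (S := MvPolynomial (Fin r × Fin r) k) inferInstance
    (IsLocalization.finiteType_of_monoid_fg
      (Submonoid.powers (Matrix.det (Matrix.mvPolynomialX (Fin r) (Fin r) k))) _)

/-- The variety `GL_r` over `k`. -/
def GLVar (r : ℕ) : Var k := Var.spec k (GLRing k r)

/-- The one-point variety `Spec k`; the `k`-points of `X` are the morphisms `pt k ⟶ X`. -/
abbrev pt : Var k := 𝟙_ (Var k)

variable {k} in
/-- The invertible matrix over `k` that corresponds to a `k`-point of the variety `GL_r`. -/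
def pointMatrix {r : ℕ} (p : pt k ⟶ GLVar k r) : GL (Fin r) k :=
  Matrix.GeneralLinearGroup.map
    (Spec.preimage (R := CommRingCat.of (GLRing k r)) (S := CommRingCat.of k) (Var.mor p)).hom
    (GLRing.universal k r)

/-! ### The space of conjugacy classes -/

/-- A presentation of the space of conjugacy classes of `GL_r(k)` by varieties: a finite
partition of `GL_r` into conjugation-invariant locally closed (reduced) subvarieties
`incl i : S i → GL_r`, together with a quotient `π i : S i → X i` of each of them by conjugation,
that is, a morphism whose fibres on `k`-points are exactly the conjugacy classes, which has a
section `σ i : X i → S i` (a normal form). Since `S i` is reduced, the section makes `π i` a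
geometric quotient. -/
structure ConjQuotient (r : ℕ) where
  /-- the number of strata -/
  n : ℕ
  /-- the strata -/
  S : Fin n → Var k
  /-- the spaces of conjugacy classes in the strata -/
  X : Fin n → Var k
  /-- the inclusion of a stratum -/
  incl : ∀ i, S i ⟶ GLVar k r
  /-- the quotient morphism -/
  π : ∀ i, S i ⟶ X i
  /-- the normal form -/
  σ : ∀ i, X i ⟶ S i
  isReduced : ∀ i, IsReduced (S i).scheme
  isImmersion : ∀ i, IsImmersion (Var.mor (incl i))
  disjoint : Pairwise fun i j =>
    Disjoint (Set.range (Var.mor (incl i))) (Set.range (Var.mor (incl j)))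
  cover : ⋃ i, Set.range (Var.mor (incl i)) = Set.univ
  section_π : ∀ i, σ i ≫ π i = 𝟙 (X i)
  /-- the conjugacy class of a point of a stratum is contained in the stratum, and is the fibre
  of the quotient morphism through this point -/
  fibre : ∀ i (a : pt k ⟶ S i) (b : pt k ⟶ GLVar k r),
    IsConj (pointMatrix (a ≫ incl i)) (pointMatrix b) ↔
      ∃ b' : pt k ⟶ S i, b' ≫ incl i = b ∧ b' ≫ π i = a ≫ π i

variable {k}

/-- The virtual class of the space of conjugacy classes: the sum of the classes of the quotients
of the strata. -/
def ConjQuotient.virtualClass {r : ℕ} (Q : ConjQuotient k r) : K0Var k :=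
  ∑ i, cls (Q.X i)

/-- The dimension of the space of conjugacy classes: the maximum of the dimensions of the
quotients of the strata. -/
def ConjQuotient.dim {r : ℕ} (Q : ConjQuotient k r) : WithBot ℕ∞ :=
  ⨆ i, topologicalKrullDim (Q.X i).scheme

/-- A sequence of virtual classes `c r` of spaces of dimension `d r` is motivically stable with
limit `L` if `c r / q ^ (d r)` converges to `L` in the completion of `M_q`. -/
def MotivicallyStableTo (c : ℕ → K0Var k) (d : ℕ → ℕ) (L : MqHat k) : Prop :=
  Tendsto (fun r => ((divQ (c r) (d r) : Mq k) : MqHat k)) atTop (𝓝 L)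

end MotivicConj

end

/-! A matrix `A` turns `k ^ r` into a `k[x]`-module, and its conjugacy class is the chain of its
invariant factors `f_0, f_1, …`, monic with `f_{i+1} ∣ f_i` and total degree `r`. Put `g_i = f_i /
f_{i+1}` and `m_i = deg g_i`, so that `∑ (i + 1) m_i = r`; the `g_i` are arbitrary monic polynomials
of these degrees, and `A` is invertible exactly when their constant terms are nonzero. The classes
of type `m` thus form a product of lines and punctured lines, of class `∏ weight q (m_i)` and
dimension `∑ m_i`. This is at most `r`, and equals `r` for `m = (r, 0, …, 0)`.

To make this algebraic, one uses that the largest dimension of a `k[A]`-submodule of `k ^ r` with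
`j` generators is `deg f_0 + ⋯ + deg f_{j-1}`. The upper bound comes from the sharper divisibility
`chi_span_dvd`: the characteristic polynomial of `A` on such a submodule divides `f_0 ⋯ f_{j-1}`.
Reaching dimension `s` is an open condition, the nonvanishing of some Krylov determinant, so the
matrices of a given type form a locally closed set. Where the maximal dimension is reached, the
characteristic polynomial on the submodule is `f_0 ⋯ f_{j-1}`; its coefficients are regular
functions wherever the Krylov determinant is invertible. Dividing successive products shows that the
`g_i` depend algebraically on `A` (`exists_quotient`), and companion blocks give the section
(`exists_normalForm`).

Two presentations are compared by cutting the quotients of each along the strata of the other.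
Taking a normal form for one presentation and projecting by the other gives mutually inverse
morphisms between the parts (`exists_iso_part`). Additivity over locally closed partitions
(`locCls_eq_sum`) and the behaviour of dimension under locally closed covers
(`topologicalKrullDim_le_of_cover`) then give the same class and dimension.

For the limit, `∑_r [C_r] t ^ r = ∏_{j ≥ 1} (1 - t ^ j) / (1 - q t ^ j)`. By the identity `1 - t ^ j
= (1 - q t ^ (j+1)) - t ^ j (1 - q t)`, multiplying `1 / (1 - q t)` by `(1 - t ^ j) / (1 - q t ^
(j+1))` changes it only by `t ^ j / (1 - q t ^ (j+1))`, where the degree in `q` grows at most half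
as fast as the degree in `t`. Hence `[C_r] = q ^ r + (degree at most r / 2 in q)`
(`exists_classSum_eq`), and the error divided by `q ^ r` tends to `0` in the dimension filtration.
-/

noncomputable section

namespace MotivicConj

/-! ### The generating function of the classes -/

section GeneratingFunction

open Polynomial

/-- The multiplicity vectors `m` with `∑ (j + 1) m_j = r`: the `m_j` are the degrees of the
quotients of successive invariant factors of an `r × r` matrix. -/
def types (r : ℕ) : Finset (Fin r → ℕ) :=
  (Fintype.piFinset fun _ => Finset.range (r + 1)).filter
    fun m => ∑ j : Fin r, ((j : ℕ) + 1) * m j = r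

theorem mem_types {r : ℕ} {m : Fin r → ℕ} :
    m ∈ types r ↔ ∑ j : Fin r, ((j : ℕ) + 1) * m j = r := by
  simp only [types, Finset.mem_filter, Fintype.mem_piFinset, Finset.mem_range,
    and_iff_right_iff_imp]
  intro h j
  have h1 : ((j : ℕ) + 1) * m j ≤ r := by
    refine le_of_le_of_eq ?_ h
    exact Finset.single_le_sum (f := fun j : Fin r => ((j : ℕ) + 1) * m j)
      (fun _ _ => Nat.zero_le _) (Finset.mem_univ j)
  nlinarith [Nat.zero_le ((j : ℕ) * m j)]

/-- The class of the variety of monic polynomials of degree `m` with nonzero constant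
coefficient, as a polynomial in `q`. -/
def weight {R : Type*} [CommRing R] (x : R) (m : ℕ) : R :=
  if m = 0 then 1 else x ^ m - x ^ (m - 1)

theorem weight_map {R S : Type*} [CommRing R] [CommRing S] (f : R →+* S) (x : R) (m : ℕ) :
    f (weight x m) = weight (f x) m := by
  unfold weight
  split_ifs <;> simp

/-- The class of the space of conjugacy classes, as a polynomial in `q`. -/
def classSum {R : Type*} [CommRing R] (x : R) (r : ℕ) : R :=
  ∑ m ∈ types r, ∏ j, weight x (m j)

theorem classSum_map {R S : Type*} [CommRing R] [CommRing S] (f : R →+* S) (x : R) (r : ℕ) :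
    f (classSum x r) = classSum (f x) r := by
  simp [classSum, map_sum, map_prod, weight_map]

/-- The power series `∑ c_m t ^ (j m)`. -/
def dilate (c : ℕ → ℤ[X]) (j : ℕ) : PowerSeries ℤ[X] :=
  PowerSeries.mk fun n => if j ∣ n then c (n / j) else 0

/-- The factor `1 - q ^ e t ^ j`. -/
def linFactor (c : ℤ[X]) (j : ℕ) : PowerSeries ℤ[X] := 1 - PowerSeries.C c * PowerSeries.X ^ j

theorem coeff_dilate_mul_linFactor (c : ℕ → ℤ[X]) (b : ℤ[X]) {j : ℕ} (hj : 0 < j) (n : ℕ) :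
    (dilate c j * linFactor b j).coeff n =
      if j ∣ n then (c (n / j) - if n = 0 then 0 else b * c (n / j - 1)) else 0 := by
  rw [linFactor, mul_sub, mul_one, map_sub,
    show dilate c j * (PowerSeries.C b * PowerSeries.X ^ j)
      = PowerSeries.C b * (dilate c j * PowerSeries.X ^ j) by ring,
    PowerSeries.coeff_C_mul, PowerSeries.coeff_mul_X_pow']
  simp only [dilate, PowerSeries.coeff_mk]
  by_cases hn : j ∣ n
  · obtain ⟨m, rfl⟩ := hn
    rcases m with _ | m
    · simp [hj.ne']
    · have h1 : j ≤ j * (m + 1) := Nat.le_mul_of_pos_right _ (Nat.succ_pos _)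
      have h2 : j * (m + 1) - j = j * m := by rw [Nat.mul_succ]; omega
      have h3 : j * (m + 1) ≠ 0 := by positivity
      simp [h1, h2, h3, Nat.mul_div_cancel_left _ hj]
  · have h1 : j ≤ n → ¬ j ∣ n - j := fun h1 h2 => hn ((Nat.dvd_sub_iff_left h1 dvd_rfl).mp h2)
    by_cases h2 : j ≤ n
    · simp [hn, h1 h2]
    · simp [hn, h2]

theorem dilate_pow_mul {j : ℕ} (hj : 0 < j) :
    dilate (fun m => X ^ m) j * linFactor X j = 1 := by
  ext1 n
  rw [coeff_dilate_mul_linFactor _ _ hj, PowerSeries.coeff_one]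
  rcases Nat.eq_zero_or_pos n with rfl | hn
  · simp
  · simp only [hn.ne', if_false]
    split_ifs with h
    · have : 0 < n / j := Nat.div_pos (Nat.le_of_dvd hn h) hj
      obtain ⟨a, ha⟩ : ∃ a, n / j = a + 1 := ⟨n / j - 1, by omega⟩
      simp [ha, pow_succ']
    · rfl

theorem coeff_linFactor (c : ℤ[X]) {j : ℕ} (n : ℕ) :
    (linFactor c j).coeff n = (if n = 0 then 1 else 0) - (if n = j then c else 0) := by
  simp [linFactor, PowerSeries.coeff_one, PowerSeries.coeff_X_pow]

/-- The weights telescope: `∑ weight q m t ^ (j m) = (1 - t ^ j) / (1 - q t ^ j)`, written without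
inverses. -/
theorem dilate_weight_mul {j : ℕ} (hj : 0 < j) :
    dilate (fun m => weight X m) j * linFactor X j = linFactor 1 j := by
  ext1 n
  rw [coeff_dilate_mul_linFactor _ _ hj, coeff_linFactor]
  rcases Nat.eq_zero_or_pos n with rfl | hn
  · simp [weight, hj.ne]
  · simp only [hn.ne', if_false]
    split_ifs with h h' h'
    · subst h'
      simp [Nat.div_self hj, weight]
    · have : 0 < n / j := Nat.div_pos (Nat.le_of_dvd hn h) hj
      obtain ⟨a, ha⟩ : ∃ a, n / j = a + 2 := by
        refine ⟨n / j - 2, ?_⟩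
        have : n / j ≠ 1 := fun h1 => h' (by rw [← Nat.div_mul_cancel h, h1, one_mul])
        omega
      simp [ha, weight]
      ring
    · exact absurd h' (by rintro rfl; exact h dvd_rfl)
    · simp

/-! ### Power series with slowly growing degree in `q` -/

/-- The degree in `q` of the coefficient of `t ^ i` is at most `i / 2`. -/
def Slow (f : PowerSeries ℤ[X]) : Prop := ∀ i, 2 * (f.coeff i).natDegree ≤ i

theorem Slow.add {f g : PowerSeries ℤ[X]} (hf : Slow f) (hg : Slow g) : Slow (f + g) := by
  intro i
  have := natDegree_add_le (f.coeff i) (g.coeff i)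
  have := hf i
  have := hg i
  rw [map_add]
  omega

theorem Slow.neg {f : PowerSeries ℤ[X]} (hf : Slow f) : Slow (-f) := by
  intro i
  rw [map_neg, natDegree_neg]
  exact hf i

theorem Slow.sub {f g : PowerSeries ℤ[X]} (hf : Slow f) (hg : Slow g) : Slow (f - g) := by
  rw [sub_eq_add_neg]
  exact hf.add hg.neg

theorem Slow.mul {f g : PowerSeries ℤ[X]} (hf : Slow f) (hg : Slow g) : Slow (f * g) := by
  intro i
  rw [PowerSeries.coeff_mul]
  have : (∑ p ∈ Finset.HasAntidiagonal.antidiagonal i, f.coeff p.1 * g.coeff p.2).natDegree ≤ i / 2 := by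
    refine natDegree_sum_le_of_forall_le _ _ fun p hp => ?_
    have := natDegree_mul_le (p := f.coeff p.1) (q := g.coeff p.2)
    have := hf p.1
    have := hg p.2
    have := Finset.HasAntidiagonal.mem_antidiagonal.mp hp
    omega
  omega

theorem slow_one : Slow 1 := by
  intro i
  rw [PowerSeries.coeff_one]
  split_ifs <;> simp

theorem slow_X_pow (n : ℕ) : Slow (PowerSeries.X ^ n) := by
  intro i
  rw [PowerSeries.coeff_X_pow]
  split_ifs <;> simp

theorem slow_linFactor_one (j : ℕ) : Slow (linFactor 1 j) := by
  rw [linFactor, map_one, one_mul]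
  exact slow_one.sub (slow_X_pow j)

/-- The coefficient of `t ^ i` is `q ^ (i / j)` or zero; only `1 / (1 - q t)`, excluded by `2 ≤ j`,
grows faster. -/
theorem slow_dilate (j : ℕ) (hj : 2 ≤ j) : Slow (dilate (fun m => X ^ m) j) := by
  intro i
  rw [dilate, PowerSeries.coeff_mk]
  split_ifs with h
  · rw [natDegree_X_pow]
    calc 2 * (i / j) ≤ j * (i / j) := Nat.mul_le_mul_right _ hj
      _ ≤ i := Nat.mul_div_le i j
  · simp

/-- Each numerator `1 - t ^ j` is paired with the next denominator `1 - q t ^ (j+1)`, so that one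
factor changes `1 / (1 - q t)` only by a slow series and slow series stay slow. -/
theorem exists_slow (n : ℕ) : ∃ G, Slow G ∧
    dilate (fun m => X ^ m) 1 * ∏ j ∈ Finset.range n,
      (linFactor 1 (j + 1) * dilate (fun m => X ^ m) (j + 2)) =
    dilate (fun m => X ^ m) 1 - G := by
  induction n with
  | zero => exact ⟨0, fun i => by simp, by simp⟩
  | succ n ih =>
    obtain ⟨G, hG, h⟩ := ih
    set D := dilate (fun m => X ^ m) (n + 2) with hD
    set H := dilate (fun m => (X : ℤ[X]) ^ m) 1 with hH
    have hs : Slow D := slow_dilate _ (by omega)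
    -- With `L = linFactor 1 (n + 1)`, this is `t ^ (n+1) D + G L D`: the change of `H` under the
    -- new factor `L D`, plus the old error times that factor.
    refine ⟨G + PowerSeries.X ^ (n + 1) * D - G * (1 - linFactor 1 (n + 1) * D),
      (hG.add ((slow_X_pow _).mul hs)).sub
        (hG.mul (slow_one.sub ((slow_linFactor_one _).mul hs))), ?_⟩
    rw [Finset.prod_range_succ, ← mul_assoc, h]
    have e1 : D * linFactor X (n + 2) = 1 := dilate_pow_mul (by omega)
    have e2 : H * linFactor X 1 = 1 := dilate_pow_mul (by omega)
    have e3 : linFactor 1 (n + 1) = linFactor X (n + 2)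
        - PowerSeries.X ^ (n + 1) * linFactor X 1 := by
      simp only [linFactor, map_one]
      ring
    have e4 : H * (linFactor 1 (n + 1) * D) = H - PowerSeries.X ^ (n + 1) * D := by
      rw [e3]
      linear_combination H * e1 - PowerSeries.X ^ (n + 1) * D * e2
    linear_combination e4

/-- A choice of exponents summing to `r` contributes only if the `j`-th one is divisible by `j + 1`;
the quotients are then a type. Factors with `j ≥ r` cannot affect the coefficient of `t ^ r`, so `r`
factors suffice. -/
theorem coeff_prod_dilate (c : ℕ → ℤ[X]) (r : ℕ) :
    (∏ j : Fin r, dilate c ((j : ℕ) + 1)).coeff r = ∑ m ∈ types r, ∏ j, c (m j) := by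
  classical
  rw [PowerSeries.coeff_prod]
  symm
  refine Finset.sum_of_injOn
    (fun m : Fin r → ℕ => Finsupp.equivFunOnFinite.symm fun j => ((j : ℕ) + 1) * m j)
    ?_ ?_ ?_ ?_
  · intro m _ m' _ h
    funext j
    have := DFunLike.congr_fun h j
    simpa using this
  · intro m hm
    simp only [Finset.mem_coe, Finset.mem_finsuppAntidiag, Finset.subset_univ, and_true]
    exact mem_types.mp hm
  · intro l hl hl'
    by_contra h
    have h1 : ∀ j : Fin r, ((j : ℕ) + 1) ∣ l j := by
      intro j
      by_contra hj
      exact h (Finset.prod_eq_zero (Finset.mem_univ j) (by simp [dilate, hj]))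
    refine hl' ⟨fun j => l j / ((j : ℕ) + 1), mem_types.mpr ?_, ?_⟩
    · simp only [Finset.mem_finsuppAntidiag, Finset.subset_univ, and_true] at hl
      simp_rw [fun j : Fin r => Nat.mul_div_cancel' (h1 j)]
      exact hl
    · ext j
      simp [Nat.mul_div_cancel' (h1 j)]
  · intro m _
    refine Finset.prod_congr rfl fun j _ => ?_
    simp [dilate]

theorem exists_classSum_eq (r : ℕ) :
    ∃ G : ℤ[X], classSum X r = X ^ r + G ∧ 2 * G.natDegree ≤ r := by
  rcases r with _ | n
  · exact ⟨0, by simp [classSum, types], by simp⟩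
  obtain ⟨G, hG, h⟩ := exists_slow n
  -- Shifting the denominators by one against the numerators leaves the first denominator, which
  -- belongs to the main term, and the last numerator `1 - t ^ (n+1)`.
  have key : ∏ j : Fin (n + 1), dilate (fun m => weight X m) ((j : ℕ) + 1) =
      linFactor 1 (n + 1) * (dilate (fun m => X ^ m) 1 - G) := by
    have e : ∀ j : ℕ, dilate (fun m => weight X m) (j + 1) =
        linFactor 1 (j + 1) * dilate (fun m => X ^ m) (j + 1) := by
      intro j
      rw [← dilate_weight_mul (Nat.succ_pos j), mul_assoc,
        mul_comm (linFactor X (j + 1)), dilate_pow_mul (Nat.succ_pos j), mul_one]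
    rw [Fin.prod_univ_eq_prod_range (fun j => dilate (fun m => weight X m) (j + 1)) (n + 1),
      Finset.prod_congr rfl fun j _ => e j, Finset.prod_mul_distrib, Finset.prod_range_succ,
      Finset.prod_range_succ' (fun j => dilate (fun m => (X : ℤ[X]) ^ m) (j + 1)), ← h,
      Finset.prod_mul_distrib]
    simp only [zero_add]
    ring
  -- The `-1` is the coefficient of `t ^ (n+1)` in `-t ^ (n+1) / (1 - q t)`.
  refine ⟨-1 - (linFactor 1 (n + 1) * G).coeff (n + 1), ?_, ?_⟩
  · rw [classSum, ← coeff_prod_dilate, key, mul_sub, map_sub, linFactor, map_one, one_mul,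
      sub_mul, one_mul, map_sub, PowerSeries.coeff_X_pow_mul']
    simp [dilate]
    ring
  · have h1 := ((slow_linFactor_one (n + 1)).mul hG) (n + 1)
    have h2 := natDegree_sub_le (-1 : ℤ[X]) ((linFactor 1 (n + 1) * G).coeff (n + 1))
    simp only [natDegree_neg, natDegree_one] at h2
    omega

end GeneratingFunction

/-! ### Finite-dimensional modules over `k[x]` -/

section PolynomialModules

open Polynomial

/-- Multiplication by `x` on a `k[x]`-module. -/
abbrev xEnd (k : Type*) [Field k] (M : Type*) [AddCommGroup M] [Module k M] [Module k[X] M]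
    [IsScalarTower k k[X] M] : Module.End k M :=
  Algebra.lsmul k k M (X : k[X])

/-- The characteristic polynomial of `x` on a finite-dimensional `k[x]`-module. -/
def chi (k : Type*) [Field k] (M : Type*) [AddCommGroup M] [Module k M] [Module k[X] M]
    [IsScalarTower k k[X] M] [Module.Finite k M] : k[X] :=
  (xEnd k M).charpoly

/-- The cyclic module `k[x] / f`. -/
abbrev Cyc {k : Type*} [Field k] (f : k[X]) := k[X] ⧸ Ideal.span {f}

variable {k : Type*} [Field k]
variable {M : Type*} [AddCommGroup M] [Module k M] [Module k[X] M]
    [IsScalarTower k k[X] M]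
variable {N : Type*} [AddCommGroup N] [Module k N] [Module k[X] N]
    [IsScalarTower k k[X] N]

instance finite_submodule [Module.Finite k M] (L : Submodule k[X] M) : Module.Finite k L :=
  inferInstanceAs (Module.Finite k (L.restrictScalars k))

theorem chi_monic [Module.Finite k M] : (chi k M).Monic := LinearMap.charpoly_monic _

theorem natDegree_chi [Module.Finite k M] : (chi k M).natDegree = Module.finrank k M :=
  LinearMap.charpoly_natDegree _

theorem chi_congr [Module.Finite k M] [Module.Finite k N] (e : M ≃ₗ[k[X]] N) :
    chi k M = chi k N := by
  rw [chi, chi, ← LinearEquiv.charpoly_conj (e.restrictScalars k) (xEnd k M)]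
  congr 1
  ext m
  simp [LinearEquiv.conj_apply]

theorem chi_prod [Module.Finite k M] [Module.Finite k N] :
    chi k (M × N) = chi k M * chi k N := by
  rw [chi, chi, chi, ← LinearMap.charpoly_prodMap]
  rfl

/-- Over an infinite field it is enough to compare values at `t`, that is, determinants of `t - x`,
and these are multiplicative along an invariant subspace. -/
theorem chi_eq_mul [Infinite k] [Module.Finite k M] (L : Submodule k[X] M) :
    chi k M = chi k L * chi k (M ⧸ L) := by
  refine Polynomial.funext fun t => ?_
  rw [eval_mul, chi, chi, chi, LinearMap.eval_charpoly, LinearMap.eval_charpoly,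
    LinearMap.eval_charpoly]
  have hL : L.restrictScalars k ≤
      (L.restrictScalars k).comap (algebraMap k (Module.End k M) t - xEnd k M) := by
    intro m hm
    exact L.sub_mem ((L.restrictScalars k).smul_mem t hm) (L.smul_mem X hm)
  rw [LinearMap.det_eq_det_mul_det (L.restrictScalars k) _ hL]
  congr 1
  rw [← LinearMap.det_conj (M := M ⧸ L.restrictScalars k) _
    ((Submodule.Quotient.restrictScalarsEquiv k L))]
  congr 1
  ext ⟨m⟩
  rfl

theorem chi_dvd_of_injective [Infinite k] [Module.Finite k M] [Module.Finite k N]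
    (f : M →ₗ[k[X]] N) (hf : Function.Injective f) : chi k M ∣ chi k N := by
  rw [chi_eq_mul (LinearMap.range f), chi_congr (LinearEquiv.ofInjective f hf)]
  exact dvd_mul_right _ _

theorem chi_dvd_of_surjective [Infinite k] [Module.Finite k M] [Module.Finite k N]
    (f : M →ₗ[k[X]] N) (hf : Function.Surjective f) : chi k N ∣ chi k M := by
  rw [chi_eq_mul (LinearMap.ker f), ← chi_congr (f.quotKerEquivOfSurjective hf)]
  exact dvd_mul_left _ _

theorem chi_pi {n : ℕ} (F : Fin n → Type*) [∀ i, AddCommGroup (F i)] [∀ i, Module k (F i)]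
    [∀ i, Module k[X] (F i)] [∀ i, IsScalarTower k k[X] (F i)] [∀ i, Module.Finite k (F i)] :
    chi k (∀ i, F i) = ∏ i, chi k (F i) := by
  induction n with
  | zero =>
    rw [Fin.prod_univ_zero]
    refine Polynomial.eq_one_of_monic_natDegree_zero chi_monic ?_
    rw [natDegree_chi]
    exact Module.finrank_zero_of_subsingleton
  | succ n ih =>
    rw [Fin.prod_univ_succ, ← ih, ← chi_prod]
    exact (chi_congr (Fin.consLinearEquiv k[X] F)).symm

/-- The basis `1, x, …, x ^ (d - 1)` of `k[x] / f`, for `f` monic of degree `d`. -/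
def cycBasis {f : k[X]} (hf : f.Monic) : Module.Basis (Fin f.natDegree) k (Cyc f) :=
  AdjoinRoot.powerBasisAux' hf

theorem finite_cyc {f : k[X]} (hf : f.Monic) : Module.Finite k (Cyc f) :=
  Module.Finite.of_basis (cycBasis hf)

theorem finrank_cyc {f : k[X]} (hf : f.Monic) : Module.finrank k (Cyc f) = f.natDegree := by
  rw [Module.finrank_eq_card_basis (cycBasis hf), Fintype.card_fin]

theorem toMatrix_cycBasis {f : k[X]} (hf : f.Monic) :
    LinearMap.toMatrix (cycBasis hf) (cycBasis hf) (xEnd k (Cyc f)) =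
      Matrix.of fun i j : Fin f.natDegree => if (j : ℕ) + 1 = f.natDegree then -f.coeff i
        else if (i : ℕ) = j + 1 then 1 else 0 := by
  have h := (AdjoinRoot.powerBasis' hf).leftMulMatrix
  have h2 : (AdjoinRoot.powerBasis' hf).minpolyGen = f := by
    rw [PowerBasis.minpolyGen_eq, AdjoinRoot.powerBasis'_gen,
      AdjoinRoot.minpoly_root hf.ne_zero]
    simp [hf.leadingCoeff]
  rw [h2] at h
  exact h

theorem chi_cyc {f : k[X]} (hf : f.Monic) [Module.Finite k (Cyc f)] : chi k (Cyc f) = f := by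
  rw [chi, ← LinearMap.charpoly_toMatrix _ (cycBasis hf)]
  have h := charpoly_leftMulMatrix (AdjoinRoot.powerBasis' hf)
  rw [AdjoinRoot.powerBasis'_gen, AdjoinRoot.minpoly_root hf.ne_zero] at h
  simp only [hf.leadingCoeff, inv_one, C_1, mul_one] at h
  exact h

/-- Multiplication by `h` as a map `k[x] / a → k[x] / (h a)`. -/
def cycMul (h a b : k[X]) (hb : b = h * a) : Cyc a →ₗ[k[X]] Cyc b :=
  Submodule.mapQ _ _ (LinearMap.mulLeft k[X] h) (by
    intro x hx
    obtain ⟨c, rfl⟩ := Ideal.mem_span_singleton'.mp hx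
    exact Ideal.mem_span_singleton'.mpr ⟨c, by simp [hb]; ring⟩)

theorem cycMul_mk (h a b : k[X]) (hb : b = h * a) (x : k[X]) :
    cycMul h a b hb (Submodule.Quotient.mk x) = Submodule.Quotient.mk (h * x) := rfl

/-- Such a module is a quotient of `(k[x] / h) ^ j`. -/
theorem chi_dvd_pow [Infinite k] [Module.Finite k M] {h : k[X]} (hh : h.Monic) {j : ℕ}
    (w : Fin j → M) (hw : ∀ i, h • w i = 0) (hs : Submodule.span k[X] (Set.range w) = ⊤) :
    chi k M ∣ h ^ j := by
  have : Module.Finite k (Cyc h) := finite_cyc hh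
  have hker : ∀ i, Ideal.span {h} ≤ LinearMap.ker (LinearMap.toSpanSingleton k[X] M (w i)) := by
    intro i
    rw [Ideal.span_le, Set.singleton_subset_iff]
    exact hw i
  let θ : (Fin j → Cyc h) →ₗ[k[X]] M :=
    ∑ i, (Submodule.liftQ _ (LinearMap.toSpanSingleton k[X] M (w i)) (hker i)).comp
      (LinearMap.proj i)
  have hθ : Function.Surjective θ := by
    rw [← LinearMap.range_eq_top, eq_top_iff, ← hs, Submodule.span_le]
    rintro _ ⟨i, rfl⟩
    refine ⟨Pi.single i (Submodule.Quotient.mk 1), ?_⟩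
    simp only [θ, LinearMap.sum_apply, LinearMap.comp_apply, LinearMap.proj_apply]
    rw [Finset.sum_eq_single i]
    · simp only [Pi.single_eq_same]
      exact one_smul _ _
    · intro b _ hb
      rw [Pi.single_eq_of_ne hb, map_zero]
    · simp
  refine (chi_dvd_of_surjective θ hθ).trans ?_
  rw [chi_pi]
  simp [chi_cyc hh]

/-- Componentwise multiplication by `h` on a product of cyclic modules. -/
def pieceMul (f : ℕ → k[X]) (n j : ℕ) (h : k[X]) (a : Fin j → k[X]) (ha : ∀ i : Fin j, f i = h * a i) :
    (∀ i : Fin j, Cyc (a i)) →ₗ[k[X]] (∀ i : Fin n, Cyc (f i)) :=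
  LinearMap.pi (φ := fun i : Fin n => Cyc (f i)) fun i => if hi : (i : ℕ) < j then
    (cycMul h (a ⟨i, hi⟩) (f (i : ℕ)) (by exact ha ⟨i, hi⟩)).comp
      (LinearMap.proj (R := k[X]) (φ := fun i : Fin j => Cyc (a i)) ⟨i, hi⟩) else 0

/-- Multiplication by `h` kills the summands from the `j`-th on, and on an earlier summand `k[x] /
(h a_i)` its image comes from `k[x] / a_i`. -/
theorem smul_mem_range_pieceMul (f : ℕ → k[X]) (n j : ℕ) (h : k[X]) (a : Fin j → k[X])
    (ha : ∀ i : Fin j, f i = h * a i) (hd : ∀ i, j ≤ i → f i ∣ h) (m : ∀ i : Fin n, Cyc (f i)) :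
    h • m ∈ LinearMap.range (pieceMul f n j h a ha) := by
  choose x hx using fun i : Fin n => Submodule.Quotient.mk_surjective _ (m i)
  refine ⟨fun i => if hi : (i : ℕ) < n then Submodule.Quotient.mk (x ⟨i, hi⟩) else 0, ?_⟩
  funext i
  rw [pieceMul, LinearMap.pi_apply, Pi.smul_apply, ← hx i]
  split_ifs with hi
  · rw [LinearMap.comp_apply, LinearMap.proj_apply, dif_pos i.2, cycMul_mk,
      ← Submodule.Quotient.mk_smul, smul_eq_mul]
  · rw [LinearMap.zero_apply, ← Submodule.Quotient.mk_smul]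
    symm
    rw [Submodule.Quotient.mk_eq_zero, smul_eq_mul]
    exact Ideal.mul_mem_right _ _ (Ideal.mem_span_singleton.mpr (hd i (not_lt.mp hi)))

/-- `h M` embeds in the range of `ψ`, which is a quotient of `P`. -/
theorem chi_dvd_of_forall_smul_mem [Infinite k] [Module.Finite k M] [Module.Finite k N]
    {P : Type*} [AddCommGroup P] [Module k P] [Module k[X] P] [IsScalarTower k k[X] P]
    [Module.Finite k P] (h : k[X]) (ι : M →ₗ[k[X]] N) (hι : Function.Injective ι)
    (ψ : P →ₗ[k[X]] N) (hψ : ∀ m, h • m ∈ LinearMap.range ψ) :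
    chi k (LinearMap.range (LinearMap.lsmul k[X] M h)) ∣ chi k P := by
  have e1 : ∀ c : LinearMap.range (LinearMap.lsmul k[X] M h), ι c.1 ∈ LinearMap.range ψ := by
    rintro ⟨y, hy⟩
    obtain ⟨m, rfl⟩ := LinearMap.mem_range.mp hy
    have h1 : ι (LinearMap.lsmul k[X] M h m) = h • ι m := map_smul ι h m
    simpa only [h1] using hψ _
  have e2 : chi k (LinearMap.range (LinearMap.lsmul k[X] M h)) ∣ chi k (LinearMap.range ψ) :=
    chi_dvd_of_injective ((ι.comp (Submodule.subtype _)).codRestrict _ e1) (by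
      intro c c' hc
      exact Subtype.ext (hι (congrArg Subtype.val hc)))
  exact e2.trans (chi_dvd_of_surjective ψ.rangeRestrict ψ.surjective_rangeRestrict)

theorem dvd_of_chain {f : ℕ → k[X]} (hd : ∀ i, f (i + 1) ∣ f i) {a b : ℕ} (hab : a ≤ b) :
    f b ∣ f a := by
  induction b, hab using Nat.le_induction with
  | base => exact dvd_rfl
  | succ b _ ih => exact (hd b).trans ih

/-- The characteristic polynomial of a submodule of `⊕ k[x] / f_i`, with `f_{i + 1} ∣ f_i`, that
is generated by `j` elements divides `f_0 ⋯ f_{j - 1}`. -/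
theorem chi_span_dvd [Infinite k] [Module.Finite k M] (f : ℕ → k[X]) (hf : ∀ i, (f i).Monic)
    (hd : ∀ i, f (i + 1) ∣ f i) {n : ℕ} (e : M ≃ₗ[k[X]] (∀ i : Fin n, Cyc (f i)))
    {j : ℕ} (v : Fin j → M) :
    chi k (Submodule.span k[X] (Set.range v)) ∣ ∏ i : Fin j, f i := by
  choose a ha using fun i : Fin j => (dvd_of_chain hd i.2.le : f j ∣ f i)
  have ham : ∀ i, (a i).Monic := fun i =>
    (hf j).of_mul_monic_left (by rw [← ha i]; exact hf i)
  have : ∀ i, Module.Finite k (Cyc (a i)) := fun i => finite_cyc (ham i)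
  have : ∀ i : Fin n, Module.Finite k (Cyc (f i)) := fun i => finite_cyc (hf i)
  -- `L` is cut along `f_j L`. The submodule `f_j L` lies in `f_j ⊕ k[x] / f_i`, where only the
  -- first `j` summands survive and contribute `a_i = f_i / f_j`; the quotient has `j` generators
  -- killed by `f_j`. Together they give `∏ f_j a_i = ∏ f_i`.
  set L := Submodule.span k[X] (Set.range v) with hL
  have h1 : chi k (LinearMap.range (LinearMap.lsmul k[X] L (f j))) ∣ ∏ i, a i := by
    refine (chi_dvd_of_forall_smul_mem (f j) (e.toLinearMap.comp L.subtype)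
      (e.injective.comp L.subtype_injective) (pieceMul f n j (f j) a ha)
      (smul_mem_range_pieceMul f n j (f j) a ha fun i hi => dvd_of_chain hd hi)).trans ?_
    rw [chi_pi]
    exact dvd_of_eq (Finset.prod_congr rfl fun i _ => chi_cyc (ham i))
  have h2 : chi k (L ⧸ LinearMap.range (LinearMap.lsmul k[X] L (f j))) ∣ f j ^ j := by
    refine chi_dvd_pow (hf j)
      (fun i => Submodule.mkQ _ ⟨v i, Submodule.subset_span ⟨i, rfl⟩⟩) (fun i => ?_) ?_
    · rw [← map_smul]
      exact (Submodule.Quotient.mk_eq_zero _).mpr ⟨⟨v i, Submodule.subset_span ⟨i, rfl⟩⟩, rfl⟩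
    · have : Submodule.span k[X] (Set.range fun i =>
          (⟨v i, Submodule.subset_span ⟨i, rfl⟩⟩ : L)) = ⊤ := by
        rw [eq_top_iff]
        rintro x -
        have := Submodule.span_span_coe_preimage (R := k[X]) (s := Set.range v)
        rw [eq_top_iff] at this
        refine Submodule.span_mono ?_ (this (Submodule.mem_top (x := x)))
        rintro ⟨_, hy⟩ ⟨i, rfl⟩
        exact ⟨i, rfl⟩
      rw [Set.range_comp' (Submodule.mkQ _), Submodule.span_image, this, Submodule.map_top,
        Submodule.range_mkQ]
  rw [chi_eq_mul (LinearMap.range (LinearMap.lsmul k[X] L (f j)))]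
  refine (mul_dvd_mul h1 h2).trans (dvd_of_eq ?_)
  rw [Finset.prod_congr rfl fun i _ => ha i, Finset.prod_mul_distrib, Finset.prod_const,
    Finset.card_univ, Fintype.card_fin, mul_comm]

end PolynomialModules

/-! ### Invariant factors -/

section InvariantFactors

open Polynomial

variable {k : Type u} [Field k]

/-- The map `k[x] / a → k[x] / b` given by multiplication by `c`, when `b ∣ c a`. -/
def cycMap (c a b : k[X]) (h : b ∣ c * a) : Cyc a →ₗ[k[X]] Cyc b :=
  Submodule.mapQ _ _ (LinearMap.mulLeft k[X] c) (by
    intro x hx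
    obtain ⟨y, rfl⟩ := Ideal.mem_span_singleton.mp hx
    refine Ideal.mem_span_singleton.mpr ?_
    rw [LinearMap.mulLeft_apply, ← mul_assoc]
    exact h.mul_right y)

theorem cycMap_mk (c a b : k[X]) (h : b ∣ c * a) (x : k[X]) :
    cycMap c a b h (Submodule.Quotient.mk x) = Submodule.Quotient.mk (c * x) := rfl

theorem cyc_mk_eq {b x y : k[X]} (h : b ∣ x - y) :
    (Submodule.Quotient.mk x : Cyc b) = Submodule.Quotient.mk y :=
  (Submodule.Quotient.eq _).mpr (Ideal.mem_span_singleton.mpr h)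

/-- `k[x] / f × k[x] / g ≃ k[x] / lcm (f, g) × k[x] / gcd (f, g)`. -/
def cycSwap (d a b u v : k[X]) (h : u * a + v * b = 1) :
    (Cyc (d * a) × Cyc (d * b)) ≃ₗ[k[X]] (Cyc (d * a * b) × Cyc d) :=
  LinearEquiv.ofLinearMap
    (((cycMap (v * b) (d * a) (d * a * b) ⟨v, by ring⟩).coprod
        (cycMap (u * a) (d * b) (d * a * b) ⟨u, by ring⟩)).prod
      ((cycMap (-1) (d * a) d ⟨-a, by ring⟩).coprod (cycMap 1 (d * b) d ⟨b, by ring⟩)))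
    (((cycMap 1 (d * a * b) (d * a) ⟨b, by ring⟩).coprod
        (cycMap (-(u * a)) d (d * a) ⟨-u, by ring⟩)).prod
      ((cycMap 1 (d * a * b) (d * b) ⟨a, by ring⟩).coprod
        (cycMap (v * b) d (d * b) ⟨v, by ring⟩)))
    (by
      refine LinearMap.ext fun ⟨x, y⟩ => ?_
      obtain ⟨x, rfl⟩ := Submodule.Quotient.mk_surjective _ x
      obtain ⟨y, rfl⟩ := Submodule.Quotient.mk_surjective _ y
      simp only [LinearMap.comp_apply, LinearMap.prod_apply, Function.prod, LinearMap.coprod_apply,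
        cycMap_mk, ← Submodule.Quotient.mk_add, LinearMap.id_apply, Prod.mk.injEq]
      constructor
      · refine cyc_mk_eq ⟨0, ?_⟩
        linear_combination x * h
      · refine cyc_mk_eq ⟨0, ?_⟩
        linear_combination y * h)
    (by
      refine LinearMap.ext fun ⟨x, y⟩ => ?_
      obtain ⟨x, rfl⟩ := Submodule.Quotient.mk_surjective _ x
      obtain ⟨y, rfl⟩ := Submodule.Quotient.mk_surjective _ y
      simp only [LinearMap.comp_apply, LinearMap.prod_apply, Function.prod, LinearMap.coprod_apply,
        cycMap_mk, ← Submodule.Quotient.mk_add, LinearMap.id_apply, Prod.mk.injEq]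
      constructor
      · refine cyc_mk_eq ⟨0, ?_⟩
        linear_combination x * h
      · refine cyc_mk_eq ⟨0, ?_⟩
        linear_combination y * h)

/-- The cyclic modules of associated polynomials are isomorphic. -/
def cycCongr {f g : k[X]} (h : Associated f g) : Cyc f ≃ₗ[k[X]] Cyc g :=
  Submodule.quotEquivOfEq _ _ (Ideal.span_singleton_eq_span_singleton.mpr h)

-- The pair `(f_0, g)` is replaced by its lcm and gcd; the lcm becomes the head and the gcd is
-- inserted in the tail. The clause on common multiples `c` is carried along so that the induction
-- shows the new tail to divide the new head.
open scoped Classical in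
theorem exists_insert (n : ℕ) : ∀ (f : Fin n → k[X]) (g : k[X]), (∀ i, f i ≠ 0) → g ≠ 0 →
    (∀ i j, i ≤ j → f j ∣ f i) →
    ∃ f' : Fin (n + 1) → k[X], (∀ i, f' i ≠ 0) ∧ (∀ i j, i ≤ j → f' j ∣ f' i) ∧
      (∀ c, g ∣ c → (∀ i, f i ∣ c) → ∀ i, f' i ∣ c) ∧
      Nonempty ((Cyc g × ∀ i, Cyc (f i)) ≃ₗ[k[X]] ∀ i, Cyc (f' i)) := by
  induction n with
  | zero =>
    intro f g _ hg _
    refine ⟨fun _ => g, fun _ => hg, fun _ _ _ => dvd_rfl, fun c h _ _ => h, ⟨?_⟩⟩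
    exact LinearEquiv.prodUnique.trans (LinearEquiv.piUnique k[X] fun _ : Fin 1 => Cyc g).symm
  | succ n ih =>
    intro f g hf hg hd
    obtain ⟨d, a, b, hfd, hgd, u, v, huv⟩ : ∃ d a b, f 0 = d * a ∧ g = d * b ∧
        ∃ u v, u * a + v * b = 1 := by
      obtain ⟨a, ha⟩ := EuclideanDomain.gcd_dvd_left (f 0) g
      obtain ⟨b, hb⟩ := EuclideanDomain.gcd_dvd_right (f 0) g
      refine ⟨EuclideanDomain.gcd (f 0) g, a, b, ha, hb, EuclideanDomain.gcdA (f 0) g,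
        EuclideanDomain.gcdB (f 0) g, ?_⟩
      have h1 := EuclideanDomain.gcd_eq_gcd_ab (f 0) g
      have h0 : EuclideanDomain.gcd (f 0) g ≠ 0 := fun h => hg (EuclideanDomain.gcd_eq_zero_iff.mp h).2
      refine mul_left_cancel₀ h0 ?_
      rw [mul_one]
      calc _ = (EuclideanDomain.gcd (f 0) g * a) * EuclideanDomain.gcdA (f 0) g
          + (EuclideanDomain.gcd (f 0) g * b) * EuclideanDomain.gcdB (f 0) g := by ring
        _ = _ := by rw [← ha, ← hb]; exact h1.symm
    have hd0 : d ≠ 0 := by rintro rfl; exact hg (by simpa using hgd)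
    have ha0 : a ≠ 0 := by rintro rfl; exact hf 0 (by simpa using hfd)
    have hb0 : b ≠ 0 := by rintro rfl; exact hg (by simpa using hgd)
    obtain ⟨f', h1, h2, h3, ⟨e⟩⟩ := ih (fun i => f i.succ) d (fun i => hf _) hd0
      (fun i j hij => hd _ _ (Fin.succ_le_succ_iff.mpr hij))
    have hL : ∀ i, f' i ∣ d * a * b := h3 _ ⟨a * b, by ring⟩ fun i =>
      (hd 0 i.succ (Fin.zero_le _)).trans (hfd ▸ Dvd.intro b rfl)
    refine ⟨Fin.cons (d * a * b) f', ?_, ?_, ?_, ⟨?_⟩⟩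
    · intro i
      cases i using Fin.cases with
      | zero => exact mul_ne_zero (mul_ne_zero hd0 ha0) hb0
      | succ i => exact h1 i
    · intro i j hij
      cases j using Fin.cases with
      | zero =>
        obtain rfl : i = 0 := Fin.le_zero_iff.mp hij
        exact dvd_rfl
      | succ j =>
        cases i using Fin.cases with
        | zero => exact hL j
        | succ i => exact h2 i j (Fin.succ_le_succ_iff.mp hij)
    · intro c hgc hfc i
      have hLc : d * a * b ∣ c := by
        have h4 : d * a ∣ c := hfd ▸ hfc 0
        have h5 : d * b ∣ c := hgd ▸ hgc
        obtain ⟨s, rfl⟩ := h4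
        obtain ⟨t, ht⟩ := h5
        have h6 : a * s = b * t := mul_left_cancel₀ hd0 (by linear_combination ht)
        refine ⟨u * t + v * s, ?_⟩
        linear_combination -(d * a * s) * huv + (d * a * u) * h6
      cases i using Fin.cases with
      | zero => exact hLc
      | succ i => exact (hL i).trans hLc
    · have e1 : (Cyc (f 0) × Cyc g) ≃ₗ[k[X]] (Cyc (d * a) × Cyc (d * b)) :=
        LinearEquiv.prodCongr (cycCongr (by rw [hfd])) (cycCongr (by rw [hgd]))
      have e2 : (Cyc g × Cyc (f 0)) ≃ₗ[k[X]] (Cyc (d * a * b) × Cyc d) :=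
        (LinearEquiv.prodComm k[X] _ _).trans (e1.trans (cycSwap d a b u v huv))
      have e3 : (Cyc g × ∀ i, Cyc (f i)) ≃ₗ[k[X]]
          (Cyc g × (Cyc (f 0) × ∀ i : Fin n, Cyc (f i.succ))) :=
        LinearEquiv.prodCongr (LinearEquiv.refl k[X] _)
          (Fin.consLinearEquiv k[X] fun i => Cyc (f i)).symm
      have e4 : (Cyc g × (Cyc (f 0) × ∀ i : Fin n, Cyc (f i.succ))) ≃ₗ[k[X]]
          ((Cyc (d * a * b) × Cyc d) × ∀ i : Fin n, Cyc (f i.succ)) :=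
        (LinearEquiv.prodAssoc k[X] _ _ _).symm.trans
          (LinearEquiv.prodCongr e2 (LinearEquiv.refl k[X] _))
      have e5 : ((Cyc (d * a * b) × Cyc d) × ∀ i : Fin n, Cyc (f i.succ)) ≃ₗ[k[X]]
          (Cyc (d * a * b) × ∀ i, Cyc (f' i)) :=
        (LinearEquiv.prodAssoc k[X] _ _ _).trans
          (LinearEquiv.prodCongr (LinearEquiv.refl k[X] _) e)
      exact e3.trans (e4.trans (e5.trans (Fin.consLinearEquiv k[X]
        fun i => Cyc ((Fin.cons (d * a * b) f' : Fin (n + 2) → k[X]) i))))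

theorem exists_sort (n : ℕ) (g : Fin n → k[X]) (hg : ∀ i, g i ≠ 0) :
    ∃ f : Fin n → k[X], (∀ i, f i ≠ 0) ∧ (∀ i j, i ≤ j → f j ∣ f i) ∧
      Nonempty ((∀ i, Cyc (g i)) ≃ₗ[k[X]] ∀ i, Cyc (f i)) := by
  induction n with
  | zero => exact ⟨g, hg, fun i => i.elim0, ⟨LinearEquiv.refl _ _⟩⟩
  | succ n ih =>
    obtain ⟨f, h1, h2, ⟨e⟩⟩ := ih (fun i => g i.succ) fun i => hg _
    obtain ⟨f', h3, h4, -, ⟨e'⟩⟩ := exists_insert n f (g 0) h1 (hg 0) h2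
    exact ⟨f', h3, h4, ⟨(Fin.consLinearEquiv k[X] fun i => Cyc (g i)).symm.trans
      ((LinearEquiv.prodCongr (LinearEquiv.refl k[X] _) e).trans e')⟩⟩

theorem pi_cyc_truncate (f : ℕ → k[X]) {a b : ℕ} (hab : a ≤ b) (h : ∀ i, a ≤ i → f i = 1) :
    Nonempty ((∀ i : Fin b, Cyc (f i)) ≃ₗ[k[X]] ∀ i : Fin a, Cyc (f i)) := by
  have hs : ∀ i, a ≤ i → Subsingleton (Cyc (f i)) := by
    intro i hi
    rw [h i hi]
    change Subsingleton (k[X] ⧸ Ideal.span {(1 : k[X])})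
    rw [Ideal.span_singleton_one]
    exact Submodule.Quotient.subsingleton_iff.mpr rfl
  let φ : (∀ i : Fin b, Cyc (f i)) →ₗ[k[X]] ∀ i : Fin a, Cyc (f i) :=
    LinearMap.pi (φ := fun i : Fin a => Cyc (f i)) fun i =>
      LinearMap.proj (R := k[X]) (φ := fun i : Fin b => Cyc (f i)) (Fin.castLE hab i)
  refine ⟨LinearEquiv.ofBijective φ ⟨fun x y hxy => ?_, fun y => ?_⟩⟩
  · funext i
    by_cases hi : (i : ℕ) < a
    · exact congrFun hxy ⟨i, hi⟩
    · exact @Subsingleton.elim _ (hs i (not_lt.mp hi)) _ _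
  · refine ⟨fun i => if hi : (i : ℕ) < a then y ⟨i, hi⟩ else 0, ?_⟩
    funext i
    change (if hi : (i : ℕ) < a then y ⟨i, hi⟩ else 0) = y i
    rw [dif_pos i.2]

variable {M : Type*} [AddCommGroup M] [Module k M] [Module k[X] M]
    [IsScalarTower k k[X] M]

/-- A chain of monic polynomials, each dividing the one before. -/
structure IsChainOf (f : ℕ → k[X]) : Prop where
  monic : ∀ i, (f i).Monic
  dvd : ∀ i, f (i + 1) ∣ f i

theorem sum_natDegree_chain [Module.Finite k M] {f : ℕ → k[X]} (hf : ∀ i, (f i).Monic) {n : ℕ}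
    (e : M ≃ₗ[k[X]] ∀ i : Fin n, Cyc (f i)) :
    ∑ i : Fin n, (f i).natDegree = Module.finrank k M := by
  have : ∀ i : Fin n, Module.Finite k (Cyc (f i)) := fun i => finite_cyc (hf i)
  rw [(e.restrictScalars k).finrank_eq, Module.finrank_pi_fintype]
  exact Finset.sum_congr rfl fun i _ => (finrank_cyc (hf i)).symm

/-- The structure theorem: a module of dimension `r` has `r` invariant factors. -/
theorem exists_invariantFactors [Module.Finite k M] {r : ℕ} (hr : Module.finrank k M = r) :
    ∃ f : ℕ → k[X], IsChainOf f ∧ (∀ i, r ≤ i → f i = 1) ∧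
      Nonempty (M ≃ₗ[k[X]] ∀ i : Fin r, Cyc (f i)) := by
  classical
  have hfin : Module.Finite k[X] M := Module.Finite.of_restrictScalars_finite k k[X] M
  have htor : Module.IsTorsion k[X] M := by
    intro m
    refine ⟨⟨chi k M, mem_nonZeroDivisors_of_ne_zero chi_monic.ne_zero⟩, ?_⟩
    have h1 : aeval (xEnd k M) (chi k M) = 0 := LinearMap.aeval_self_charpoly _
    have h2 : aeval (xEnd k M) (chi k M) = Algebra.lsmul k k M (chi k M) := by
      rw [aeval_algHom_apply, aeval_X_left_apply]
    have := congrArg (fun φ => φ m) (h2.symm.trans h1)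
    exact this
  obtain ⟨ι, hι, p, hp, e, ⟨E⟩⟩ := Module.equiv_directSum_of_isTorsion htor
  obtain ⟨n, ⟨σ⟩⟩ := Finite.exists_equiv_fin ι
  obtain ⟨f, h1, h2, ⟨E'⟩⟩ := exists_sort n (fun i => p (σ.symm i) ^ e (σ.symm i))
    fun i => pow_ne_zero _ (hp _).ne_zero
  let F : ℕ → k[X] := fun i => if hi : i < n then normalize (f ⟨i, hi⟩) else 1
  have hF : ∀ i : Fin n, F i = normalize (f i) := fun i => dif_pos i.2
  have hchain : IsChainOf F := by
    constructor
    · intro i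
      by_cases hi : i < n
      · simp only [F, dif_pos hi]
        exact Polynomial.monic_normalize (h1 _)
      · simp only [F, dif_neg hi]
        exact monic_one
    · intro i
      by_cases hi : i + 1 < n
      · simp only [F, dif_pos hi, dif_pos ((Nat.lt_succ_self i).trans hi)]
        exact normalize_dvd_iff.mpr (dvd_normalize_iff.mpr (h2 _ _ (Nat.le_succ i)))
      · simp only [F, dif_neg hi]
        exact one_dvd _
  have E2 : M ≃ₗ[k[X]] ∀ i : Fin n, Cyc (F i) := by
    have a1 : M ≃ₗ[k[X]] ∀ i : ι, Cyc (p i ^ e i) :=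
      E.trans (DirectSum.linearEquivFunOnFintype k[X] ι _)
    have a2 : M ≃ₗ[k[X]] ∀ i : Fin n, Cyc (p (σ.symm i) ^ e (σ.symm i)) :=
      a1.trans (LinearEquiv.piCongrLeft k[X] (fun i : ι => Cyc (p i ^ e i)) σ.symm).symm
    have a3 : (∀ i : Fin n, Cyc (f i)) ≃ₗ[k[X]] ∀ i : Fin n, Cyc (F i) :=
      LinearEquiv.piCongrRight fun i => cycCongr (by
        rw [hF]
        exact (normalize_associated _).symm)
    exact a2.trans (E'.trans a3)
  have hsum := sum_natDegree_chain hchain.monic E2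
  -- If `F_i ≠ 1`, then `F_0, …, F_i` all have positive degree, so `i + 1` is at most the total
  -- degree `r`.
  have h1F : ∀ i, r ≤ i → F i = 1 := by
    intro i hi
    by_contra hne
    have hin : i < n := by
      by_contra hin
      exact hne (dif_neg hin)
    have hpos : ∀ l, l ≤ i → 1 ≤ (F l).natDegree := by
      intro l hl
      by_contra h0
      have : F l = 1 := Polynomial.eq_one_of_monic_natDegree_zero (hchain.monic l) (by omega)
      have h3 := dvd_of_chain hchain.dvd hl
      rw [this] at h3
      exact hne ((hchain.monic i).eq_one_of_isUnit (isUnit_of_dvd_one h3))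
    have : i + 1 ≤ ∑ l : Fin n, (F l).natDegree := by
      rw [Fin.sum_univ_eq_sum_range (fun l => (F l).natDegree) n]
      calc i + 1 = ∑ l ∈ Finset.range (i + 1), 1 := by simp
        _ ≤ ∑ l ∈ Finset.range (i + 1), (F l).natDegree :=
          Finset.sum_le_sum fun l hl => hpos l (by simpa [Nat.lt_succ_iff] using hl)
        _ ≤ _ := Finset.sum_le_sum_of_subset (Finset.range_mono hin)
    omega
  refine ⟨F, hchain, h1F, ?_⟩
  obtain ⟨e1⟩ := pi_cyc_truncate F (Nat.le_max_left n r) fun i hi => dif_neg (not_lt.mpr hi)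
  obtain ⟨e2⟩ := pi_cyc_truncate F (Nat.le_max_right n r) h1F
  exact ⟨E2.trans (e1.symm.trans e2)⟩

end InvariantFactors

/-! ### Krylov matrices -/

section Krylov

open Polynomial

/-- The data of a Krylov matrix: `s` columns `A ^ p v` and `t` constant columns. -/
structure KrylovDatum (k : Type*) (r j s : ℕ) where
  /-- the number of constant columns -/
  t : ℕ
  /-- the numbering of the columns -/
  e : Fin s ⊕ Fin t ≃ Fin r
  /-- the generators -/
  v : Fin j → Fin r → k
  /-- the exponent in a column -/
  pow : Fin s → ℕ
  /-- the generator in a column -/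
  gen : Fin s → Fin j
  /-- the constant columns -/
  w : Fin t → Fin r → k

variable {k : Type*} [Field k] {r j s : ℕ} (D : KrylovDatum k r j s)
variable {B : Type*} [CommRing B] [Algebra k B]

/-- The columns of the Krylov matrix. -/
def KrylovDatum.col (A : Matrix (Fin r) (Fin r) B) : Fin s ⊕ Fin D.t → Fin r → B :=
  Sum.elim (fun a => (A ^ D.pow a).mulVec fun i => algebraMap k B (D.v (D.gen a) i))
    fun b i => algebraMap k B (D.w b i)

/-- The Krylov matrix of `A`. -/
def KrylovDatum.mat (A : Matrix (Fin r) (Fin r) B) : Matrix (Fin r) (Fin r) B :=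
  Matrix.of fun i c => D.col A (D.e.symm c) i

/-- The block of the matrix `A` in the basis given by the Krylov matrix. -/
def KrylovDatum.block (A : Matrix (Fin r) (Fin r) B) : Matrix (Fin s) (Fin s) B :=
  ((D.mat A)⁻¹ * A * D.mat A).submatrix (D.e ∘ Sum.inl) (D.e ∘ Sum.inl)

/-- The characteristic polynomial of the block. -/
def KrylovDatum.blockPoly (A : Matrix (Fin r) (Fin r) B) : B[X] := (D.block A).charpoly

variable {B' : Type*} [CommRing B'] [Algebra k B']

theorem KrylovDatum.mat_map (φ : B →ₐ[k] B') (A : Matrix (Fin r) (Fin r) B) :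
    D.mat (A.map φ) = (D.mat A).map φ := by
  ext i c
  simp only [KrylovDatum.mat, KrylovDatum.col, Matrix.of_apply, Matrix.map_apply]
  rcases D.e.symm c with a | b
  · simp only [Sum.elim_inl]
    have h1 : A.map φ ^ D.pow a = (A ^ D.pow a).map φ :=
      (map_pow (φ.toRingHom.mapMatrix (m := Fin r)) A (D.pow a)).symm
    rw [h1]
    simp [Matrix.mulVec, dotProduct]
  · simp

theorem matrix_inv_map {n : Type*} [Fintype n] [DecidableEq n] (φ : B →ₐ[k] B') {P : Matrix n n B}
    (hP : IsUnit P.det) : (P.map φ)⁻¹ = P⁻¹.map φ := by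
  refine Matrix.inv_eq_left_inv ?_
  have := congrArg (φ.toRingHom.mapMatrix) (Matrix.nonsing_inv_mul P hP)
  rw [map_mul, map_one] at this
  exact this

/-- This compatibility lets the block polynomial of a matrix of functions be evaluated at points
where the Krylov determinant is invertible. -/
theorem KrylovDatum.blockPoly_map (φ : B →ₐ[k] B') (A : Matrix (Fin r) (Fin r) B)
    (hA : IsUnit (D.mat A).det) : D.blockPoly (A.map φ) = (D.blockPoly A).map φ.toRingHom := by
  rw [KrylovDatum.blockPoly, KrylovDatum.blockPoly, ← Matrix.charpoly_map]
  congr 1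
  rw [KrylovDatum.block, D.mat_map, matrix_inv_map φ hA]
  have : (D.mat A)⁻¹.map φ * A.map φ * (D.mat A).map φ = ((D.mat A)⁻¹ * A * D.mat A).map φ := by
    have h1 := map_mul (φ.toRingHom.mapMatrix (m := Fin r)) ((D.mat A)⁻¹ * A) (D.mat A)
    have h2 := map_mul (φ.toRingHom.mapMatrix (m := Fin r)) (D.mat A)⁻¹ A
    exact (h1.trans (congrArg (· * _) h2)).symm
  rw [this]
  rfl

theorem KrylovDatum.det_map (φ : B →ₐ[k] B') (A : Matrix (Fin r) (Fin r) B) :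
    (D.mat (A.map φ)).det = φ (D.mat A).det := by
  rw [D.mat_map]
  exact (AlgHom.map_det φ _).symm

theorem KrylovDatum.blockPoly_monic (A : Matrix (Fin r) (Fin r) B) : (D.blockPoly A).Monic :=
  Matrix.charpoly_monic _

/-- The `k[x]`-module `k ^ r` on which `x` acts by `A`. -/
def MatModule (_ : Matrix (Fin r) (Fin r) k) := Fin r → k

instance (A : Matrix (Fin r) (Fin r) k) : AddCommGroup (MatModule A) :=
  inferInstanceAs (AddCommGroup (Fin r → k))

instance (A : Matrix (Fin r) (Fin r) k) : Module k (MatModule A) :=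
  inferInstanceAs (Module k (Fin r → k))

/-- The endomorphism of `k ^ r` given by a polynomial in `A`. -/
def MatModule.actHom (A : Matrix (Fin r) (Fin r) k) : k[X] →ₐ[k] Module.End k (MatModule A) :=
  aeval (R := k) (A := Module.End k (MatModule A)) (A.mulVecLin : (Fin r → k) →ₗ[k] Fin r → k)

instance (A : Matrix (Fin r) (Fin r) k) : Module k[X] (MatModule A) :=
  Module.compHom (MatModule A) (MatModule.actHom A).toRingHom

instance (A : Matrix (Fin r) (Fin r) k) : IsScalarTower k k[X] (MatModule A) where
  smul_assoc a p m := by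
    change MatModule.actHom A (a • p) m = a • MatModule.actHom A p m
    rw [map_smul]
    rfl

instance (A : Matrix (Fin r) (Fin r) k) : Module.Finite k (MatModule A) :=
  inferInstanceAs (Module.Finite k (Fin r → k))

theorem finrank_matModule (A : Matrix (Fin r) (Fin r) k) : Module.finrank k (MatModule A) = r := by
  change Module.finrank k (Fin r → k) = r
  simp

/-- A vector as an element of the `k[x]`-module of `A`. -/
def MatModule.of (A : Matrix (Fin r) (Fin r) k) : (Fin r → k) ≃ₗ[k] MatModule A :=
  LinearEquiv.refl _ _

theorem MatModule.X_smul (A : Matrix (Fin r) (Fin r) k) (v : Fin r → k) :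
    (X : k[X]) • MatModule.of A v = MatModule.of A (A.mulVec v) := by
  have h : MatModule.actHom A X = (A.mulVecLin : (Fin r → k) →ₗ[k] Fin r → k) := aeval_X _
  exact congrArg (fun φ : Module.End k (Fin r → k) => φ v) h

theorem MatModule.X_pow_smul (A : Matrix (Fin r) (Fin r) k) (n : ℕ) (v : Fin r → k) :
    (X ^ n : k[X]) • MatModule.of A v = MatModule.of A ((A ^ n).mulVec v) := by
  induction n with
  | zero => simp
  | succ n ih => rw [pow_succ', mul_smul, ih, MatModule.X_smul, Matrix.mulVec_mulVec, pow_succ']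

/-- The submodule `k[A] v_1 + ⋯ + k[A] v_j`. -/
def krylovSpan (A : Matrix (Fin r) (Fin r) k) (v : Fin j → Fin r → k) :
    Submodule k[X] (MatModule A) :=
  Submodule.span k[X] (Set.range fun i => MatModule.of A (v i))

theorem krylovSpan_eq (A : Matrix (Fin r) (Fin r) k) (v : Fin j → Fin r → k) :
    (krylovSpan A v).restrictScalars k = Submodule.span k
      (Set.range fun p : ℕ × Fin j => MatModule.of A ((A ^ p.1).mulVec (v p.2))) := by
  apply le_antisymm
  · intro x hx
    have hx' : x ∈ Submodule.span k[X] (Set.range fun i => MatModule.of A (v i)) := hx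
    clear hx
    induction hx' using Submodule.span_induction with
    | mem x h =>
      obtain ⟨i, rfl⟩ := h
      exact Submodule.subset_span ⟨(0, i), by simp⟩
    | zero => exact Submodule.zero_mem _
    | add x y _ _ h1 h2 => exact Submodule.add_mem _ h1 h2
    | smul c x _ h2 =>
      induction c using Polynomial.induction_on' with
      | add p q hp hq => rw [add_smul]; exact Submodule.add_mem _ hp hq
      | monomial n a =>
        rw [← smul_X_eq_monomial, smul_assoc]
        refine Submodule.smul_mem _ _ ?_
        clear * - h2
        induction h2 using Submodule.span_induction with
        | mem x h =>
          obtain ⟨p, rfl⟩ := h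
          refine Submodule.subset_span ⟨(n + p.1, p.2), ?_⟩
          dsimp only
          rw [MatModule.X_pow_smul, Matrix.mulVec_mulVec, pow_add]
        | zero => rw [smul_zero]; exact Submodule.zero_mem _
        | add x y _ _ h1 h2 => rw [smul_add]; exact Submodule.add_mem _ h1 h2
        | smul c x _ h1 => rw [smul_comm]; exact Submodule.smul_mem _ _ h1
  · rw [Submodule.span_le]
    rintro _ ⟨p, rfl⟩
    dsimp only
    rw [← MatModule.X_pow_smul]
    exact (krylovSpan A v).smul_mem _ (Submodule.subset_span ⟨p.2, rfl⟩)

/-- Some submodule generated by `j` elements has dimension at least `s`. -/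
def Reach (A : Matrix (Fin r) (Fin r) k) (j s : ℕ) : Prop :=
  ∃ v : Fin j → Fin r → k, s ≤ Module.finrank k (krylovSpan A v)

theorem KrylovDatum.col_mem (A : Matrix (Fin r) (Fin r) k) (a : Fin s) :
    MatModule.of A (D.col A (Sum.inl a)) ∈ krylovSpan A D.v := by
  change _ ∈ (krylovSpan A D.v).restrictScalars k
  rw [krylovSpan_eq]
  exact Submodule.subset_span ⟨(D.pow a, D.gen a), rfl⟩

theorem KrylovDatum.linearIndependent_col {A : Matrix (Fin r) (Fin r) k}
    (hD : (D.mat A).det ≠ 0) : LinearIndependent k (D.col A) := by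
  have h1 : LinearIndependent k (D.mat A).col := Matrix.linearIndependent_cols_iff_isUnit.mpr
    ((Matrix.isUnit_iff_isUnit_det _).mpr (isUnit_iff_ne_zero.mpr hD))
  have h2 := h1.comp D.e D.e.injective
  convert h2 using 1
  funext c i
  exact congrArg (fun c => D.col A c i) (D.e.symm_apply_apply c).symm

theorem KrylovDatum.linearIndependent_sub {A : Matrix (Fin r) (Fin r) k}
    (hD : (D.mat A).det ≠ 0) : LinearIndependent k fun a : Fin s =>
      (⟨MatModule.of A (D.col A (Sum.inl a)), D.col_mem A a⟩ : krylovSpan A D.v) := by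
  have h1 := (D.linearIndependent_col hD).comp _ Sum.inl_injective
  have h2 : LinearIndependent k fun a : Fin s =>
      ((krylovSpan A D.v).subtype.restrictScalars k)
      (⟨MatModule.of A (D.col A (Sum.inl a)), D.col_mem A a⟩ : krylovSpan A D.v) :=
    h1.map' (MatModule.of A).toLinearMap (MatModule.of A).ker
  exact LinearIndependent.of_comp _ h2

theorem KrylovDatum.reach {A : Matrix (Fin r) (Fin r) k} (hD : (D.mat A).det ≠ 0) :
    Reach A j s :=
  ⟨D.v, by simpa using (D.linearIndependent_sub hD).fintype_card_le_finrank⟩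

/-- Among the spanning vectors `A ^ p v_i` there is a basis of the submodule; `s` of its members are
kept and completed to a basis of `k ^ r` by constant vectors. -/
theorem exists_krylovDatum {A : Matrix (Fin r) (Fin r) k} (h : Reach A j s) :
    ∃ D : KrylovDatum k r j s, (D.mat A).det ≠ 0 := by
  obtain ⟨v, hv⟩ := h
  obtain ⟨κ, a, -, hsp, hli⟩ := exists_linearIndependent' k
    (fun p : ℕ × Fin j => MatModule.of A ((A ^ p.1).mulVec (v p.2)))
  rw [← krylovSpan_eq] at hsp
  have hκ : Finite κ := hli.finite
  have : Fintype κ := Fintype.ofFinite κ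
  have hcard : s ≤ Fintype.card κ := by
    rw [← finrank_span_eq_card hli, hsp]
    exact hv
  obtain ⟨ι⟩ : Nonempty (Fin s ↪ κ) := Function.Embedding.nonempty_of_card_le (by simpa using hcard)
  let c : Fin s → Fin r → k := fun i => (A ^ (a (ι i)).1).mulVec (v (a (ι i)).2)
  have hc : LinearIndependent k c := by
    have h1 := hli.comp ι ι.injective
    exact h1.map' (MatModule.of A).symm.toLinearMap (MatModule.of A).symm.ker
  obtain ⟨W, hW⟩ := Submodule.exists_isCompl (Submodule.span k (Set.range c))
  let b := Module.finBasis k W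
  have hdis : Disjoint (Submodule.span k (Set.range c))
      (Submodule.span k (Set.range fun i => (b i : Fin r → k))) :=
    hW.disjoint.mono_right (Submodule.span_le.mpr (by rintro _ ⟨i, rfl⟩; exact (b i).2))
  have hsum : LinearIndependent k (Sum.elim c fun i => (b i : Fin r → k)) :=
    hc.sum_type (b.linearIndependent.map' W.subtype W.ker_subtype) hdis
  have hdim : s + Module.finrank k W = r := by
    have := Submodule.finrank_add_eq_of_isCompl hW
    rw [finrank_span_eq_card hc] at this
    simpa using this
  let e : Fin s ⊕ Fin (Module.finrank k W) ≃ Fin r := finSumFinEquiv.trans (finCongr hdim)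
  let D : KrylovDatum k r j s :=
    ⟨_, e, v, fun i => (a (ι i)).1, fun i => (a (ι i)).2, fun i => (b i : Fin r → k)⟩
  have hD : ∀ x, D.col A x = Sum.elim c (fun i => (b i : Fin r → k)) x := by
    rintro (x | x) <;> rfl
  refine ⟨D, ?_⟩
  rw [← isUnit_iff_ne_zero, ← Matrix.isUnit_iff_isUnit_det, ← Matrix.linearIndependent_cols_iff_isUnit]
  convert hsum.comp e.symm e.symm.injective using 1
  funext i
  exact hD (e.symm i)

theorem KrylovDatum.exists_basis {A : Matrix (Fin r) (Fin r) k} (hD : (D.mat A).det ≠ 0)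
    (hs : Module.finrank k (krylovSpan A D.v) = s) :
    ∃ b : Module.Basis (Fin s) k (krylovSpan A D.v),
      ∀ a, (b a : MatModule A) = MatModule.of A (D.col A (Sum.inl a)) := by
  have hli := D.linearIndependent_sub hD
  have hc : Fintype.card (Fin s) = Module.finrank k (krylovSpan A D.v) :=
    (Fintype.card_fin s).trans hs.symm
  have hsp := hli.span_eq_top_of_card_eq_finrank' hc
  refine ⟨Module.Basis.mk hli hsp.ge, fun a => ?_⟩
  rw [Module.Basis.mk_apply]

theorem KrylovDatum.mat_mulVec_single (A : Matrix (Fin r) (Fin r) k) (c : Fin s ⊕ Fin D.t) :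
    (D.mat A).mulVec (Pi.single (D.e c) 1) = D.col A c := by
  funext i
  simp [KrylovDatum.mat]

theorem KrylovDatum.block_eq {A : Matrix (Fin r) (Fin r) k} (hD : (D.mat A).det ≠ 0)
    (c : Fin s) (β : Fin s → k)
    (h : ∑ a, β a • D.col A (Sum.inl a) = A.mulVec (D.col A (Sum.inl c))) (a : Fin s) :
    D.block A a c = β a := by
  have hinv : (D.mat A)⁻¹ * D.mat A = 1 := Matrix.nonsing_inv_mul _ (isUnit_iff_ne_zero.mpr hD)
  have h4 := congrArg (D.mat A)⁻¹.mulVec h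
  rw [Matrix.mulVec_sum] at h4
  simp only [Matrix.mulVec_smul, ← D.mat_mulVec_single, Matrix.mulVec_mulVec, hinv,
    Matrix.one_mulVec] at h4
  have h5 := congrFun h4 (D.e (Sum.inl a))
  rw [Finset.sum_apply, Finset.sum_eq_single a] at h5
  · simp only [Pi.smul_apply, Pi.single_eq_same, smul_eq_mul, mul_one,
      Matrix.mulVec_single_one] at h5
    rw [h5, KrylovDatum.block, Matrix.submatrix_apply, mul_assoc]
    rfl
  · intro a' _ ha'
    rw [Pi.smul_apply, Pi.single_eq_of_ne, smul_zero]
    exact fun h => ha' (Sum.inl_injective (D.e.injective h)).symm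
  · simp

/-- When the dimension is exactly `s`, the first family of columns is a basis of an `A`-stable
subspace, and the block is the matrix of `A` on it. -/
theorem KrylovDatum.blockPoly_eq {A : Matrix (Fin r) (Fin r) k} (hD : (D.mat A).det ≠ 0)
    (hs : Module.finrank k (krylovSpan A D.v) = s) :
    D.blockPoly A = chi k (krylovSpan A D.v) := by
  obtain ⟨b, hb⟩ := D.exists_basis hD hs
  rw [chi, ← LinearMap.charpoly_toMatrix _ b, KrylovDatum.blockPoly]
  congr 1
  ext a c
  rw [LinearMap.toMatrix_apply]
  refine D.block_eq hD c _ ?_ a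
  have h2 := congrArg (fun y : krylovSpan A D.v => (MatModule.of A).symm y.1)
    (b.sum_repr (xEnd k _ (b c)))
  have h3 : (MatModule.of A).symm (xEnd k (krylovSpan A D.v) (b c)).1 =
      A.mulVec (D.col A (Sum.inl c)) := by
    change (MatModule.of A).symm ((X : k[X]) • (b c : MatModule A)) = _
    rw [hb, MatModule.X_smul, LinearEquiv.symm_apply_apply]
  simp only [Submodule.coe_sum, map_sum] at h2
  rw [h3] at h2
  rw [← h2]
  refine Finset.sum_congr rfl fun a _ => ?_
  rw [← (MatModule.of A).symm_apply_apply (D.col A (Sum.inl a)), ← hb]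
  rfl

end Krylov

/-! ### Rational canonical form -/

section CanonicalForm

open Polynomial

variable {k : Type u} [Field k] {r : ℕ}
variable {M : Type*} [AddCommGroup M] [Module k M] [Module k[X] M]
    [IsScalarTower k k[X] M]

theorem xSmul_linear_ext {M N : Type*} [AddCommGroup M] [Module k M] [Module k[X] M]
    [IsScalarTower k k[X] M] [AddCommGroup N] [Module k N] [Module k[X] N]
    [IsScalarTower k k[X] N] (φ : M →ₗ[k] N)
    (h : ∀ m, φ ((X : k[X]) • m) = (X : k[X]) • φ m) (p : k[X]) (m : M) :
    φ (p • m) = p • φ m := by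
  induction p using Polynomial.induction_on' generalizing m with
  | add p q hp hq => rw [add_smul, add_smul, map_add, hp, hq]
  | monomial n a =>
    rw [← smul_X_eq_monomial, smul_assoc, smul_assoc, map_smul]
    congr 1
    induction n generalizing m with
    | zero => simp
    | succ n ih => rw [pow_succ, mul_smul, mul_smul, ih, h]

/-- A `k`-linear equivalence that commutes with `x` is `k[x]`-linear. -/
def equivOfX {M N : Type*} [AddCommGroup M] [Module k M] [Module k[X] M]
    [IsScalarTower k k[X] M] [AddCommGroup N] [Module k N] [Module k[X] N]
    [IsScalarTower k k[X] N] (φ : M ≃ₗ[k] N)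
    (h : ∀ m, φ ((X : k[X]) • m) = (X : k[X]) • φ m) : M ≃ₗ[k[X]] N :=
  { φ with map_smul' := xSmul_linear_ext φ.toLinearMap h }

/-- The `k[x]`-module of the matrix of `x` in a basis. -/
def matModuleEquiv (b : Module.Basis (Fin r) k M) :
    MatModule (LinearMap.toMatrix b b (xEnd k M)) ≃ₗ[k[X]] M :=
  equivOfX ((MatModule.of _).symm.trans b.equivFun.symm) (by
    intro m
    obtain ⟨v, rfl⟩ := (MatModule.of _).surjective m
    rw [MatModule.X_smul]
    simp only [LinearEquiv.trans_apply, LinearEquiv.symm_apply_apply]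
    apply b.equivFun.injective
    rw [LinearEquiv.apply_symm_apply]
    have h := LinearMap.toMatrix_mulVec_repr b b (xEnd k M) (b.equivFun.symm v)
    have h2 : (b.repr (b.equivFun.symm v) : Fin r → k) = v := b.equivFun.apply_symm_apply v
    rw [h2] at h
    rw [h]
    rfl)

theorem isConj_of_equiv (A B : GL (Fin r) k)
    (e : MatModule (A : Matrix (Fin r) (Fin r) k) ≃ₗ[k[X]]
      MatModule (B : Matrix (Fin r) (Fin r) k)) : IsConj A B := by
  let φ : (Fin r → k) ≃ₗ[k] (Fin r → k) :=
    ((MatModule.of _).trans (e.restrictScalars k)).trans (MatModule.of _).symm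
  have hφ : ∀ v, φ ((A : Matrix (Fin r) (Fin r) k).mulVec v) = (B : Matrix (Fin r) (Fin r) k).mulVec (φ v) := by
    intro v
    have h1 : φ ((A : Matrix (Fin r) (Fin r) k).mulVec v) =
        (MatModule.of _).symm (e ((X : k[X]) • MatModule.of _ v)) := by
      rw [MatModule.X_smul]
      rfl
    rw [h1, map_smul]
    apply (MatModule.of (B : Matrix (Fin r) (Fin r) k)).injective
    rw [← MatModule.X_smul, LinearEquiv.apply_symm_apply]
    rfl
  let P : GL (Fin r) k := Matrix.GeneralLinearGroup.mkOfDetNeZero (LinearMap.toMatrix' φ.toLinearMap) (by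
    rw [LinearMap.det_toMatrix']
    exact (LinearEquiv.isUnit_det' φ).ne_zero)
  refine isConj_iff.mpr ⟨P, ?_⟩
  rw [mul_inv_eq_iff_eq_mul]
  apply Units.ext
  apply Matrix.toLin'.injective
  have hP : Matrix.toLin' P.1 = φ.toLinearMap := Matrix.toLin'_toMatrix' _
  rw [Units.val_mul, Units.val_mul, Matrix.toLin'_mul, Matrix.toLin'_mul, hP]
  exact LinearMap.ext hφ

/-- A basis of the `k[x]`-module of a matrix gives an equivalence for conjugate matrices. -/
theorem exists_equiv_of_isConj {A B : GL (Fin r) k} (h : IsConj A B) :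
    Nonempty (MatModule (A : Matrix (Fin r) (Fin r) k) ≃ₗ[k[X]]
      MatModule (B : Matrix (Fin r) (Fin r) k)) := by
  obtain ⟨P, hP⟩ := isConj_iff.mp h
  rw [mul_inv_eq_iff_eq_mul] at hP
  let φ : (Fin r → k) ≃ₗ[k] (Fin r → k) := Matrix.toLin'OfInv
    (M := ((P⁻¹ : GL (Fin r) k) : Matrix (Fin r) (Fin r) k)) (M' := (P : Matrix (Fin r) (Fin r) k))
    (by rw [← Units.val_mul, inv_mul_cancel, Units.val_one])
    (by rw [← Units.val_mul, mul_inv_cancel, Units.val_one])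
  refine ⟨equivOfX (((MatModule.of _).symm.trans φ).trans (MatModule.of _)) fun m => ?_⟩
  obtain ⟨v, rfl⟩ := (MatModule.of _).surjective m
  rw [MatModule.X_smul]
  simp only [LinearEquiv.trans_apply, LinearEquiv.symm_apply_apply]
  rw [MatModule.X_smul]
  congr 1
  have hφ : ∀ w, φ w = P.1.mulVec w := fun w => Matrix.toLin'_apply _ _
  rw [hφ, hφ]
  rw [Matrix.mulVec_mulVec, Matrix.mulVec_mulVec]
  exact congrArg (fun Q : GL (Fin r) k => (Q : Matrix (Fin r) (Fin r) k).mulVec v) hP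

/-- `f_0, f_1, …` are the invariant factors of the matrix `A`. -/
structure HasInvariantFactors (A : Matrix (Fin r) (Fin r) k) (f : ℕ → k[X]) : Prop where
  chain : IsChainOf f
  eq_one : ∀ i, r ≤ i → f i = 1
  equiv : Nonempty (MatModule A ≃ₗ[k[X]] ∀ i : Fin r, Cyc (f i))

theorem exists_hasInvariantFactors (A : Matrix (Fin r) (Fin r) k) :
    ∃ f, HasInvariantFactors A f := by
  obtain ⟨f, h1, h2, h3⟩ := exists_invariantFactors (M := MatModule A) (finrank_matModule A)
  exact ⟨f, h1, h2, h3⟩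

namespace HasInvariantFactors

variable {A : Matrix (Fin r) (Fin r) k} {f : ℕ → k[X]} (h : HasInvariantFactors A f)
include h

theorem sum_natDegree : ∑ i : Fin r, (f i).natDegree = r := by
  obtain ⟨e⟩ := h.equiv
  rw [sum_natDegree_chain h.chain.monic e, finrank_matModule]

theorem chi_krylovSpan_dvd [Infinite k] {j : ℕ} (v : Fin j → Fin r → k) :
    chi k (krylovSpan A v) ∣ ∏ i : Fin j, f i := by
  obtain ⟨e⟩ := h.equiv
  exact chi_span_dvd f h.chain.monic h.chain.dvd e _

theorem natDegree_prod (j : ℕ) :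
    (∏ i : Fin j, f i).natDegree = ∑ i : Fin j, (f i).natDegree :=
  natDegree_prod_of_monic _ _ fun i _ => h.chain.monic i

theorem finrank_krylovSpan_le [Infinite k] {j : ℕ} (v : Fin j → Fin r → k) :
    Module.finrank k (krylovSpan A v) ≤ ∑ i : Fin j, (f i).natDegree := by
  rw [← natDegree_chi, ← h.natDegree_prod]
  exact natDegree_le_of_dvd (h.chi_krylovSpan_dvd v)
    (monic_prod_of_monic Finset.univ (fun i : Fin j => f i) fun i _ => h.chain.monic i).ne_zero

/-- The bound of `finrank_krylovSpan_le` is attained by the generators of the first `j` cyclic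
summands. -/
theorem reach {j : ℕ} (hj : j ≤ r) : Reach A j (∑ i : Fin j, (f i).natDegree) := by
  classical
  obtain ⟨e⟩ := h.equiv
  have : ∀ i : Fin j, Module.Finite k (Cyc (f i)) := fun i => finite_cyc (h.chain.monic i)
  let u : Fin j → ∀ i : Fin r, Cyc (f i) :=
    fun l => Pi.single (M := fun i : Fin r => Cyc (f i)) (Fin.castLE hj l) (Submodule.Quotient.mk 1)
  let ι : (∀ i : Fin j, Cyc (f i)) →ₗ[k[X]] ∀ i : Fin r, Cyc (f i) :=
    LinearMap.pi (φ := fun i : Fin r => Cyc (f i)) fun i => if hi : (i : ℕ) < j then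
      LinearMap.proj (R := k[X]) (φ := fun i : Fin j => Cyc (f i)) ⟨i, hi⟩ else 0
  have hι : ∀ m (i : Fin r), ι m i = if hi : (i : ℕ) < j then m ⟨i, hi⟩ else 0 := by
    intro m i
    change (if hi : (i : ℕ) < j then
      LinearMap.proj (R := k[X]) (φ := fun i : Fin j => Cyc (f i)) ⟨i, hi⟩ else 0 :
      (∀ i : Fin j, Cyc (f i)) →ₗ[k[X]] Cyc (f i)) m = _
    split_ifs <;> rfl
  have hinj : Function.Injective ι := by
    intro m m' hm
    funext i
    have := congrFun hm (Fin.castLE hj i)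
    rw [hι, hι] at this
    simpa using this
  refine ⟨fun l => (MatModule.of A).symm (e.symm (u l)), ?_⟩
  let κ : (∀ i : Fin j, Cyc (f i)) →ₗ[k[X]] MatModule A := e.symm.toLinearMap.comp ι
  have hκ : ∀ m, κ m ∈ krylovSpan A fun l => (MatModule.of A).symm (e.symm (u l)) := by
    intro m
    choose x hx using fun i => Submodule.Quotient.mk_surjective _ (m i)
    have h1 : ι m = ∑ l, x l • u l := by
      funext i
      rw [hι, Finset.sum_apply]
      simp only [Pi.smul_apply, u]
      split_ifs with hi
      · rw [Finset.sum_eq_single ⟨i, hi⟩]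
        · rw [← hx ⟨i, hi⟩]
          have : Fin.castLE hj ⟨i, hi⟩ = i := rfl
          rw [this, Pi.single_eq_same, ← Submodule.Quotient.mk_smul, smul_eq_mul, mul_one]
        · intro l _ hl
          rw [Pi.single_eq_of_ne, smul_zero]
          intro h
          exact hl (Fin.ext (congrArg Fin.val h).symm)
        · simp
      · refine (Finset.sum_eq_zero fun l _ => ?_).symm
        rw [Pi.single_eq_of_ne, smul_zero]
        intro h
        exact hi ((congrArg Fin.val h).trans_lt l.2)
    have h2 : κ m = ∑ l, x l • e.symm (u l) := by
      change e.symm (ι m) = _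
      rw [h1, map_sum]
      exact Finset.sum_congr rfl fun l _ => map_smul _ _ _
    rw [h2]
    refine Submodule.sum_mem _ fun l _ => Submodule.smul_mem _ _ ?_
    exact Submodule.subset_span ⟨l, by simp⟩
  have h3 := LinearMap.finrank_le_finrank_of_injective
    (f := (κ.codRestrict _ hκ).restrictScalars k) (by
      intro m m' hm
      exact hinj (e.symm.injective (congrArg Subtype.val hm)))
  refine le_trans (le_of_eq ?_) h3
  rw [Module.finrank_pi_fintype]
  exact Finset.sum_congr rfl fun i _ => (finrank_cyc (h.chain.monic i)).symm

theorem reach_iff [Infinite k] {j s : ℕ} (hj : j ≤ r) :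
    Reach A j s ↔ s ≤ ∑ i : Fin j, (f i).natDegree := by
  constructor
  · rintro ⟨v, hv⟩
    exact hv.trans (h.finrank_krylovSpan_le v)
  · intro hs
    obtain ⟨v, hv⟩ := h.reach hj
    exact ⟨v, hs.trans hv⟩

/-- In the extremal case the divisibility of `chi_krylovSpan_dvd` is between monic polynomials of
equal degree, hence an equality, whatever generators are used. -/
theorem blockPoly_eq [Infinite k] {j s : ℕ} (hs : s = ∑ i : Fin j, (f i).natDegree)
    (D : KrylovDatum k r j s) (hD : (D.mat A).det ≠ 0) :
    D.blockPoly A = ∏ i : Fin j, f i := by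
  have h1 : s ≤ Module.finrank k (krylovSpan A D.v) := by
    simpa using (D.linearIndependent_sub hD).fintype_card_le_finrank
  have h2 := h.finrank_krylovSpan_le D.v
  rw [← hs] at h2
  have h3 : Module.finrank k (krylovSpan A D.v) = s := le_antisymm h2 h1
  rw [D.blockPoly_eq hD h3]
  have h4 := h.chi_krylovSpan_dvd D.v
  have h5 : (∏ i : Fin j, f i).Monic :=
    monic_prod_of_monic Finset.univ (fun i : Fin j => f i) fun i _ => h.chain.monic i
  have h6 : (∏ i : Fin j, f i).natDegree ≤ (chi k (krylovSpan A D.v)).natDegree := by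
    rw [h.natDegree_prod, natDegree_chi, h3, hs]
  exact (Polynomial.eq_of_monic_of_dvd_of_natDegree_le chi_monic h5 h4 h6).symm

theorem charpoly_eq : A.charpoly = ∏ i : Fin r, f i := by
  obtain ⟨e⟩ := h.equiv
  have : ∀ i : Fin r, Module.Finite k (Cyc (f i)) := fun i => finite_cyc (h.chain.monic i)
  have h1 : chi k (MatModule A) = A.charpoly := by
    rw [← Matrix.charpoly_mulVecLin, chi]
    have : xEnd k (MatModule A) = (A.mulVecLin : (Fin r → k) →ₗ[k] Fin r → k) :=
      LinearMap.ext fun v => MatModule.X_smul A v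
    rw [this]
    rfl
  rw [← h1, chi_congr e, chi_pi]
  exact Finset.prod_congr rfl fun i _ => chi_cyc (h.chain.monic i)

theorem det_ne_zero_iff : A.det ≠ 0 ↔ ∀ i, (f i).coeff 0 ≠ 0 := by
  rw [Matrix.det_eq_sign_charpoly_coeff, h.charpoly_eq, coeff_zero_prod]
  constructor
  · intro h1 i
    by_cases hi : i < r
    · exact Finset.prod_ne_zero_iff.mp (right_ne_zero_of_mul h1) ⟨i, hi⟩ (Finset.mem_univ _)
    · rw [h.eq_one i (not_lt.mp hi)]
      simp
  · intro h1
    refine mul_ne_zero (pow_ne_zero _ (by simp)) (Finset.prod_ne_zero_iff.mpr fun i _ => h1 i)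

omit h in
theorem congr {A B : GL (Fin r) k} {f : ℕ → k[X]} (h : HasInvariantFactors (A : Matrix (Fin r) (Fin r) k) f)
    (hAB : IsConj A B) : HasInvariantFactors (B : Matrix (Fin r) (Fin r) k) f := by
  obtain ⟨e⟩ := h.equiv
  obtain ⟨e'⟩ := exists_equiv_of_isConj hAB
  exact ⟨h.chain, h.eq_one, ⟨e'.symm.trans e⟩⟩

omit h in
theorem isConj {A B : GL (Fin r) k} {f : ℕ → k[X]} (hA : HasInvariantFactors (A : Matrix (Fin r) (Fin r) k) f)
    (hB : HasInvariantFactors (B : Matrix (Fin r) (Fin r) k) f) : IsConj A B := by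
  obtain ⟨e⟩ := hA.equiv
  obtain ⟨e'⟩ := hB.equiv
  exact isConj_of_equiv A B (e.trans e'.symm)

end HasInvariantFactors

/-- The companion matrix of a monic polynomial of degree `d`. -/
def companionMat {B : Type*} [CommRing B] (d : ℕ) (p : B[X]) : Matrix (Fin d) (Fin d) B :=
  Matrix.of fun i j => if (j : ℕ) + 1 = d then -p.coeff i else if (i : ℕ) = j + 1 then 1 else 0

/-- The block diagonal matrix of the companion matrices of monic polynomials of degrees
`d_0, d_1, …`. -/
def canonicalForm {B : Type*} [CommRing B] (d : Fin r → ℕ) (hd : ∑ i, d i = r) (f : Fin r → B[X]) :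
    Matrix (Fin r) (Fin r) B :=
  Matrix.reindex (finSigmaFinEquiv.trans (finCongr hd)) (finSigmaFinEquiv.trans (finCongr hd))
    (Matrix.blockDiagonal' fun i => companionMat (d i) (f i))

theorem canonicalForm_map {B B' : Type*} [CommRing B] [CommRing B'] (φ : B →+* B')
    (d : Fin r → ℕ) (hd : ∑ i, d i = r) (f : Fin r → B[X]) :
    (canonicalForm d hd f).map φ = canonicalForm d hd fun i => (f i).map φ := by
  rw [canonicalForm, canonicalForm, Matrix.reindex_apply, Matrix.reindex_apply,
    ← Matrix.submatrix_map, Matrix.blockDiagonal'_map _ _ (map_zero φ)]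
  congr 2
  funext i
  ext a b
  simp only [companionMat, Matrix.map_apply, Matrix.of_apply]
  split_ifs <;> simp

theorem hasInvariantFactors_canonicalForm {f : ℕ → k[X]} (hf : IsChainOf f)
    (h1 : ∀ i, r ≤ i → f i = 1) (d : Fin r → ℕ) (hfd : ∀ i : Fin r, (f i).natDegree = d i)
    (hd : ∑ i, d i = r) : HasInvariantFactors (canonicalForm d hd fun i => f i) f := by
  refine ⟨hf, h1, ?_⟩
  obtain rfl : d = fun i : Fin r => (f i).natDegree := funext fun i => (hfd i).symm
  -- In the bases `1, x, x ^ 2, …` of the cyclic summands, multiplication by `x` is the block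
  -- diagonal matrix of companion matrices.
  let b : Module.Basis (Fin r) k (∀ i : Fin r, Cyc (f i)) :=
    (Pi.basis fun i : Fin r => cycBasis (hf.monic i)).reindex
      (finSigmaFinEquiv.trans (finCongr hd))
  have hb : LinearMap.toMatrix b b (xEnd k _) =
      canonicalForm (fun i : Fin r => (f i).natDegree) hd fun i => f i := by
    ext i j
    obtain ⟨⟨i, a⟩, rfl⟩ := (finSigmaFinEquiv.trans (finCongr hd)).surjective i
    obtain ⟨⟨j, c⟩, rfl⟩ := (finSigmaFinEquiv.trans (finCongr hd)).surjective j
    rw [canonicalForm, Matrix.reindex_apply, Matrix.submatrix_apply, Equiv.symm_apply_apply,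
      Equiv.symm_apply_apply, LinearMap.toMatrix_apply, Module.Basis.reindex_apply,
      Module.Basis.repr_reindex_apply, Equiv.symm_apply_apply, Equiv.symm_apply_apply,
      Pi.basis_repr, Matrix.blockDiagonal'_apply]
    have e1 : xEnd k (∀ i : Fin r, Cyc (f i))
        (Pi.basis (fun i : Fin r => cycBasis (hf.monic i)) ⟨j, c⟩) i =
        xEnd k (Cyc (f i)) (Pi.basis (fun i : Fin r => cycBasis (hf.monic i)) ⟨j, c⟩ i) := rfl
    rw [e1, Pi.basis_apply]
    by_cases hij : i = j
    · obtain rfl := hij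
      rw [Pi.single_eq_same, ← LinearMap.toMatrix_apply, toMatrix_cycBasis, dif_pos rfl]
      rfl
    · rw [Pi.single_eq_of_ne hij, map_zero, map_zero, dif_neg hij]
      rfl
  rw [← hb]
  exact ⟨matModuleEquiv b⟩

end CanonicalForm

/-! ### Reduced subvarieties and `k`-points -/

section Varieties

variable {k : Type u} [Field k]

instance (X : Var k) : LocallyOfFiniteType X.obj.hom := X.property.1

instance (X : Var k) : QuasiCompact X.obj.hom := X.property.2.1

instance (X : Var k) : IsSeparated X.obj.hom := X.property.2.2

instance (X : Var k) : CompactSpace X.scheme := by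
  have := QuasiCompact.isCompact_preimage (f := X.obj.hom) Set.univ isOpen_univ isCompact_univ
  rw [Set.preimage_univ] at this
  exact ⟨this⟩

instance (X : Var k) : IsLocallyNoetherian X.scheme :=
  LocallyOfFiniteType.isLocallyNoetherian X.obj.hom

instance (X : Var k) : IsNoetherian X.scheme where

instance (X : Var k) : JacobsonSpace X.scheme := LocallyOfFiniteType.jacobsonSpace X.obj.hom

theorem mor_hom {X Y : Var k} (f : X ⟶ Y) : Var.mor f ≫ Y.obj.hom = X.obj.hom := Over.w f.hom

theorem mor_injective {X Y : Var k} {f g : X ⟶ Y} (h : Var.mor f = Var.mor g) : f = g := by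
  apply InducedCategory.hom_ext
  exact Over.OverMorphism.ext h

/-- A morphism of varieties from a morphism of schemes. -/
def homMk {X Y : Var k} (f : X.scheme ⟶ Y.scheme) (h : f ≫ Y.obj.hom = X.obj.hom) : X ⟶ Y :=
  ObjectProperty.homMk (Over.homMk f h)

@[simp]
theorem mor_homMk {X Y : Var k} (f : X.scheme ⟶ Y.scheme) (h : f ≫ Y.obj.hom = X.obj.hom) :
    Var.mor (homMk f h) = f := rfl

@[simp]
theorem mor_comp {X Y Z : Var k} (f : X ⟶ Y) (g : Y ⟶ Z) :
    Var.mor (f ≫ g) = Var.mor f ≫ Var.mor g := rfl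

@[simp]
theorem mor_id (X : Var k) : Var.mor (𝟙 X) = 𝟙 X.scheme := rfl

theorem isIso_of_mor {X Y : Var k} (f : X ⟶ Y) [IsIso (Var.mor f)] : IsIso f := by
  refine ⟨homMk (inv (Var.mor f)) ?_, mor_injective ?_, mor_injective ?_⟩
  · rw [IsIso.inv_comp_eq, mor_hom]
  · simp
  · simp

/-- A morphism from a reduced scheme lifts through an immersion that contains its image. -/
theorem exists_lift_immersion {T S X : Scheme.{u}} [IsReduced T] (f : T ⟶ X) (i : S ⟶ X)
    [IsImmersion i] (h : Set.range f ⊆ Set.range i) : ∃ g : T ⟶ S, g ≫ i = f := by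
  -- The base change of `i` to `T` is a surjective immersion, thus a closed one, and a surjective
  -- closed immersion into a reduced scheme is an isomorphism.
  have hs : Function.Surjective (Limits.pullback.fst f i) := by
    rw [← Set.range_eq_univ, Scheme.Pullback.range_fst]
    exact Set.eq_univ_of_forall fun t => h ⟨t, rfl⟩
  have : Surjective (Limits.pullback.fst f i) := ⟨hs⟩
  have : IsClosedImmersion (Limits.pullback.fst f i) :=
    .of_isPreimmersion _ (by rw [hs.range_eq]; exact isClosed_univ)
  have := isIso_of_isClosedImmersion_of_surjective (Limits.pullback.fst f i)
  exact ⟨inv (Limits.pullback.fst f i) ≫ Limits.pullback.snd f i, by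
    rw [Category.assoc, ← Limits.pullback.condition, IsIso.inv_hom_id_assoc]⟩

theorem exists_lift {T S X : Var k} [IsReduced T.scheme] (f : T ⟶ X) (i : S ⟶ X)
    [IsImmersion (Var.mor i)] (h : Set.range (Var.mor f) ⊆ Set.range (Var.mor i)) :
    ∃ g : T ⟶ S, g ≫ i = f := by
  obtain ⟨g, hg⟩ := exists_lift_immersion (Var.mor f) (Var.mor i) h
  refine ⟨homMk g ?_, mor_injective hg⟩
  rw [← mor_hom i, reassoc_of% hg, mor_hom]

theorem isReduced_vanishingIdeal_subscheme {X : Scheme.{u}} (Z : TopologicalSpace.Closeds X) :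
    IsReduced (Scheme.IdealSheafData.vanishingIdeal Z).subscheme := by
  have (U : X.affineOpens) : AlgebraicGeometry.IsReduced ((Scheme.IdealSheafData.vanishingIdeal Z).subschemeCover.openCover.X U) := by
    change AlgebraicGeometry.IsReduced (Spec (CommRingCat.of
      (Γ(X, U.1) ⧸ (Scheme.IdealSheafData.vanishingIdeal Z).ideal U)))
    have : _root_.IsReduced (Γ(X, U.1) ⧸ (Scheme.IdealSheafData.vanishingIdeal Z).ideal U) := by
      rw [← Ideal.isRadical_iff_quotient_reduced, Scheme.IdealSheafData.vanishingIdeal_ideal]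
      exact PrimeSpectrum.isRadical_vanishingIdeal _
    infer_instance
  have : ∀ U, AlgebraicGeometry.IsReduced (
      (Scheme.IdealSheafData.vanishingIdeal Z).subschemeCover.openCover.X U) := this
  exact IsReduced.of_openCover _
    (Scheme.IdealSheafData.vanishingIdeal Z).subschemeCover.openCover

/-- Every locally closed subset is the image of an immersion of a reduced scheme. -/
theorem exists_reduced_immersion {X : Scheme.{u}} {T : Set X} (hT : IsLocallyClosed T) :
    ∃ (Y : Scheme.{u}) (i : Y ⟶ X), IsReduced Y ∧ IsImmersion i ∧ Set.range i = T := by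
  obtain ⟨U, Z, hU, hZ, rfl⟩ := hT
  let O : X.Opens := ⟨U, hU⟩
  let C : TopologicalSpace.Closeds O.toScheme := ⟨O.ι ⁻¹' Z, hZ.preimage O.ι.continuous⟩
  refine ⟨_, (Scheme.IdealSheafData.vanishingIdeal C).subschemeι ≫ O.ι,
    isReduced_vanishingIdeal_subscheme C, inferInstance, ?_⟩
  rw [Scheme.Hom.comp_base]
  change Set.range (O.ι ∘ (Scheme.IdealSheafData.vanishingIdeal C).subschemeι) = _
  rw [Set.range_comp, Scheme.IdealSheafData.range_subschemeι,
    Scheme.IdealSheafData.coe_support_vanishingIdeal]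
  change O.ι '' (O.ι ⁻¹' Z) = _
  rw [Set.image_preimage_eq_range_inter, Scheme.Opens.range_ι]
  rfl

theorem exists_reduced {X : Var k} {T : Set X.scheme} (hT : IsLocallyClosed T) :
    ∃ (Y : Var k) (i : Y ⟶ X), IsReduced Y.scheme ∧ IsImmersion (Var.mor i) ∧
      Set.range (Var.mor i) = T := by
  obtain ⟨Y, i, h1, h2, h3⟩ := exists_reduced_immersion hT
  have : TopologicalSpace.NoetherianSpace Y := i.isEmbedding.isInducing.noetherianSpace
  have : QuasiCompact i := inferInstance
  exact ⟨⟨Over.mk (i ≫ X.obj.hom), inferInstanceAs (LocallyOfFiniteType (i ≫ X.obj.hom)),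
    inferInstanceAs (QuasiCompact (i ≫ X.obj.hom)), inferInstanceAs (IsSeparated (i ≫ X.obj.hom))⟩,
    homMk i rfl, h1, h2, h3⟩

theorem isImmersion_mor_mono {X Y : Var k} (i : X ⟶ Y) [IsImmersion (Var.mor i)] : Mono i :=
  ⟨fun _ _ h => mor_injective ((cancel_mono (Var.mor i)).mp (congrArg Var.mor h))⟩

/-! ### Density of the `k`-points -/

section Points

/-- The closed point that underlies a `k`-point. -/
def Var.point {X : Var k} (p : pt k ⟶ X) : X.scheme :=
  Var.mor p (IsLocalRing.closedPoint k : Spec (CommRingCat.of k))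

theorem point_comp {X Y : Var k} (p : pt k ⟶ X) (f : X ⟶ Y) :
    Var.point (p ≫ f) = Var.mor f (Var.point p) := rfl

theorem mor_pt_apply {X : Var k} (p : pt k ⟶ X) (a : (pt k).scheme) :
    Var.mor p a = Var.point p :=
  congrArg (Var.mor p) (Subsingleton.elim (α := Spec (CommRingCat.of k)) _ _)

theorem range_mor_pt {X : Var k} (p : pt k ⟶ X) : Set.range (Var.mor p) = {Var.point p} := by
  ext x
  constructor
  · rintro ⟨a, rfl⟩
    exact mor_pt_apply p a
  · rintro rfl
    exact ⟨_, rfl⟩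

theorem exists_lift_point {S X : Var k} (i : S ⟶ X) [IsImmersion (Var.mor i)] (p : pt k ⟶ X)
    (h : Var.point p ∈ Set.range (Var.mor i)) : ∃ p' : pt k ⟶ S, p' ≫ i = p := by
  have : IsReduced (pt k).scheme := inferInstanceAs (IsReduced (Spec (CommRingCat.of k)))
  refine exists_lift p i ?_
  rw [range_mor_pt]
  simpa using h

variable [IsAlgClosed k]

theorem exists_point_of_isClosed {X : Var k} {x : X.scheme} (hx : IsClosed {x}) :
    ∃ p : pt k ⟶ X, Var.point p = x :=
  ⟨homMk (pointOfClosedPoint X.obj.hom x hx) (pointOfClosedPoint_comp _ _ _),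
    pointOfClosedPoint_apply _ _ _ _⟩

theorem exists_point_mem {X : Var k} {T : Set X.scheme} (hT : IsLocallyClosed T)
    (hne : T.Nonempty) : ∃ p : pt k ⟶ X, Var.point p ∈ T := by
  obtain ⟨x, hx, hx'⟩ := nonempty_inter_closedPoints hne hT
  obtain ⟨p, rfl⟩ := exists_point_of_isClosed hx'
  exact ⟨p, hx⟩

/-- With `T = U ∩ Z`, the complements of `U` and `Z` are locally closed and would contain a
`k`-point if they were nonempty. This reduces set-theoretic claims to `k`-points. -/
theorem eq_univ_of_points {X : Var k} {T : Set X.scheme} (hT : IsLocallyClosed T)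
    (h : ∀ p : pt k ⟶ X, Var.point p ∈ T) : T = Set.univ := by
  obtain ⟨U, Z, hU, hZ, rfl⟩ := hT
  refine Set.eq_univ_of_univ_subset (Set.subset_inter (Set.univ_subset_iff.mpr ?_)
    (Set.univ_subset_iff.mpr ?_))
  · by_contra hne
    obtain ⟨p, hp⟩ := exists_point_mem hU.isClosed_compl.isLocallyClosed
      (Set.nonempty_compl.mpr hne)
    exact hp (h p).1
  · by_contra hne
    obtain ⟨p, hp⟩ := exists_point_mem hZ.isOpen_compl.isLocallyClosed
      (Set.nonempty_compl.mpr hne)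
    exact hp (h p).2

theorem range_subset_of_points {Y X : Var k} (f : Y ⟶ X) {T : Set X.scheme}
    (hT : IsLocallyClosed T) (h : ∀ p : pt k ⟶ Y, Var.point (p ≫ f) ∈ T) :
    Set.range (Var.mor f) ⊆ T := by
  rw [← Set.preimage_eq_univ_iff]
  exact eq_univ_of_points (hT.preimage (Var.mor f).continuous) h

theorem hom_ext_points {X Y : Var k} [IsReduced X.scheme] {f g : X ⟶ Y}
    (h : ∀ p : pt k ⟶ X, p ≫ f = p ≫ g) : f = g := by
  apply mor_injective
  have : LocallyOfFiniteType (Var.mor f ≫ Y.obj.hom) := by rw [mor_hom]; infer_instance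
  refine ext_of_apply_eq Y.obj.hom Set.univ isClosed_univ.isLocallyClosed dense_univ ?_
    (by rw [mor_hom, mor_hom])
  intro x _ hx
  obtain ⟨p, rfl⟩ := exists_point_of_isClosed hx
  rw [← point_comp, ← point_comp, h]

end Points

end Varieties

/-! ### Additivity in the Grothendieck ring -/

section Additivity

variable {k : Type u} [Field k]

theorem cls_congr {X Y : Var k} (e : X ≅ Y) : cls X = cls Y := by
  have : toSkeleton X = toSkeleton Y := Quotient.sound ⟨e⟩
  rw [cls, cls, FreeVar.of, FreeVar.of, this]

theorem cls_eq_of_isIso {X Y : Var k} (f : X ⟶ Y) [IsIso (Var.mor f)] : cls X = cls Y := by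
  have := isIso_of_mor f
  exact cls_congr (asIso f)

theorem cls_tensor (X Y : Var k) : cls (X ⊗ Y) = cls X * cls Y := by
  rw [cls, cls, cls, ← map_mul, FreeVar.of, FreeVar.of, FreeVar.of, ← map_mul,
    ← Skeleton.toSkeleton_tensorObj]

theorem cls_pt : cls (pt k) = 1 := by
  rw [cls, FreeVar.of, ← map_one (Ideal.Quotient.mk (Ideal.span (scissor k))),
    ← map_one (MonoidAlgebra.of ℤ (Skeleton (Var k)))]
  rfl

theorem cls_eq_add {X Z U : Var k} (i : Z ⟶ X) (j : U ⟶ X) [IsClosedImmersion (Var.mor i)]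
    [IsOpenImmersion (Var.mor j)] (h : Set.range (Var.mor j) = (Set.range (Var.mor i))ᶜ) :
    cls X = cls U + cls Z := by
  have h1 : FreeVar.of X - (FreeVar.of U + FreeVar.of Z) ∈ Ideal.span (scissor k) :=
    Ideal.subset_span ⟨X, Z, U, i, j, inferInstance, inferInstance, h, rfl⟩
  rw [cls, cls, cls, ← map_add]
  exact Ideal.Quotient.eq.mpr h1

theorem cls_of_isEmpty (X : Var k) [IsEmpty X.scheme] : cls X = 0 := by
  have h := cls_eq_add (𝟙 X) (𝟙 X) (by
    ext x
    exact isEmptyElim (α := X.scheme) x)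
  simpa using h

/-- Surjective closed immersions preserve the class. -/
theorem cls_eq_of_surjective {Y X : Var k} (i : Y ⟶ X) [IsClosedImmersion (Var.mor i)]
    (h : Function.Surjective (Var.mor i)) : cls X = cls Y := by
  obtain ⟨E, j, _, h2, h3⟩ := exists_reduced (X := X) isOpen_empty.isLocallyClosed
  have : IsEmpty E.scheme := Set.range_eq_empty_iff.mp h3
  have h4 := cls_eq_add i j (by rw [h3, h.range_eq, Set.compl_univ])
  rw [h4, cls_of_isEmpty E, zero_add]

/-- Bijective immersions of reduced varieties with the same image. -/
theorem cls_eq_of_range {Y Y' X : Var k} [IsReduced Y.scheme] [IsReduced Y'.scheme] (i : Y ⟶ X)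
    (i' : Y' ⟶ X) [IsImmersion (Var.mor i)] [IsImmersion (Var.mor i')]
    (h : Set.range (Var.mor i) = Set.range (Var.mor i')) : cls Y = cls Y' := by
  obtain ⟨g, hg⟩ := exists_lift i i' h.le
  obtain ⟨g', hg'⟩ := exists_lift i' i h.ge
  have := isImmersion_mor_mono i
  have := isImmersion_mor_mono i'
  refine cls_congr ⟨g, g', ?_, ?_⟩
  · rw [← cancel_mono i, Category.assoc, hg', hg, Category.id_comp]
  · rw [← cancel_mono i', Category.assoc, hg, hg', Category.id_comp]

/-- The class of the reduced subvariety on a locally closed subset. -/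
def locCls (X : Var k) (T : Set X.scheme) : K0Var k :=
  open Classical in
  if hT : IsLocallyClosed T then cls (exists_reduced hT).choose else 0

theorem locCls_eq_of_isReduced {Y X : Var k} [IsReduced Y.scheme] (i : Y ⟶ X)
    [IsImmersion (Var.mor i)] {T : Set X.scheme} (hT : Set.range (Var.mor i) = T) :
    locCls X T = cls Y := by
  have h : IsLocallyClosed T := hT ▸ (Var.mor i).isLocallyClosed_range
  rw [locCls, dif_pos h]
  obtain ⟨j, h1, h2, h3⟩ := (exists_reduced h).choose_spec
  exact cls_eq_of_range j i (h3.trans hT.symm)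

/-- The reduction of `X` is a closed subvariety with empty complement, so nilpotents do not affect
the class. -/
theorem locCls_univ (X : Var k) : locCls X Set.univ = cls X := by
  obtain ⟨Y, i, _, _, h⟩ := exists_reduced (X := X) isOpen_univ.isLocallyClosed
  have : IsClosedImmersion (Var.mor i) := .of_isPreimmersion _ (by rw [h]; exact isClosed_univ)
  rw [locCls_eq_of_isReduced i h, cls_eq_of_surjective i (Set.range_eq_univ.mp h)]

theorem locCls_image {Y X : Var k} (i : Y ⟶ X) [IsImmersion (Var.mor i)]
    {T : Set Y.scheme} (hT : IsLocallyClosed T) : locCls X (Var.mor i '' T) = locCls Y T := by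
  obtain ⟨Z, j, _, _, h⟩ := exists_reduced hT
  have : IsImmersion (Var.mor (j ≫ i)) := by
    rw [mor_comp]
    infer_instance
  rw [locCls_eq_of_isReduced j h, locCls_eq_of_isReduced (j ≫ i)]
  rw [← h]
  exact Set.range_comp (Var.mor i) (Var.mor j)

theorem locCls_univ_eq_add (X : Var k) {O : Set X.scheme} (hO : IsOpen O) :
    locCls X Set.univ = locCls X O + locCls X Oᶜ := by
  obtain ⟨Z, i, _, _, hi⟩ := exists_reduced (X := X) hO.isClosed_compl.isLocallyClosed
  have h1 : IsClosedImmersion (Var.mor i) :=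
    .of_isPreimmersion _ (by rw [hi]; exact hO.isClosed_compl)
  let U : X.scheme.Opens := ⟨O, hO⟩
  let V : Var k := ⟨Over.mk (U.ι ≫ X.obj.hom), inferInstanceAs (LocallyOfFiniteType (U.ι ≫ X.obj.hom)),
    inferInstanceAs (QuasiCompact (U.ι ≫ X.obj.hom)),
    inferInstanceAs (IsSeparated (U.ι ≫ X.obj.hom))⟩
  let j : V ⟶ X := homMk U.ι rfl
  have h2 : IsOpenImmersion (Var.mor j) := inferInstanceAs (IsOpenImmersion U.ι)
  have hj : Set.range (Var.mor j) = O := U.range_ι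
  have h3 : locCls X O = cls V := by
    rw [← locCls_univ, ← locCls_image j isOpen_univ.isLocallyClosed, Set.image_univ, hj]
  rw [locCls_univ, h3, locCls_eq_of_isReduced i hi]
  exact cls_eq_add i j (by rw [hj, hi, compl_compl])

theorem locCls_eq_add {X : Var k} {T O : Set X.scheme} (hT : IsLocallyClosed T) (hO : IsOpen O) :
    locCls X T = locCls X (T ∩ O) + locCls X (T \ O) := by
  obtain ⟨Y, i, _, _, rfl⟩ := exists_reduced hT
  have hO' : IsOpen (Var.mor i ⁻¹' O) := hO.preimage (Var.mor i).continuous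
  have h := locCls_univ_eq_add Y hO'
  rw [← locCls_image i isOpen_univ.isLocallyClosed, ← locCls_image i hO'.isLocallyClosed,
    ← locCls_image i hO'.isClosed_compl.isLocallyClosed, Set.image_univ,
    Set.image_preimage_eq_range_inter, ← Set.preimage_compl,
    Set.image_preimage_eq_range_inter] at h
  exact h

theorem locCls_empty (X : Var k) : locCls X ∅ = 0 := by
  have h := locCls_eq_add (X := X) (T := ∅) isOpen_empty.isLocallyClosed isOpen_empty
  simpa using h

/-- Additivity for finite partitions into locally closed subsets. -/
theorem locCls_eq_sum {X : Var k} {ι : Type*} (s : Finset ι) (P : ι → Set X.scheme)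
    (hP : ∀ i ∈ s, IsLocallyClosed (P i)) (T : Set X.scheme) (hT : IsLocallyClosed T)
    (hd : (s : Set ι).PairwiseDisjoint P) (hu : ⋃ i ∈ s, P i = T) :
    locCls X T = ∑ i ∈ s, locCls X (P i) := by
  classical
  induction s using Finset.induction_on generalizing T P with
  | empty =>
    simp only [Finset.notMem_empty, Set.iUnion_of_empty, Set.iUnion_empty] at hu
    rw [← hu, locCls_empty, Finset.sum_empty]
  | insert a s ha ih =>
    -- No piece of the partition need be open or closed in `T`. With `P a = O ∩ Z`, the set `T` is
    -- cut into `T \ O`, `T ∩ O ∩ Zᶜ` and `P a`; the first two avoid `P a`, so the induction applies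
    -- there to the remaining pieces.
    obtain ⟨O, Z, hO, hZ, hOZ⟩ := hP a (Finset.mem_insert_self a s)
    have hs : ∀ i ∈ s, IsLocallyClosed (P i) := fun i hi => hP i (Finset.mem_insert_of_mem hi)
    have hda : ∀ i ∈ s, Disjoint (P a) (P i) := fun i hi =>
      hd (Finset.mem_insert_self a s) (Finset.mem_insert_of_mem hi) (by rintro rfl; exact ha hi)
    have hds : (s : Set ι).PairwiseDisjoint P := hd.subset (by simp)
    rw [Finset.set_biUnion_insert] at hu
    have hZo : IsOpen Zᶜ := hZ.isOpen_compl
    have e1 := locCls_eq_add hT hO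
    have e2 := locCls_eq_add (hT.inter hO.isLocallyClosed) hZo
    have e3 : (T ∩ O) \ Zᶜ = P a := by
      rw [hOZ, Set.sdiff_compl, Set.inter_assoc, ← hOZ, Set.inter_eq_right, ← hu]
      exact Set.subset_union_left
    have e4 : locCls X (T ∩ O ∩ Zᶜ) = ∑ i ∈ s, locCls X (P i ∩ O) := by
      rw [Finset.sum_congr rfl fun i hi => locCls_eq_add
        ((hs i hi).inter hO.isLocallyClosed) hZo]
      have e5 : ∀ i ∈ s, (P i ∩ O) \ Zᶜ = ∅ := by
        intro i hi
        rw [Set.sdiff_compl, Set.inter_assoc, ← hOZ, Set.inter_comm]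
        exact (hda i hi).inter_eq
      rw [Finset.sum_congr rfl fun i hi => by rw [e5 i hi, locCls_empty, add_zero]]
      refine ih (fun i => P i ∩ O ∩ Zᶜ) (fun i hi => ((hs i hi).inter
        hO.isLocallyClosed).inter hZo.isLocallyClosed) _ ((hT.inter
        hO.isLocallyClosed).inter hZo.isLocallyClosed)
        (hds.mono fun i => Set.inter_subset_left.trans Set.inter_subset_left) ?_
      rw [← hu, ← Set.iUnion₂_inter, ← Set.iUnion₂_inter]
      ext x
      simp only [Set.mem_inter_iff, Set.mem_union, hOZ, Set.mem_compl_iff]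
      tauto
    have e6 : locCls X (T \ O) = ∑ i ∈ s, locCls X (P i \ O) := by
      refine ih (fun i => P i \ O) (fun i hi => (hs i hi).inter hO.isClosed_compl.isLocallyClosed)
        _ (hT.inter hO.isClosed_compl.isLocallyClosed) (hds.mono fun i => Set.sdiff_subset) ?_
      rw [← hu]
      ext x
      simp only [Set.mem_iUnion, Set.mem_sdiff, Set.mem_union, hOZ, Set.mem_inter_iff]
      constructor
      · rintro ⟨i, hi, hx, hx'⟩
        exact ⟨Or.inr ⟨i, hi, hx⟩, hx'⟩
      · rintro ⟨hx | ⟨i, hi, hx⟩, hx'⟩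
        · exact absurd hx.1 hx'
        · exact ⟨i, hi, hx, hx'⟩
    rw [Finset.sum_insert ha, e1, e2, e3, e4, e6,
      Finset.sum_congr rfl fun i hi => locCls_eq_add (hs i hi) hO, Finset.sum_add_distrib]
    ring

end Additivity

/-! ### Dimension and locally closed partitions -/

section Dimension

/-- Substituting constants for the first `j` variables. -/
def substFirst {k : Type*} [CommRing k] {n : ℕ} (c : Fin n → k) (j : ℕ) :
    MvPolynomial (Fin n) k →ₐ[k] MvPolynomial (Fin n) k :=
  MvPolynomial.aeval fun i => if (i : ℕ) < j then MvPolynomial.C (c i) else MvPolynomial.X i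

theorem substFirst_comp {k : Type*} [CommRing k] {n : ℕ} (c : Fin n → k) {j j' : ℕ} (h : j ≤ j') :
    (substFirst c j').comp (substFirst c j) = substFirst c j' := by
  apply MvPolynomial.algHom_ext
  intro i
  simp only [substFirst, AlgHom.comp_apply, MvPolynomial.aeval_X]
  split_ifs with h1 h2 h2
  · exact MvPolynomial.aeval_C _ _
  · omega
  · rw [MvPolynomial.aeval_X, if_pos h2]
  · rw [MvPolynomial.aeval_X, if_neg h2]

/-- A chain of `n + 1` primes of `k[x_1, …, x_n]` that avoids a given non-zero element. -/
theorem exists_chain_mvPolynomial {k : Type*} [Field k] [Infinite k] {n : ℕ}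
    {a : MvPolynomial (Fin n) k} (ha : a ≠ 0) :
    ∃ l : LTSeries (PrimeSpectrum (MvPolynomial (Fin n) k)), l.length = n ∧
      a ∉ l.last.asIdeal := by
  obtain ⟨c, hc⟩ : ∃ c, MvPolynomial.eval c a ≠ 0 := by
    by_contra! h
    exact ha (MvPolynomial.funext fun c => by rw [h, map_zero])
  have hprime : ∀ j, (RingHom.ker (substFirst c j).toRingHom).IsPrime := fun j =>
    RingHom.ker_isPrime _
  let P : Fin (n + 1) → PrimeSpectrum (MvPolynomial (Fin n) k) := fun j => ⟨_, hprime j⟩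
  have hle : ∀ {j j' : ℕ}, j ≤ j' → RingHom.ker (substFirst c j).toRingHom ≤
      RingHom.ker (substFirst c j').toRingHom := by
    intro j j' h x hx
    change substFirst c j' x = 0
    rw [← substFirst_comp c h, AlgHom.comp_apply, show substFirst c j x = 0 from hx, map_zero]
  have hP : StrictMono P := by
    rw [Fin.strictMono_iff_lt_succ]
    intro j
    refine lt_of_le_of_ne (hle (Nat.le_succ j)) fun h => ?_
    have h1 : (MvPolynomial.X j - MvPolynomial.C (c j) : MvPolynomial (Fin n) k) ∈
        (P j.succ).asIdeal := by
      change substFirst c _ _ = 0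
      rw [map_sub, substFirst, MvPolynomial.aeval_X, MvPolynomial.aeval_C, if_pos (by simp)]
      exact sub_self _
    rw [← h] at h1
    have h2 : substFirst c j (MvPolynomial.X j - MvPolynomial.C (c j)) = 0 := h1
    rw [map_sub, substFirst, MvPolynomial.aeval_X, MvPolynomial.aeval_C, if_neg (by simp),
      MvPolynomial.algebraMap_eq, sub_eq_zero] at h2
    have h3 := congrArg (MvPolynomial.eval fun _ => c j + 1) h2
    simp at h3
  refine ⟨LTSeries.mk n P hP, rfl, fun h => hc ?_⟩
  have h1 : substFirst c n a = 0 := h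
  have h2 : (MvPolynomial.aeval c).comp (substFirst c n) = MvPolynomial.aeval c := by
    apply MvPolynomial.algHom_ext
    intro i
    simp [substFirst]
  have h3 := DFunLike.congr_fun h2 a
  rw [AlgHom.comp_apply, h1, map_zero] at h3
  exact h3.symm

/-- By Noether normalization `A` is integral over a polynomial ring in `n` variables, and `dim A ≤
n`. A chain of length `n` there that avoids a nonzero multiple of `f` lifts by going-up to primes
that avoid `f`, and these survive in the localization. -/
theorem ringKrullDim_le_localizationAway (k : Type*) {A : Type*} [Field k] [Infinite k]
    [CommRing A] [IsDomain A] [Algebra k A] [Algebra.FiniteType k A] {f : A} (hf : f ≠ 0) :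
    ringKrullDim A ≤ ringKrullDim (Localization.Away f) := by
  obtain ⟨n, g, hg, hfin⟩ := exists_finite_inj_algHom_of_fg k A
  algebraize [g.toRingHom]
  have hint : Algebra.IsIntegral (MvPolynomial (Fin n) k) A := ⟨RingHom.Finite.to_isIntegral hfin⟩
  have h1 : ringKrullDim A ≤ n := by
    have h2 : StrictMono (PrimeSpectrum.comap (algebraMap (MvPolynomial (Fin n) k) A)) :=
      fun p q hpq => Ideal.IsIntegral.comap_lt_comap hpq
    refine (Order.krullDim_le_of_strictMono _ h2).trans ?_
    change ringKrullDim _ ≤ _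
    rw [MvPolynomial.ringKrullDim_of_isNoetherianRing, ringKrullDim_eq_zero_of_field]
    simp
  refine h1.trans ?_
  -- Since `f` is integral, it has a nonzero multiple `a` in the polynomial ring; a prime of `A`
  -- containing `f` contracts to one containing `a`.
  have h2 : Ideal.comap (algebraMap (MvPolynomial (Fin n) k) A) (Ideal.span {f}) ≠ ⊥ :=
    Ideal.comap_ne_bot_of_integral_mem hf (Ideal.mem_span_singleton_self f)
      (Algebra.IsIntegral.isIntegral f)
  obtain ⟨a, ha, ha0⟩ := (Submodule.ne_bot_iff _).mp h2
  obtain ⟨l, hl, hla⟩ := exists_chain_mvPolynomial ha0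
  have : FaithfulSMul (MvPolynomial (Fin n) k) A := (faithfulSMul_iff_algebraMap_injective _ _).mpr hg
  obtain ⟨P, hP, hPl⟩ := (inferInstance : Nonempty (l.head.asIdeal.primesOver A))
  obtain ⟨L, hL, -, hLl⟩ := Ideal.exists_ltSeries_of_hasGoingUp l P
  have h3 : PrimeSpectrum.comap (algebraMap (MvPolynomial (Fin n) k) A) L.last = l.last := by
    rw [← RelSeries.getLast_toList, ← RelSeries.getLast_toList,
      ← List.getLast_map (f := PrimeSpectrum.comap (algebraMap (MvPolynomial (Fin n) k) A))
        (by simp [RelSeries.toList])]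
    simp only [hLl]
  have h4 : f ∉ L.last.asIdeal := by
    intro h
    apply hla
    rw [← h3]
    exact (Ideal.span_singleton_le_iff_mem _).mpr h ha
  have h5 : ∀ i, ∃ p : PrimeSpectrum (Localization.Away f),
      PrimeSpectrum.comap (algebraMap A (Localization.Away f)) p = L i := by
    intro i
    have : L i ∈ Set.range (PrimeSpectrum.comap (algebraMap A (Localization.Away f))) := by
      rw [PrimeSpectrum.localization_away_comap_range (Localization.Away f) f]
      exact fun h => h4 (L.monotone (Fin.le_last i) h)
    exact this
  choose p hp using h5
  have h6 : StrictMono p := by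
    intro i j hij
    have h7 : L i < L j := L.strictMono hij
    rw [← hp, ← hp] at h7
    simp only [lt_iff_le_not_ge, PrimeSpectrum.le_iff_specializes,
      (PrimeSpectrum.localization_comap_isInducing (Localization.Away f)
        (Submonoid.powers f)).specializes_iff] at h7 ⊢
    exact h7
  rw [← hl, ← hL]
  exact Order.LTSeries.length_le_krullDim (LTSeries.mk L.length p h6)

/-- A locally closed subset that contains the generic point contains a basic open subset. -/
theorem exists_basicOpen_subset {A : Type*} [CommRing A] [IsDomain A]
    {T : Set (PrimeSpectrum A)} (hT : IsLocallyClosed T) (h : (⊥ : PrimeSpectrum A) ∈ T) :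
    ∃ f : A, f ≠ 0 ∧ (PrimeSpectrum.basicOpen f : Set (PrimeSpectrum A)) ⊆ T := by
  obtain ⟨U, Z, hU, hZ, rfl⟩ := hT
  obtain ⟨_, ⟨f, rfl⟩, hf, hfU⟩ :=
    PrimeSpectrum.isTopologicalBasis_basic_opens.exists_subset_of_mem_open h.1 hU
  refine ⟨f, fun h0 => hf (by rw [h0]; exact Submodule.zero_mem _), Set.subset_inter hfU ?_⟩
  intro x _
  have hx : (⊥ : PrimeSpectrum A) ⤳ x := (PrimeSpectrum.le_iff_specializes _ _).mp bot_le
  exact hx.mem_closed hZ h.2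

/-- The set `T i` that contains the generic point of the largest member of the chain contains a
nonempty open part of that member, and passing to it loses no dimension. -/
theorem exists_le_topologicalKrullDim {k : Type u} [Field k] [Infinite k] (X : Var k) {ι : Type*}
    (T : ι → Set X.scheme) (hT : ∀ i, IsLocallyClosed (T i)) (hu : ⋃ i, T i = Set.univ)
    (l : LTSeries (TopologicalSpace.IrreducibleCloseds X.scheme)) :
    ∃ i, l.length ≤ topologicalKrullDim (T i) := by
  have hη : ∀ i, ∃ x : X.scheme, closure {x} = (l i : Set X.scheme) := fun i =>
    QuasiSober.sober (l i).2 (l i).3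
  choose η hη using hη
  have hsp : ∀ i j, i ≤ j ↔ η j ⤳ η i := by
    intro i j
    rw [specializes_iff_closure_subset, hη, hη]
    exact l.strictMono.le_iff_le.symm
  -- An affine neighbourhood of the most special point `η 0` contains all the `η i`, which are its
  -- generizations.
  obtain ⟨R, ι', _, hx, -⟩ := Scheme.exists_affine_mem_range_and_range_subset
    (x := η 0) (U := (⊤ : X.scheme.Opens)) trivial
  have hy : ∀ i, ∃ y, ι' y = η i := fun i =>
    ((hsp 0 i).mp (Fin.zero_le i)).mem_open ι'.isOpenEmbedding.isOpen_range hx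
  choose y hy using hy
  obtain ⟨i, hi⟩ := Set.mem_iUnion.mp (hu.ge (Set.mem_univ (η (Fin.last _))))
  refine ⟨i, ?_⟩
  let y' : Fin (l.length + 1) → PrimeSpectrum R := y
  have hle : ∀ a b, a ≤ b ↔ y' b ≤ y' a := by
    intro a b
    rw [PrimeSpectrum.le_iff_specializes, hsp, ← hy, ← hy]
    exact ι'.isOpenEmbedding.isInducing.specializes_iff
  let φ : k →+* R := (Spec.preimage (ι' ≫ X.obj.hom)).hom
  have hφ : φ.FiniteType := by
    have h1 : LocallyOfFiniteType (Spec.map (Spec.preimage (ι' ≫ X.obj.hom))) := by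
      rw [Spec.map_preimage]
      infer_instance
    exact (HasRingHomProperty.Spec_iff (P := @LocallyOfFiniteType)).mp h1
  algebraize [φ]
  let I := (y' (Fin.last _)).asIdeal
  have hI : I.IsPrime := (y' (Fin.last _)).isPrime
  let A := R ⧸ I
  have : Algebra.FiniteType k A := inferInstance
  let c : PrimeSpectrum A → PrimeSpectrum R := PrimeSpectrum.comap (Ideal.Quotient.mk I)
  have hc : IsClosedEmbedding c :=
    PrimeSpectrum.isClosedEmbedding_comap_of_surjective _ _ Ideal.Quotient.mk_surjective
  have hbot : c ⊥ = y' (Fin.last _) := by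
    apply PrimeSpectrum.ext
    change Ideal.comap (Ideal.Quotient.mk I) ⊥ = I
    exact Ideal.mk_ker
  have hdim : (l.length : WithBot ℕ∞) ≤ ringKrullDim A := by
    have h1 : ∀ a, ∃ z, c z = y' a := by
      intro a
      have h2 : y' a ∈ Set.range c := by
        rw [range_comap_of_surjective _ _ Ideal.Quotient.mk_surjective]
        change (RingHom.ker (Ideal.Quotient.mk I) : Set R) ⊆ (y' a).asIdeal
        rw [Ideal.mk_ker]
        exact (hle a (Fin.last _)).mp (Fin.le_last a)
      exact h2
    choose z hz using h1
    have h2 : StrictMono (z ∘ Fin.rev) := by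
      have h3 : ∀ a b, a ≤ b ↔ z b ≤ z a := by
        intro a b
        rw [hle, ← hz, ← hz, PrimeSpectrum.le_iff_specializes, PrimeSpectrum.le_iff_specializes]
        exact hc.isInducing.specializes_iff
      intro a b hab
      rw [lt_iff_le_not_ge] at hab ⊢
      simp only [Function.comp_apply]
      rwa [← h3, ← h3, Fin.rev_le_rev, Fin.rev_le_rev]
    exact Order.LTSeries.length_le_krullDim (LTSeries.mk l.length _ h2)
  let h : PrimeSpectrum A → X.scheme := fun p => ι' (c p)
  have hh : IsInducing h := ι'.isOpenEmbedding.isInducing.comp hc.isInducing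
  obtain ⟨f, hf, hfT⟩ := exists_basicOpen_subset ((hT i).preimage hh.continuous)
    (show h ⊥ ∈ T i by
      change ι' (c ⊥) ∈ T i
      rw [hbot]
      exact (hy _).symm ▸ hi)
  refine hdim.trans ((ringKrullDim_le_localizationAway k hf).trans ?_)
  rw [← PrimeSpectrum.topologicalKrullDim_eq_ringKrullDim]
  have h3 := hh.comp (PrimeSpectrum.localization_comap_isInducing (Localization.Away f)
        (Submonoid.powers f))
  have h4 : ∀ p, (h ∘ (PrimeSpectrum.comap (algebraMap A (Localization.Away f)))) p ∈ T i := by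
    intro p
    apply hfT
    rw [← PrimeSpectrum.localization_away_comap_range (Localization.Away f) f]
    exact ⟨p, rfl⟩
  exact (h3.codRestrict h4).topologicalKrullDim_le

theorem topologicalKrullDim_le_of_cover {k : Type u} [Field k] [Infinite k] (X : Var k) {ι : Type*}
    (T : ι → Set X.scheme) (hT : ∀ i, IsLocallyClosed (T i)) (hu : ⋃ i, T i = Set.univ)
    {d : WithBot ℕ∞} (hd : ∀ i, topologicalKrullDim (T i) ≤ d) :
    topologicalKrullDim X.scheme ≤ d := by
  refine iSup_le fun l => ?_
  obtain ⟨i, hi⟩ := exists_le_topologicalKrullDim X T hT hu l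
  exact hi.trans (hd i)

end Dimension

/-! ### Independence of the presentation -/

section Independence

variable {k : Type u} [Field k] {r : ℕ}

instance (A : Type u) [CommRing A] [Algebra k A] [Algebra.FiniteType k A] [IsReduced A] :
    AlgebraicGeometry.IsReduced (Var.spec k A).scheme :=
  inferInstanceAs (AlgebraicGeometry.IsReduced (Spec (CommRingCat.of A)))

namespace ConjQuotient

variable (Q Q' : ConjQuotient k r)

attribute [instance] ConjQuotient.isReduced ConjQuotient.isImmersion

/-- The part of the `i`-th quotient of `Q` whose normal forms lie in the `j`-th stratum of `Q'`. -/
def part (i : Fin Q.n) (j : Fin Q'.n) : Set (Q.X i).scheme :=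
  Var.mor (Q.σ i ≫ Q.incl i) ⁻¹' Set.range (Var.mor (Q'.incl j))

theorem isLocallyClosed_part (i : Fin Q.n) (j : Fin Q'.n) : IsLocallyClosed (Q.part Q' i j) :=
  (Var.mor (Q'.incl j)).isLocallyClosed_range.preimage
    (Var.mor (Q.σ i ≫ Q.incl i)).continuous

theorem iUnion_part (i : Fin Q.n) : ⋃ j, Q.part Q' i j = Set.univ := by
  simp only [part]
  rw [← Set.preimage_iUnion, Q'.cover, Set.preimage_univ]

theorem disjoint_part (i : Fin Q.n) : Pairwise fun j j' => Disjoint (Q.part Q' i j) (Q.part Q' i j') :=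
  fun _ _ h => (Q'.disjoint h).preimage _

/-- The two quotients of the part common to two strata have the same points. -/
theorem exists_point_part (i : Fin Q.n) (j : Fin Q'.n) (x : pt k ⟶ Q.X i) (b : pt k ⟶ Q'.S j)
    (h : b ≫ Q'.incl j = x ≫ Q.σ i ≫ Q.incl i) :
    ∃ b' : pt k ⟶ Q.S i, b' ≫ Q.incl i = (b ≫ Q'.π j) ≫ Q'.σ j ≫ Q'.incl j ∧ b' ≫ Q.π i = x := by
  have h1 := (Q'.fibre j ((b ≫ Q'.π j) ≫ Q'.σ j) (b ≫ Q'.incl j)).mpr ⟨b, rfl, by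
    rw [Category.assoc, Q'.section_π, Category.comp_id]⟩
  rw [h, ← Category.assoc x] at h1
  obtain ⟨b', h2, h3⟩ := (Q.fibre i (x ≫ Q.σ i) _).mp h1.symm
  refine ⟨b', by rw [h2, Category.assoc], ?_⟩
  rw [h3, Category.assoc, Q.section_π, Category.comp_id]

theorem cls_eq_sum (i : Fin Q.n) : cls (Q.X i) = ∑ j, locCls (Q.X i) (Q.part Q' i j) := by
  rw [← locCls_univ]
  refine locCls_eq_sum Finset.univ _ (fun j _ => Q.isLocallyClosed_part Q' i j) _
    isClosed_univ.isLocallyClosed (fun j _ j' _ h => Q.disjoint_part Q' i h) ?_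
  rw [← Q.iUnion_part Q' i]
  simp

variable [IsAlgClosed k]

/-- The morphism takes the normal form of `Q` and projects it by `Q'`. It lands in the right part
because the normal form of `Q'` for the resulting class is conjugate to that of `Q`, and the strata
are stable under conjugation. -/
theorem exists_hom_part (i : Fin Q.n) (j : Fin Q'.n) {Y Y' : Var k} [IsReduced Y.scheme]
    (ι : Y ⟶ Q.X i) (ι' : Y' ⟶ Q'.X j) [IsImmersion (Var.mor ι')]
    (hY : Set.range (Var.mor ι) = Q.part Q' i j) (hY' : Set.range (Var.mor ι') = Q'.part Q j i) :
    ∃ f : Y ⟶ Y', ∀ p : pt k ⟶ Y, ∃ b : pt k ⟶ Q'.S j,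
      b ≫ Q'.incl j = (p ≫ ι) ≫ Q.σ i ≫ Q.incl i ∧ p ≫ f ≫ ι' = b ≫ Q'.π j := by
  obtain ⟨g, hg⟩ := exists_lift (ι ≫ Q.σ i ≫ Q.incl i) (Q'.incl j) (by
    rintro _ ⟨y, rfl⟩
    exact (hY.le ⟨y, rfl⟩ : Var.mor ι y ∈ Q.part Q' i j))
  obtain ⟨f, hf⟩ := exists_lift (g ≫ Q'.π j) ι' (by
    rw [hY']
    refine range_subset_of_points _ (Q'.isLocallyClosed_part Q j i) fun p => ?_
    obtain ⟨b', h1, -⟩ := Q.exists_point_part Q' i j (p ≫ ι) (p ≫ g) (by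
      rw [Category.assoc, hg, Category.assoc])
    change Var.point ((p ≫ g ≫ Q'.π j) ≫ Q'.σ j ≫ Q'.incl j) ∈ Set.range (Var.mor (Q.incl i))
    rw [← Category.assoc p, ← h1, point_comp]
    exact ⟨_, rfl⟩)
  refine ⟨f, fun p => ⟨p ≫ g, ?_, ?_⟩⟩
  · rw [Category.assoc, hg, Category.assoc]
  · rw [hf, Category.assoc]

/-- On `k`-points the composite sends a class to the class of a conjugate of its normal form, which
is the same class; `Y` being reduced, `k`-points decide. -/
theorem comp_eq_id (i : Fin Q.n) (j : Fin Q'.n) {Y Y' : Var k} [IsReduced Y.scheme]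
    (ι : Y ⟶ Q.X i) (ι' : Y' ⟶ Q'.X j) [IsImmersion (Var.mor ι)] (f : Y ⟶ Y') (f' : Y' ⟶ Y)
    (hf : ∀ p : pt k ⟶ Y, ∃ b : pt k ⟶ Q'.S j,
      b ≫ Q'.incl j = (p ≫ ι) ≫ Q.σ i ≫ Q.incl i ∧ p ≫ f ≫ ι' = b ≫ Q'.π j)
    (hf' : ∀ p : pt k ⟶ Y', ∃ b : pt k ⟶ Q.S i,
      b ≫ Q.incl i = (p ≫ ι') ≫ Q'.σ j ≫ Q'.incl j ∧ p ≫ f' ≫ ι = b ≫ Q.π i) :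
    f ≫ f' = 𝟙 Y := by
  have := isImmersion_mor_mono ι
  have := isImmersion_mor_mono (Q.incl i)
  rw [← cancel_mono ι]
  refine hom_ext_points fun p => ?_
  obtain ⟨b, h1, h2⟩ := hf p
  obtain ⟨c, h3, h4⟩ := hf' (p ≫ f)
  obtain ⟨b', h5, h6⟩ := Q.exists_point_part Q' i j (p ≫ ι) b h1
  have h7 : c = b' := by
    rw [← cancel_mono (Q.incl i), h3, h5, Category.assoc p, h2]
  simp only [Category.assoc, Category.id_comp] at h4 ⊢
  rw [h4, h7, h6]

theorem exists_iso_part (i : Fin Q.n) (j : Fin Q'.n) : ∃ (Y Y' : Var k) (ι : Y ⟶ Q.X i)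
    (ι' : Y' ⟶ Q'.X j), IsReduced Y.scheme ∧ IsReduced Y'.scheme ∧ IsImmersion (Var.mor ι) ∧
    IsImmersion (Var.mor ι') ∧ Set.range (Var.mor ι) = Q.part Q' i j ∧
    Set.range (Var.mor ι') = Q'.part Q j i ∧ Nonempty (Y ≅ Y') := by
  obtain ⟨Y, ι, h1, h2, h3⟩ := exists_reduced (Q.isLocallyClosed_part Q' i j)
  obtain ⟨Y', ι', h1', h2', h3'⟩ := exists_reduced (Q'.isLocallyClosed_part Q j i)
  obtain ⟨f, hf⟩ := Q.exists_hom_part Q' i j ι ι' h3 h3'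
  obtain ⟨f', hf'⟩ := Q'.exists_hom_part Q j i ι' ι h3' h3
  exact ⟨Y, Y', ι, ι', h1, h1', h2, h2', h3, h3', ⟨f, f', Q.comp_eq_id Q' i j ι ι' f f' hf hf',
    Q'.comp_eq_id Q j i ι' ι f' f hf' hf⟩⟩

theorem locCls_part (i : Fin Q.n) (j : Fin Q'.n) :
    locCls (Q.X i) (Q.part Q' i j) = locCls (Q'.X j) (Q'.part Q j i) := by
  obtain ⟨Y, Y', ι, ι', _, _, _, _, h, h', ⟨e⟩⟩ := Q.exists_iso_part Q' i j
  rw [locCls_eq_of_isReduced ι h, locCls_eq_of_isReduced ι' h', cls_congr e]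

theorem topologicalKrullDim_part_le (i : Fin Q.n) (j : Fin Q'.n) :
    topologicalKrullDim (Q.part Q' i j) ≤ topologicalKrullDim (Q'.X j).scheme := by
  obtain ⟨Y, Y', ι, ι', _, _, _, _, h, h', ⟨e⟩⟩ := Q.exists_iso_part Q' i j
  have h1 : IsInducing (Var.mor (e.hom ≫ ι')) := by
    have : IsIso (Var.mor e.hom) := ⟨Var.mor e.inv, by rw [← mor_comp, e.hom_inv_id]; rfl,
      by rw [← mor_comp, e.inv_hom_id]; rfl⟩
    have : IsImmersion (Var.mor (e.hom ≫ ι')) := by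
      rw [mor_comp]
      infer_instance
    exact (Var.mor (e.hom ≫ ι')).isEmbedding.isInducing
  rw [← h]
  have h2 := (Var.mor ι).isEmbedding.toHomeomorph
  exact (h1.comp h2.symm.isInducing).topologicalKrullDim_le

theorem virtualClass_eq : Q.virtualClass = Q'.virtualClass := by
  rw [virtualClass, virtualClass, Finset.sum_congr rfl fun i _ => Q.cls_eq_sum Q' i,
    Finset.sum_congr rfl fun i _ => Q'.cls_eq_sum Q i, Finset.sum_comm]
  exact Finset.sum_congr rfl fun j _ => Finset.sum_congr rfl fun i _ => Q.locCls_part Q' i j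

theorem dim_le : Q.dim ≤ Q'.dim := by
  have : Infinite k := IsAlgClosed.instInfinite
  refine iSup_le fun i => topologicalKrullDim_le_of_cover _ (fun j => Q.part Q' i j)
    (fun j => Q.isLocallyClosed_part Q' i j) (Q.iUnion_part Q' i) fun j => ?_
  exact (Q.topologicalKrullDim_part_le Q' i j).trans
    (le_iSup (fun j => topologicalKrullDim (Q'.X j).scheme) j)

theorem dim_eq : Q.dim = Q'.dim := le_antisymm (Q.dim_le Q') (Q'.dim_le Q)

end ConjQuotient

end Independence

/-! ### Affine varieties -/

section Affine

variable {k : Type u} [Field k]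
variable {A B C : Type u} [CommRing A] [Algebra k A] [Algebra.FiniteType k A]
  [CommRing B] [Algebra k B] [Algebra.FiniteType k B]
  [CommRing C] [Algebra k C] [Algebra.FiniteType k C]

/-- The morphism of affine varieties given by a homomorphism of `k`-algebras. -/
def specMap (φ : A →ₐ[k] B) : Var.spec k B ⟶ Var.spec k A :=
  homMk (Spec.map (CommRingCat.ofHom φ.toRingHom)) (by
    change Spec.map _ ≫ Spec.map _ = Spec.map _
    rw [← Spec.map_comp, ← CommRingCat.ofHom_comp]
    congr 2
    exact φ.comp_algebraMap)

theorem mor_specMap (φ : A →ₐ[k] B) :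
    Var.mor (specMap φ) = Spec.map (CommRingCat.ofHom φ.toRingHom) := rfl

theorem specMap_comp (φ : A →ₐ[k] B) (ψ : B →ₐ[k] C) :
    specMap (ψ.comp φ) = specMap ψ ≫ specMap φ := by
  apply mor_injective
  exact Spec.map_comp (CommRingCat.ofHom φ.toRingHom) (CommRingCat.ofHom ψ.toRingHom)

theorem specMap_id : specMap (AlgHom.id k A) = 𝟙 (Var.spec k A) := by
  apply mor_injective
  rw [mor_specMap, mor_id]
  exact Spec.map_id _

theorem cls_spec_congr (e : A ≃ₐ[k] B) : cls (Var.spec k A) = cls (Var.spec k B) :=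
  cls_congr ⟨specMap (e.symm : B →ₐ[k] A), specMap (e : A →ₐ[k] B),
    by rw [← specMap_comp, AlgEquiv.symm_comp, specMap_id],
    by rw [← specMap_comp, AlgEquiv.comp_symm, specMap_id]⟩

/-- The value of functions at a `k`-point. -/
def evalAt (p : pt k ⟶ Var.spec k A) : A →ₐ[k] k :=
  { (Spec.preimage (R := CommRingCat.of A) (S := CommRingCat.of k) (Var.mor p)).hom with
    commutes' := by
      intro a
      have h := mor_hom p
      have h1 : Var.mor p = Spec.map (Spec.preimage (R := CommRingCat.of A)
        (S := CommRingCat.of k) (Var.mor p)) := (Spec.map_preimage _).symm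
      rw [h1] at h
      have h2 : Spec.map (CommRingCat.ofHom (algebraMap k A) ≫ Spec.preimage
        (R := CommRingCat.of A) (S := CommRingCat.of k) (Var.mor p)) =
          Spec.map (𝟙 (CommRingCat.of k)) := by
        rw [Spec.map_comp, Spec.map_id]
        exact h
      have h3 := Spec.map_injective h2
      exact congrArg (fun f => f.hom a) h3 }

theorem mor_eq_evalAt (p : pt k ⟶ Var.spec k A) :
    Var.mor p = Spec.map (CommRingCat.ofHom (evalAt p).toRingHom) :=
  (Spec.map_preimage (R := CommRingCat.of A) (S := CommRingCat.of k) (Var.mor p)).symm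

theorem evalAt_injective {p p' : pt k ⟶ Var.spec k A} (h : evalAt p = evalAt p') : p = p' :=
  mor_injective (by rw [mor_eq_evalAt, mor_eq_evalAt, h])

theorem evalAt_comp_specMap (φ : A →ₐ[k] B) (p : pt k ⟶ Var.spec k B) :
    evalAt (p ≫ specMap φ) = (evalAt p).comp φ := by
  have h : Spec.map (CommRingCat.ofHom (evalAt (p ≫ specMap φ)).toRingHom) =
      Spec.map (CommRingCat.ofHom ((evalAt p).comp φ).toRingHom) := by
    rw [← mor_eq_evalAt, mor_comp, mor_eq_evalAt p, mor_specMap]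
    exact (Spec.map_comp _ _).symm
  have h1 := Spec.map_injective h
  apply AlgHom.ext
  intro a
  exact congrArg (fun f => f.hom a) h1

/-- The `k`-point at which functions take given values. -/
def pointOf (φ : A →ₐ[k] k) : pt k ⟶ Var.spec k A :=
  homMk (Spec.map (CommRingCat.ofHom φ.toRingHom)) (by
    change Spec.map _ ≫ Spec.map _ = 𝟙 (Spec (CommRingCat.of k))
    rw [← Spec.map_comp, ← CommRingCat.ofHom_comp, ← Spec.map_id]
    congr 1
    ext a
    exact φ.commutes a)

theorem evalAt_pointOf (φ : A →ₐ[k] k) : evalAt (pointOf φ) = φ := by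
  have h : Spec.map (CommRingCat.ofHom (evalAt (pointOf φ)).toRingHom) =
      Spec.map (CommRingCat.ofHom φ.toRingHom) := by
    rw [← mor_eq_evalAt]
    rfl
  have h1 := Spec.map_injective h
  apply AlgHom.ext
  intro a
  exact congrArg (fun f => f.hom a) h1

theorem mem_point_iff (p : pt k ⟶ Var.spec k A) (a : A) :
    a ∈ (Var.point p : PrimeSpectrum A).asIdeal ↔ evalAt p a = 0 := by
  have : (Var.point p : PrimeSpectrum A) = PrimeSpectrum.comap (evalAt p).toRingHom
      (IsLocalRing.closedPoint k) := by
    rw [Var.point, mor_eq_evalAt]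
    rfl
  rw [this]
  change (evalAt p) a ∈ IsLocalRing.maximalIdeal k ↔ _
  rw [IsLocalRing.maximalIdeal_eq_bot]
  rfl

/-- Nullstellensatz: a basic open set that contains all `k`-points is everything. -/
theorem isUnit_of_evalAt [IsAlgClosed k] {a : A} (h : ∀ p : pt k ⟶ Var.spec k A, evalAt p a ≠ 0) :
    IsUnit a := by
  have h1 : ((PrimeSpectrum.basicOpen a : TopologicalSpace.Opens (PrimeSpectrum A)) :
      Set (PrimeSpectrum A)) = Set.univ := by
    refine eq_univ_of_points (X := Var.spec k A) (T := (PrimeSpectrum.basicOpen a :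
      Set (PrimeSpectrum A))) ?_ fun p hp => h p ((mem_point_iff p a).mp hp)
    exact (PrimeSpectrum.basicOpen a).isOpen.isLocallyClosed
  by_contra hu
  obtain ⟨M, hM, ha⟩ := exists_max_ideal_of_mem_nonunits hu
  exact h1.ge (Set.mem_univ ⟨M, hM.isPrime⟩) ha

instance (f : A) : Algebra.FiniteType k (Localization.Away f) :=
  Algebra.FiniteType.trans (S := A) inferInstance
    (IsLocalization.finiteType_of_monoid_fg (Submonoid.powers f) _)

theorem cls_spec_eq_add (f : A) (φ : A →ₐ[k] B) (hφ : Function.Surjective φ)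
    (hf : RingHom.ker φ = Ideal.span {f}) :
    cls (Var.spec k A) = cls (Var.spec k (Localization.Away f)) + cls (Var.spec k B) := by
  have h1 : IsClosedImmersion (Var.mor (specMap φ)) :=
    IsClosedImmersion.spec_of_surjective _ hφ
  let ψ : A →ₐ[k] Localization.Away f := IsScalarTower.toAlgHom k A _
  have h2 : IsOpenImmersion (Var.mor (specMap ψ)) :=
    Scheme.isOpenImmersion_SpecMap_localizationAway (R := CommRingCat.of A) f
  refine cls_eq_add (specMap φ) (specMap ψ) ?_
  have e1 : Set.range (Var.mor (specMap φ)) = (PrimeSpectrum.zeroLocus {f} : Set (PrimeSpectrum A)) := by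
    have := range_comap_of_surjective B φ.toRingHom hφ
    rw [← PrimeSpectrum.zeroLocus_span, ← hf]
    exact this
  have e2 : Set.range (Var.mor (specMap ψ)) = (PrimeSpectrum.basicOpen f : Set (PrimeSpectrum A)) :=
    PrimeSpectrum.localization_away_comap_range (Localization.Away f) f
  rw [e1, e2]
  exact PrimeSpectrum.basicOpen_eq_zeroLocus_compl f

open TensorProduct in
theorem cls_spec_tensor [Algebra.FiniteType k (A ⊗[k] B)] :
    cls (Var.spec k (A ⊗[k] B)) = cls (Var.spec k A) * cls (Var.spec k B) := by
  rw [← cls_tensor]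
  let e := pullbackSpecIso k A B
  let f : Var.spec k A ⊗ Var.spec k B ⟶ Var.spec k (A ⊗[k] B) := homMk e.hom (by
    change e.hom ≫ Spec.map _ = Limits.pullback.fst _ _ ≫ Spec.map _
    rw [← pullbackSpecIso_hom_fst k A B, Category.assoc, ← Spec.map_comp, ← CommRingCat.ofHom_comp])
  have : IsIso (Var.mor f) := inferInstanceAs (IsIso e.hom)
  exact (cls_eq_of_isIso f).symm

theorem cls_spec_self : cls (Var.spec k k) = 1 := by
  rw [← cls_pt]
  let f : Var.spec k k ⟶ pt k := homMk (𝟙 (Spec (CommRingCat.of k))) (by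
    change 𝟙 (Spec (CommRingCat.of k)) ≫ 𝟙 (Spec (CommRingCat.of k)) = Spec.map (𝟙 (CommRingCat.of k))
    rw [Spec.map_id, Category.comp_id])
  have : IsIso (Var.mor f) := inferInstanceAs (IsIso (𝟙 (Spec (CommRingCat.of k))))
  exact cls_eq_of_isIso f

theorem cls_spec_mvPolynomial :
    cls (Var.spec k (MvPolynomial PUnit.{u + 1} A)) = cls (Var.spec k A) * q k := by
  let e := (MvPolynomial.algebraTensorAlgEquiv (σ := PUnit.{u + 1}) k A).restrictScalars k
  have := Algebra.FiniteType.equiv (inferInstance :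
    Algebra.FiniteType k (MvPolynomial PUnit.{u + 1} A)) e.symm
  rw [← cls_spec_congr e, cls_spec_tensor]
  rfl

end Affine

/-! ### Products of lines and punctured lines -/

section Torus

/-- The `k`-algebra `A` is universal for families `x` indexed by `σ`, such that `x i` is a unit
for `i ∈ J`. -/
structure IsUniversal (k : Type u) [Field k] {σ : Type*} (J : Set σ) {A : Type u} [CommRing A]
    [Algebra k A] (x : σ → A) : Prop where
  isUnit : ∀ i ∈ J, IsUnit (x i)
  lift : ∀ {R : Type u} [CommRing R] [Algebra k R] (y : σ → R), (∀ i ∈ J, IsUnit (y i)) →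
    ∃ φ : A →ₐ[k] R, ∀ i, φ (x i) = y i
  hom_ext : ∀ {R : Type u} [CommRing R] [Algebra k R] (φ ψ : A →ₐ[k] R),
    (∀ i, φ (x i) = ψ (x i)) → φ = ψ

variable {k : Type u} [Field k]

theorem IsUniversal.of_equiv {σ τ : Type*} (e : σ ≃ τ) {J : Set τ} {A : Type u} [CommRing A]
    [Algebra k A] {x : σ → A} (h : IsUniversal k (e ⁻¹' J) x) :
    IsUniversal k J (x ∘ e.symm) where
  isUnit i hi := h.isUnit _ (by simpa using hi)
  lift y hy := by
    obtain ⟨φ, hφ⟩ := h.lift (y ∘ e) fun i hi => hy _ hi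
    exact ⟨φ, fun i => by simp [hφ]⟩
  hom_ext φ ψ hh := h.hom_ext φ ψ fun i => by simpa using hh (e i)

theorem isUniversal_of_isEmpty {σ : Type*} [IsEmpty σ] (J : Set σ) :
    IsUniversal k J (isEmptyElim : σ → k) where
  isUnit i := isEmptyElim i
  lift {R} _ _ _ _ := ⟨Algebra.ofId k R, fun i => isEmptyElim i⟩
  hom_ext φ ψ _ := Subsingleton.elim φ ψ

theorem IsUniversal.mvPolynomial {σ : Type*} {J : Set (Option σ)} (hJ : none ∉ J) {A : Type u}
    [CommRing A] [Algebra k A] {x : σ → A} (h : IsUniversal k (some ⁻¹' J) x) :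
    IsUniversal k J (fun i : Option σ => i.elim (MvPolynomial.X PUnit.unit)
      (fun i => MvPolynomial.C (x i)) : Option σ → MvPolynomial PUnit.{u + 1} A) where
  isUnit i hi := by
    cases i with
    | none => exact absurd hi hJ
    | some i => exact (h.isUnit i hi).map MvPolynomial.C
  lift {R} _ _ y hy := by
    obtain ⟨φ, hφ⟩ := h.lift (fun i => y (some i)) fun i hi => hy (some i) hi
    algebraize [φ.toRingHom]
    have : IsScalarTower k A R := IsScalarTower.of_algebraMap_eq fun a => (φ.commutes a).symm
    refine ⟨(MvPolynomial.aeval (R := A) fun _ => y none).restrictScalars k, fun i => ?_⟩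
    cases i with
    | none => exact MvPolynomial.aeval_X _ _
    | some i => exact (MvPolynomial.aeval_C _ _).trans (hφ i)
  hom_ext {R} _ _ φ ψ hh := by
    have h1 : φ.comp (IsScalarTower.toAlgHom k A _) = ψ.comp (IsScalarTower.toAlgHom k A _) :=
      h.hom_ext _ _ fun i => hh (some i)
    have h2 : φ.toRingHom = ψ.toRingHom := by
      apply MvPolynomial.ringHom_ext
      · intro a
        exact DFunLike.congr_fun h1 a
      · intro i
        exact hh none
    exact AlgHom.ext fun a => DFunLike.congr_fun h2 a

theorem IsUniversal.localizationAway {σ : Type*} {J J' : Set σ} {i₀ : σ} (hJ : J' = insert i₀ J)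
    {A : Type u} [CommRing A] [Algebra k A] {x : σ → A} (h : IsUniversal k J x) :
    IsUniversal k J' (fun i => algebraMap A (Localization.Away (x i₀)) (x i)) where
  isUnit i hi := by
    subst hJ
    rcases hi with rfl | hi
    · exact IsLocalization.Away.algebraMap_isUnit _
    · exact (h.isUnit i hi).map _
  lift {R} _ _ y hy := by
    subst hJ
    obtain ⟨φ, hφ⟩ := h.lift y fun i hi => hy i (Or.inr hi)
    have hu : ∀ s : Submonoid.powers (x i₀), IsUnit (φ s) := by
      rintro ⟨_, n, rfl⟩
      change IsUnit (φ (x i₀ ^ n))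
      rw [map_pow, hφ]
      exact (hy _ (Or.inl rfl)).pow n
    refine ⟨IsLocalization.liftAlgHom (S := Localization.Away (x i₀)) hu, fun i => ?_⟩
    rw [IsLocalization.liftAlgHom_apply, IsLocalization.lift_eq]
    exact hφ i
  hom_ext {R} _ _ φ ψ hh := by
    have h1 : φ.comp (IsScalarTower.toAlgHom k A _) = ψ.comp (IsScalarTower.toAlgHom k A _) :=
      h.hom_ext _ _ fun i => hh i
    exact IsLocalization.algHom_ext (Submonoid.powers (x i₀)) h1

theorem ker_aeval_zero (A : Type u) [CommRing A] [Algebra k A] :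
    RingHom.ker ((MvPolynomial.aeval (R := A)
      (fun _ : PUnit.{u + 1} => (0 : A))).restrictScalars k) =
      Ideal.span {(MvPolynomial.X PUnit.unit : MvPolynomial PUnit.{u + 1} A)} := by
  apply le_antisymm
  · intro p hp
    have h : p - MvPolynomial.C (MvPolynomial.aeval (fun _ : PUnit.{u + 1} => (0 : A)) p) ∈
        Ideal.span {(MvPolynomial.X PUnit.unit : MvPolynomial PUnit.{u + 1} A)} := by
      clear hp
      induction p using MvPolynomial.induction_on with
      | C a => simp
      | add p p' hp hp' =>
        rw [map_add, map_add, add_sub_add_comm]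
        exact Ideal.add_mem _ hp hp'
      | mul_X p i _ =>
        simp only [map_mul, MvPolynomial.aeval_X, mul_zero, map_zero, sub_zero]
        exact Ideal.mul_mem_left _ _ (Ideal.mem_span_singleton_self _)
    rw [show MvPolynomial.aeval (fun _ : PUnit.{u + 1} => (0 : A)) p = 0 from hp, map_zero,
      sub_zero] at h
    exact h
  · rw [Ideal.span_singleton_le_iff_mem]
    exact MvPolynomial.aeval_X _ _

-- The variables are adjoined one at a time: each multiplies the class by `q`, or by `q - 1` when it
-- is inverted, and raises the dimension by one in both cases. The universal property is kept
-- instead of explicit coordinates because it is what builds morphisms to and from these varieties.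
open Classical in
theorem exists_isUniversal [Infinite k] (σ : Type) [Finite σ] (J : Set σ) :
    ∃ (A : Type u) (_ : CommRing A) (_ : Algebra k A) (_ : Algebra.FiniteType k A) (x : σ → A),
      IsUniversal k J x ∧ IsDomain A ∧ ringKrullDim A = Nat.card σ ∧
      cls (Var.spec k A) = ∏ᶠ i, if i ∈ J then q k - 1 else q k := by
  induction σ using Finite.induction_empty_option with
  | of_equiv e ih =>
    obtain ⟨A, i1, i2, i3, x, h1, h2, h3, h4⟩ := ih (e ⁻¹' J)
    refine ⟨A, i1, i2, i3, _, h1.of_equiv e, h2, ?_, ?_⟩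
    · rw [h3, Nat.card_congr e]
    · rw [h4]
      exact finprod_eq_of_bijective e e.bijective fun i => rfl
  | h_empty =>
    refine ⟨k, inferInstance, inferInstance, inferInstance, _, isUniversal_of_isEmpty J, inferInstance, ?_, ?_⟩
    · simp
    · rw [cls_spec_self, finprod_of_isEmpty]
  | @h_option σ _ ih =>
    obtain ⟨A, _, _, _, x, h1, h2, h3, h4⟩ := ih (some ⁻¹' J)
    have hdim : ringKrullDim (MvPolynomial PUnit.{u + 1} A) = Nat.card (Option σ) := by
      have : IsNoetherianRing A := Algebra.FiniteType.isNoetherianRing k A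
      rw [MvPolynomial.ringKrullDim_of_isNoetherianRing, h3]
      simp
    have hprod : (∏ᶠ i : Option σ, if i ∈ J then q k - 1 else q k) =
        (if none ∈ J then q k - 1 else q k) * cls (Var.spec k A) := by
      have := Fintype.ofFinite σ
      rw [h4, finprod_eq_prod_of_fintype, finprod_eq_prod_of_fintype, Fintype.prod_option]
      rfl
    by_cases hJ : none ∈ J
    · have h5 : IsUniversal k (J \ {none}) (fun i : Option σ => i.elim (MvPolynomial.X PUnit.unit)
          (fun i => MvPolynomial.C (x i)) : Option σ → MvPolynomial PUnit.{u + 1} A) := by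
        refine IsUniversal.mvPolynomial (by simp) ?_
        convert h1 using 1
        ext i
        simp
      have h6 := h5.localizationAway (J' := J) (i₀ := none) (by simp [hJ])
      refine ⟨Localization.Away (MvPolynomial.X PUnit.unit : MvPolynomial PUnit.{u + 1} A),
        inferInstance, inferInstance, inferInstance, _, h6, ?_, ?_, ?_⟩
      · exact IsLocalization.isDomain_localization (powers_le_nonZeroDivisors_of_noZeroDivisors
          (MvPolynomial.X_ne_zero (R := A) PUnit.unit))
      · refine le_antisymm ?_ ?_
        · rw [← hdim]
          rw [← PrimeSpectrum.topologicalKrullDim_eq_ringKrullDim,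
            ← PrimeSpectrum.topologicalKrullDim_eq_ringKrullDim]
          exact (PrimeSpectrum.localization_comap_isInducing _
            (Submonoid.powers (MvPolynomial.X (R := A) PUnit.unit))).topologicalKrullDim_le
        · rw [← hdim]
          exact ringKrullDim_le_localizationAway k (MvPolynomial.X_ne_zero _)
      · rw [hprod, if_pos hJ]
        have h7 := cls_spec_eq_add (MvPolynomial.X PUnit.unit)
          ((MvPolynomial.aeval (R := A) (fun _ : PUnit.{u + 1} => (0 : A))).restrictScalars k)
          (fun a => ⟨MvPolynomial.C a, MvPolynomial.aeval_C _ _⟩) (ker_aeval_zero _)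
        rw [cls_spec_mvPolynomial] at h7
        rw [sub_mul, one_mul, mul_comm, h7]
        exact (add_sub_cancel_right _ _).symm
    · refine ⟨MvPolynomial PUnit.{u + 1} A, inferInstance, inferInstance, inferInstance, _, h1.mvPolynomial hJ, inferInstance, hdim, ?_⟩
      rw [hprod, if_neg hJ, cls_spec_mvPolynomial, mul_comm]

end Torus

/-! ### Gluing morphisms given on points -/

section Gluing

variable {k : Type u} [Field k]

theorem exists_specMap {A B : Type u} [CommRing A] [Algebra k A] [Algebra.FiniteType k A]
    [CommRing B] [Algebra k B] [Algebra.FiniteType k B] (f : Var.spec k B ⟶ Var.spec k A) :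
    ∃ φ : A →ₐ[k] B, f = specMap φ := by
  let ψ := Spec.preimage (R := CommRingCat.of A) (S := CommRingCat.of B) (Var.mor f)
  have h1 : Var.mor f = Spec.map ψ := (Spec.map_preimage _).symm
  have h := mor_hom f
  rw [h1] at h
  have h2 : Spec.map (CommRingCat.ofHom (algebraMap k A) ≫ ψ) =
      Spec.map (CommRingCat.ofHom (algebraMap k B)) := by
    rw [Spec.map_comp]
    exact h
  have h3 := Spec.map_injective h2
  exact ⟨{ ψ.hom with commutes' := fun a => congrArg (fun f => f.hom a) h3 }, mor_injective h1⟩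

theorem exists_affine_nhd (S : Var k) (x : S.scheme) :
    ∃ (R : Type u) (_ : CommRing R) (_ : Algebra k R) (_ : Algebra.FiniteType k R)
      (j : Var.spec k R ⟶ S), IsOpenImmersion (Var.mor j) ∧ x ∈ Set.range (Var.mor j) := by
  obtain ⟨R, ι, _, hx, -⟩ := Scheme.exists_affine_mem_range_and_range_subset
    (x := x) (U := (⊤ : S.scheme.Opens)) trivial
  let φ : k →+* R := (Spec.preimage (ι ≫ S.obj.hom)).hom
  have hφ : φ.FiniteType := by
    have h1 : LocallyOfFiniteType (Spec.map (Spec.preimage (ι ≫ S.obj.hom))) := by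
      rw [Spec.map_preimage]
      infer_instance
    exact (HasRingHomProperty.Spec_iff (P := @LocallyOfFiniteType)).mp h1
  let _ : Algebra k R := φ.toAlgebra
  exact ⟨R, inferInstance, inferInstance, hφ, homMk ι (Spec.map_preimage (ι ≫ S.obj.hom)).symm,
    inferInstanceAs (IsOpenImmersion ι), hx⟩

/-- Affine open neighbourhoods of a point on which a given function is a unit. -/
theorem exists_affine_nhd_isUnit {S : Var k} {A : Type u} [CommRing A] [Algebra k A]
    [Algebra.FiniteType k A] (i : S ⟶ Var.spec k A) (p : pt k ⟶ S) (δ : A)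
    (hδ : evalAt (p ≫ i) δ ≠ 0) :
    ∃ (R : Type u) (_ : CommRing R) (_ : Algebra k R) (_ : Algebra.FiniteType k R)
      (j : Var.spec k R ⟶ S) (φ : A →ₐ[k] R), IsOpenImmersion (Var.mor j) ∧
      Var.point p ∈ Set.range (Var.mor j) ∧ j ≫ i = specMap φ ∧ IsUnit (φ δ) := by
  obtain ⟨R, _, _, _, j, _, hp⟩ := exists_affine_nhd S (Var.point p)
  obtain ⟨φ, hφ⟩ := exists_specMap (j ≫ i)
  obtain ⟨p', rfl⟩ := exists_lift_point j p hp
  let ψ : R →ₐ[k] Localization.Away (φ δ) := IsScalarTower.toAlgHom k R _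
  have h2 : IsOpenImmersion (Var.mor (specMap ψ)) :=
    Scheme.isOpenImmersion_SpecMap_localizationAway (R := CommRingCat.of R) (φ δ)
  refine ⟨Localization.Away (φ δ), inferInstance, inferInstance, inferInstance, specMap ψ ≫ j,
    ψ.comp φ, ?_, ?_, ?_, ?_⟩
  · rw [mor_comp]
    infer_instance
  · have h3 : Set.range (Var.mor (specMap ψ)) =
        (PrimeSpectrum.basicOpen (φ δ) : Set (PrimeSpectrum R)) :=
      PrimeSpectrum.localization_away_comap_range (Localization.Away (φ δ)) (φ δ)
    have h4 : Var.point p' ∈ Set.range (Var.mor (specMap ψ)) := by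
      rw [h3]
      intro h
      refine hδ ?_
      rw [Category.assoc, hφ, evalAt_comp_specMap]
      exact (mem_point_iff p' (φ δ)).mp h
    obtain ⟨y, hy⟩ := h4
    exact ⟨y, congrArg (Var.mor j) hy⟩
  · rw [Category.assoc, hφ, specMap_comp]
  · exact IsLocalization.Away.algebraMap_isUnit (φ δ)

variable [IsAlgClosed k]

/-- A map on `k`-points that is locally induced by morphisms is induced by one. Neighbourhoods of
the `k`-points already cover `S`, and overlaps are reduced, so the local morphisms agree there
because they agree on `k`-points. -/
theorem exists_glue {S X : Var k} [IsReduced S.scheme] (Φ : (pt k ⟶ S) → (pt k ⟶ X))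
    (h : ∀ p : pt k ⟶ S, ∃ (V : Var k) (j : V ⟶ S) (f : V ⟶ X), IsOpenImmersion (Var.mor j) ∧
      Var.point p ∈ Set.range (Var.mor j) ∧ ∀ p' : pt k ⟶ V, p' ≫ f = Φ (p' ≫ j)) :
    ∃ f : S ⟶ X, ∀ p, p ≫ f = Φ p := by
  choose V j f hj hp hf using h
  have hcov : ⋃ p, Set.range (Var.mor (j p)) = Set.univ :=
    eq_univ_of_points (isOpen_iUnion fun p => (Var.mor (j p)).isOpenEmbedding.isOpen_range).isLocallyClosed
      fun p => Set.mem_iUnion.mpr ⟨p, hp p⟩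
  let 𝒰 : S.scheme.OpenCover := Scheme.Cover.mkOfCovers (P := @IsOpenImmersion) (pt k ⟶ S)
    (fun p => (V p).scheme) (fun p => Var.mor (j p))
    (fun x => by
      obtain ⟨p, y, hy⟩ := Set.mem_iUnion.mp (hcov.ge (Set.mem_univ x))
      exact ⟨p, y, hy⟩) hj
  have hagree : ∀ a b : pt k ⟶ S, Limits.pullback.fst (Var.mor (j a)) (Var.mor (j b)) ≫
      Var.mor (f a) = Limits.pullback.snd (Var.mor (j a)) (Var.mor (j b)) ≫ Var.mor (f b) := by
    intro a b
    have : QuasiCompact (Var.mor (j b)) := inferInstance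
    let h₀ : Limits.pullback (Var.mor (j a)) (Var.mor (j b)) ⟶ Spec (CommRingCat.of k) :=
      Limits.pullback.fst (Var.mor (j a)) (Var.mor (j b)) ≫ (V a).obj.hom
    let W : Var k := ⟨Over.mk h₀, inferInstanceAs (LocallyOfFiniteType h₀),
      inferInstanceAs (QuasiCompact h₀), inferInstanceAs (IsSeparated h₀)⟩
    let w₁ : W ⟶ V a := homMk (Limits.pullback.fst _ _) rfl
    let w₂ : W ⟶ V b := homMk (Limits.pullback.snd _ _) (by
      change _ = Limits.pullback.fst _ _ ≫ _
      rw [← mor_hom (j a), ← mor_hom (j b), Limits.pullback.condition_assoc])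
    have hw : w₁ ≫ j a = w₂ ≫ j b := mor_injective Limits.pullback.condition
    have : IsOpenImmersion (Var.mor w₁) := inferInstanceAs (IsOpenImmersion
      (Limits.pullback.fst (Var.mor (j a)) (Var.mor (j b))))
    have : IsOpenImmersion (Var.mor (w₁ ≫ j a)) := by
      rw [mor_comp]
      infer_instance
    have : IsReduced W.scheme := isReduced_of_isOpenImmersion (Var.mor (w₁ ≫ j a))
    have key : w₁ ≫ f a = w₂ ≫ f b := hom_ext_points fun p => by
      rw [← Category.assoc, hf, ← Category.assoc, hf, Category.assoc, Category.assoc, hw]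
    exact congrArg Var.mor key
  have hglue : ∀ a, Var.mor (j a) ≫ 𝒰.glueMorphisms (fun a => Var.mor (f a)) hagree = Var.mor (f a) :=
    fun a => 𝒰.ι_glueMorphisms (fun a => Var.mor (f a)) hagree a
  have hover : 𝒰.glueMorphisms (fun a => Var.mor (f a)) hagree ≫ X.obj.hom = S.obj.hom := by
    refine Scheme.Cover.hom_ext 𝒰 _ _ fun a => ?_
    change Var.mor (j a) ≫ _ = Var.mor (j a) ≫ _
    rw [reassoc_of% hglue a, mor_hom, mor_hom]
  refine ⟨homMk _ hover, fun p => ?_⟩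
  obtain ⟨p', hp'⟩ := exists_lift_point (j p) p (hp p)
  have h1 : j p ≫ homMk _ hover = f p := mor_injective (hglue p)
  rw [← hp', Category.assoc, hp', h1, hf, hp']

end Gluing

/-! ### Types of matrices -/

section Types

open Polynomial

variable {r : ℕ} (m : Fin r → ℕ)

/-- The degree of the `i`-th invariant factor of a matrix of type `m`. -/
def degSeq (i : ℕ) : ℕ := ∑ l : Fin r, if i ≤ l then m l else 0

/-- The sum of the degrees of the first `j` invariant factors of a matrix of type `m`. -/
def degSum (j : ℕ) : ℕ := ∑ i : Fin j, degSeq m i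

theorem degSeq_of_le {i : ℕ} (hi : r ≤ i) : degSeq m i = 0 :=
  Finset.sum_eq_zero fun l _ => if_neg (by omega)

theorem degSeq_eq_add (i : Fin r) : degSeq m i = m i + degSeq m (i + 1) := by
  have h : ∀ l : Fin r, (if (i : ℕ) ≤ l then m l else 0) =
      (if l = i then m l else 0) + if (i : ℕ) + 1 ≤ l then m l else 0 := by
    intro l
    by_cases h1 : l = i
    · subst h1
      simp
    · have : (l : ℕ) ≠ i := fun h => h1 (Fin.ext h)
      rw [if_neg h1, zero_add]
      congr 1
      apply propext
      omega
  rw [degSeq, degSeq, Finset.sum_congr rfl fun l _ => h l, Finset.sum_add_distrib]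
  simp

theorem degSum_self : degSum m r = ∑ l : Fin r, ((l : ℕ) + 1) * m l := by
  rw [degSum]
  simp only [degSeq]
  rw [Finset.sum_comm]
  refine Finset.sum_congr rfl fun l _ => ?_
  rw [← Finset.sum_filter, Finset.sum_const, smul_eq_mul]
  congr 1
  have : (Finset.univ.filter fun i : Fin r => (i : ℕ) ≤ l) = Finset.Iic l :=
    Finset.ext fun i => by
      rw [Finset.mem_filter, Finset.mem_Iic, Fin.le_def]
      exact and_iff_right (Finset.mem_univ i)
  rw [this, Fin.card_Iic]

theorem degSum_succ (j : ℕ) : degSum m (j + 1) = degSum m j + degSeq m j := by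
  rw [degSum, degSum, Fin.sum_univ_castSucc]
  rfl

theorem degSum_mono : Monotone (degSum m) :=
  monotone_nat_of_le_succ fun j => by rw [degSum_succ]; omega

theorem degSum_le (hm : m ∈ types r) {j : ℕ} (hj : j ≤ r) : degSum m j ≤ r :=
  (degSum_mono m hj).trans (by rw [degSum_self, mem_types.mp hm])

section Ring

variable {B : Type*} [CommRing B] {B' : Type*} [CommRing B']

/-- The monic polynomial of degree `m j` with given lower coefficients. -/
def gPoly (c : (Σ j : Fin r, Fin (m j)) → B) (j : Fin r) : B[X] :=
  X ^ m j + ∑ l : Fin (m j), C (c ⟨j, l⟩) * X ^ (l : ℕ)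

theorem degree_gPoly_aux (c : (Σ j : Fin r, Fin (m j)) → B) (j : Fin r) :
    (∑ l : Fin (m j), C (c ⟨j, l⟩) * X ^ (l : ℕ)).degree < (m j : WithBot ℕ) :=
  degree_sum_fin_lt fun l => c ⟨j, l⟩

theorem gPoly_monic (c : (Σ j : Fin r, Fin (m j)) → B) (j : Fin r) : (gPoly m c j).Monic :=
  monic_X_pow_add (degree_gPoly_aux m c j)

theorem natDegree_gPoly [Nontrivial B] (c : (Σ j : Fin r, Fin (m j)) → B) (j : Fin r) :
    (gPoly m c j).natDegree = m j := by
  refine natDegree_eq_of_degree_eq_some ?_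
  rw [gPoly, degree_add_eq_left_of_degree_lt, degree_X_pow]
  rw [degree_X_pow]
  exact degree_gPoly_aux m c j

theorem coeff_gPoly (c : (Σ j : Fin r, Fin (m j)) → B) (j : Fin r) (l : Fin (m j)) :
    (gPoly m c j).coeff l = c ⟨j, l⟩ := by
  rw [gPoly, coeff_add, coeff_X_pow, if_neg l.2.ne, zero_add, finsetSum_coeff,
    Finset.sum_eq_single l]
  · simp
  · intro b _ hb
    rw [coeff_C_mul, coeff_X_pow, if_neg, mul_zero]
    exact fun h => hb (Fin.ext h.symm)
  · simp

theorem gPoly_map (φ : B →+* B') (c : (Σ j : Fin r, Fin (m j)) → B) (j : Fin r) :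
    (gPoly m c j).map φ = gPoly m (fun i => φ (c i)) j := by
  simp [gPoly, Polynomial.map_sum]

theorem eq_gPoly {p : B[X]} {j : Fin r} (hp : p.Monic) (hd : p.natDegree = m j)
    {c : (Σ j : Fin r, Fin (m j)) → B} (hc : ∀ l : Fin (m j), c ⟨j, l⟩ = p.coeff l) :
    p = gPoly m c j := by
  refine hp.as_sum.trans ?_
  rw [gPoly, hd, Finset.sum_range]
  exact congrArg _ (Finset.sum_congr rfl fun l _ => by rw [hc])

/-- The product of the `gPoly m c l` with `i ≤ l`. -/
def fPoly (c : (Σ j : Fin r, Fin (m j)) → B) (i : ℕ) : B[X] :=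
  ∏ l : Fin r, if i ≤ l then gPoly m c l else 1

theorem fPoly_of_le (c : (Σ j : Fin r, Fin (m j)) → B) {i : ℕ} (hi : r ≤ i) : fPoly m c i = 1 :=
  Finset.prod_eq_one fun l _ => if_neg (by omega)

theorem fPoly_eq_mul (c : (Σ j : Fin r, Fin (m j)) → B) (i : Fin r) :
    fPoly m c i = gPoly m c i * fPoly m c (i + 1) := by
  have h : ∀ l : Fin r, (if (i : ℕ) ≤ l then gPoly m c l else 1) =
      (if l = i then gPoly m c l else 1) * if (i : ℕ) + 1 ≤ l then gPoly m c l else 1 := by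
    intro l
    by_cases h1 : l = i
    · subst h1
      simp
    · have : (l : ℕ) ≠ i := fun h => h1 (Fin.ext h)
      rw [if_neg h1, one_mul]
      congr 1
      apply propext
      omega
  rw [fPoly, fPoly, Finset.prod_congr rfl fun l _ => h l, Finset.prod_mul_distrib]
  simp

theorem fPoly_monic (c : (Σ j : Fin r, Fin (m j)) → B) (i : ℕ) : (fPoly m c i).Monic := by
  refine monic_prod_of_monic _ _ fun l _ => ?_
  split_ifs
  · exact gPoly_monic m c l
  · exact monic_one

theorem natDegree_fPoly [Nontrivial B] (c : (Σ j : Fin r, Fin (m j)) → B) (i : ℕ) :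
    (fPoly m c i).natDegree = degSeq m i := by
  rw [fPoly, natDegree_prod_of_monic, degSeq]
  · refine Finset.sum_congr rfl fun l _ => ?_
    split_ifs
    · exact natDegree_gPoly m c l
    · exact natDegree_one
  · intro l _
    split_ifs
    · exact gPoly_monic m c l
    · exact monic_one

theorem fPoly_map (φ : B →+* B') (c : (Σ j : Fin r, Fin (m j)) → B) (i : ℕ) :
    (fPoly m c i).map φ = fPoly m (fun i => φ (c i)) i := by
  rw [fPoly, Polynomial.map_prod, fPoly]
  refine Finset.prod_congr rfl fun l _ => ?_
  split_ifs
  · exact gPoly_map m φ c l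
  · exact Polynomial.map_one φ

/-- The lower coefficients of the quotients of consecutive polynomials of a chain. -/
def coords (f : ℕ → B[X]) (i : Σ j : Fin r, Fin (m j)) : B :=
  (f i.1 /ₘ f (i.1 + 1)).coeff i.2

theorem coords_fPoly (c : (Σ j : Fin r, Fin (m j)) → B) : coords m (fPoly m c) = c := by
  funext ⟨j, l⟩
  rw [coords, fPoly_eq_mul, mul_comm, mul_divByMonic_cancel_left _ (fPoly_monic m c _)]
  exact coeff_gPoly m c j l

end Ring

variable {k : Type u} [Field k]

theorem isChainOf_fPoly (c : (Σ j : Fin r, Fin (m j)) → k) : IsChainOf (fPoly m c) where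
  monic := fPoly_monic m c
  dvd i := by
    by_cases hi : i < r
    · exact ⟨_, (fPoly_eq_mul m c ⟨i, hi⟩).trans (mul_comm _ _)⟩
    · rw [fPoly_of_le m c (i := i + 1) (by omega)]
      exact one_dvd _

/-- A chain of monic polynomials is determined by its coordinates. -/
theorem eq_fPoly {f : ℕ → k[X]} (hf : IsChainOf f) (h1 : ∀ i, r ≤ i → f i = 1)
    (hd : ∀ i : Fin r, (f i).natDegree = degSeq m i) : f = fPoly m (coords m f) := by
  have hd' : ∀ i, (f i).natDegree = degSeq m i := by
    intro i
    by_cases hi : i < r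
    · exact hd ⟨i, hi⟩
    · rw [h1 i (not_lt.mp hi), degSeq_of_le m (not_lt.mp hi), natDegree_one]
  have hmul : ∀ i, f (i + 1) * (f i /ₘ f (i + 1)) = f i := fun i => by
    obtain ⟨g, hg⟩ := hf.dvd i
    rw [hg, mul_divByMonic_cancel_left _ (hf.monic _)]
  have hg : ∀ i : Fin r, f i /ₘ f (i + 1) = gPoly m (coords m f) i := by
    intro i
    refine eq_gPoly m ?_ ?_ fun l => rfl
    · have := hf.monic i
      rw [← hmul i] at this
      exact (hf.monic _).of_mul_monic_left this
    · rw [natDegree_divByMonic _ (hf.monic _), hd', hd', degSeq_eq_add]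
      omega
  have key : ∀ n i, r ≤ i + n → f i = fPoly m (coords m f) i := by
    intro n
    induction n with
    | zero =>
      intro i hi
      rw [h1 i hi, fPoly_of_le m _ (i := i) hi]
    | succ n ih =>
      intro i hi
      by_cases hir : i < r
      · rw [fPoly_eq_mul m _ ⟨i, hir⟩, ← hg, ← ih (i + 1) (by omega), mul_comm]
        exact (hmul i).symm
      · exact ih i (by omega)
  exact funext fun i => key r i (by omega)

theorem exists_type {A : Matrix (Fin r) (Fin r) k} {f : ℕ → k[X]} (h : HasInvariantFactors A f) :
    ∃ m ∈ types r, ∀ i : Fin r, (f i).natDegree = degSeq m i := by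
  let m : Fin r → ℕ := fun i => (f i).natDegree - (f (i + 1)).natDegree
  have hle : ∀ i, (f (i + 1)).natDegree ≤ (f i).natDegree := fun i =>
    natDegree_le_of_dvd (h.chain.dvd i) (h.chain.monic i).ne_zero
  have key : ∀ n i, r ≤ i + n → (f i).natDegree = degSeq m i := by
    intro n
    induction n with
    | zero =>
      intro i hi
      rw [h.eq_one i hi, degSeq_of_le m (i := i) hi, natDegree_one]
    | succ n ih =>
      intro i hi
      by_cases hir : i < r
      · have h1 := degSeq_eq_add m ⟨i, hir⟩
        rw [← ih (i + 1) (by omega)] at h1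
        have h2 : m ⟨i, hir⟩ = (f i).natDegree - (f (i + 1)).natDegree := rfl
        have := hle i
        simp only at h1
        omega
      · exact ih i (by omega)
  have hd : ∀ i : Fin r, (f i).natDegree = degSeq m i := fun i => key r i (by omega)
  refine ⟨m, mem_types.mpr ?_, hd⟩
  rw [← degSum_self, degSum]
  exact (Finset.sum_congr rfl fun i _ => (hd i).symm).trans h.sum_natDegree

theorem HasInvariantFactors.sum_eq_degSum {f : ℕ → k[X]}
    (hd : ∀ i : Fin r, (f i).natDegree = degSeq m i) {j : ℕ} (hj : j ≤ r) :
    ∑ i : Fin j, (f i).natDegree = degSum m j :=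
  Finset.sum_congr rfl fun i _ => hd (Fin.castLE hj i)

/-- The type is determined by the maximal dimensions of submodules with `j` generators, a
description that does not mention the invariant factors and is open or closed condition by
condition. -/
theorem natDegree_eq_degSeq_iff [Infinite k] {A : Matrix (Fin r) (Fin r) k} {f : ℕ → k[X]}
    (h : HasInvariantFactors A f) : (∀ i : Fin r, (f i).natDegree = degSeq m i) ↔
      ∀ j : Fin (r + 1), Reach A j (degSum m j) ∧ ¬ Reach A j (degSum m j + 1) := by
  have key : (∀ j : Fin (r + 1), Reach A j (degSum m j) ∧ ¬ Reach A j (degSum m j + 1)) ↔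
      ∀ j ≤ r, ∑ i : Fin j, (f i).natDegree = degSum m j := by
    constructor
    · intro H j hj
      have := H ⟨j, by omega⟩
      rw [h.reach_iff hj, h.reach_iff hj] at this
      simp only at this
      omega
    · intro H j
      rw [h.reach_iff (by omega), h.reach_iff (by omega), H j (by omega)]
      omega
  rw [key]
  constructor
  · intro H j hj
    exact HasInvariantFactors.sum_eq_degSum m H hj
  · intro H i
    have h1 := H i i.2.le
    have h2 := H (i + 1) i.2
    rw [Fin.sum_univ_castSucc, degSum_succ] at h2
    simp only [Fin.val_castSucc, Fin.val_last] at h2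
    omega

/-- The invariant factors are unique. -/
theorem HasInvariantFactors.unique [Infinite k] {A : Matrix (Fin r) (Fin r) k} {f f' : ℕ → k[X]}
    (h : HasInvariantFactors A f) (h' : HasInvariantFactors A f') : f = f' := by
  obtain ⟨m, -, hd⟩ := exists_type h
  have hd' := (natDegree_eq_degSeq_iff m h').mpr ((natDegree_eq_degSeq_iff m h).mp hd)
  -- Both products equal the block polynomial of the same Krylov datum, so the factors agree after
  -- cancellation.
  have hprod : ∀ j ≤ r, ∏ i : Fin j, f i = ∏ i : Fin j, f' i := by
    intro j hj
    obtain ⟨D, hD⟩ := exists_krylovDatum (((natDegree_eq_degSeq_iff m h).mp hd) ⟨j, by omega⟩).1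
    rw [← h.blockPoly_eq (HasInvariantFactors.sum_eq_degSum m hd hj).symm D hD,
      ← h'.blockPoly_eq (HasInvariantFactors.sum_eq_degSum m hd' hj).symm D hD]
  funext i
  by_cases hi : i < r
  · have h1 := hprod i hi.le
    have h2 := hprod (i + 1) hi
    rw [Fin.prod_univ_castSucc, Fin.prod_univ_castSucc] at h2
    simp only [Fin.val_castSucc, Fin.val_last] at h2
    rw [h1] at h2
    exact mul_left_cancel₀ (monic_prod_of_monic Finset.univ (fun i : Fin i => f' i)
      fun i _ => h'.chain.monic i).ne_zero h2
  · rw [h.eq_one i (not_lt.mp hi), h'.eq_one i (not_lt.mp hi)]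

end Types

/-! ### The stratification of the general linear group -/

section Strata

open Polynomial

variable {k : Type u} [Field k] {r : ℕ}

variable (k r) in
/-- The universal invertible matrix. -/
def uMat : Matrix (Fin r) (Fin r) (GLRing k r) := (GLRing.universal k r).1

theorem pointMatrix_val (p : pt k ⟶ GLVar k r) :
    (pointMatrix p).1 = (uMat k r).map (evalAt p) := rfl

theorem exists_algHom_of_isUnit_det {R : Type u} [CommRing R] [Algebra k R]
    (M : Matrix (Fin r) (Fin r) R) (hM : IsUnit M.det) :
    ∃ φ : GLRing k r →ₐ[k] R, (uMat k r).map φ = M := by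
  let φ₀ : MvPolynomial (Fin r × Fin r) k →ₐ[k] R := MvPolynomial.aeval fun i => M i.1 i.2
  have h0 : (Matrix.mvPolynomialX (Fin r) (Fin r) k).map φ₀ = M := by
    ext i j
    simp [φ₀, Matrix.mvPolynomialX]
  have hdet : φ₀ (Matrix.mvPolynomialX (Fin r) (Fin r) k).det = M.det := by
    rw [AlgHom.map_det, ← h0]
    rfl
  have hu : ∀ s : Submonoid.powers (Matrix.mvPolynomialX (Fin r) (Fin r) k).det, IsUnit (φ₀ s) := by
    rintro ⟨_, n, rfl⟩
    change IsUnit (φ₀ (_ ^ n))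
    rw [map_pow, hdet]
    exact hM.pow n
  refine ⟨IsLocalization.liftAlgHom (S := GLRing k r) hu, ?_⟩
  rw [← h0]
  ext i j
  exact IsLocalization.lift_eq _ _

/-- The points `A` of `GL_r` such that some subspace that is generated by `j` vectors as a
`k[A]`-module has dimension at least `s`. -/
def reachSet (k : Type u) [Field k] (r j s : ℕ) : Set (GLVar k r).scheme :=
  ⋃ D : KrylovDatum k r j s,
    (PrimeSpectrum.basicOpen (D.mat (uMat k r)).det : Set (PrimeSpectrum (GLRing k r)))

theorem isOpen_reachSet (j s : ℕ) : IsOpen (reachSet k r j s) :=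
  isOpen_iUnion fun _ => (PrimeSpectrum.basicOpen _).isOpen

theorem point_mem_reachSet {j s : ℕ} (p : pt k ⟶ GLVar k r) :
    Var.point p ∈ reachSet k r j s ↔ Reach (pointMatrix p).1 j s := by
  have h : ∀ D : KrylovDatum k r j s, Var.point p ∈ (PrimeSpectrum.basicOpen
      (D.mat (uMat k r)).det : Set (PrimeSpectrum (GLRing k r))) ↔
      (D.mat (pointMatrix p).1).det ≠ 0 := by
    intro D
    rw [pointMatrix_val, D.det_map]
    exact (mem_point_iff p _).not
  constructor
  · intro hp
    obtain ⟨D, hD⟩ := Set.mem_iUnion.mp hp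
    exact D.reach ((h D).mp hD)
  · intro hr
    obtain ⟨D, hD⟩ := exists_krylovDatum hr
    exact Set.mem_iUnion.mpr ⟨D, (h D).mpr hD⟩

/-- The stratum of the matrices of type `m`. -/
def stratum (k : Type u) [Field k] {r : ℕ} (m : Fin r → ℕ) : Set (GLVar k r).scheme :=
  (⋂ j : Fin (r + 1), reachSet k r j (degSum m j)) ∩
    ⋂ j : Fin (r + 1), (reachSet k r j (degSum m j + 1))ᶜ

theorem isLocallyClosed_stratum (m : Fin r → ℕ) : IsLocallyClosed (stratum k m) :=
  (isOpen_iInter_of_finite fun _ => isOpen_reachSet _ _).isLocallyClosed.inter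
    (isClosed_iInter fun _ => (isOpen_reachSet _ _).isClosed_compl).isLocallyClosed

theorem point_mem_stratum [Infinite k] {m : Fin r → ℕ} (p : pt k ⟶ GLVar k r) {f : ℕ → k[X]}
    (h : HasInvariantFactors (pointMatrix p).1 f) :
    Var.point p ∈ stratum k m ↔ ∀ i : Fin r, (f i).natDegree = degSeq m i := by
  rw [natDegree_eq_degSeq_iff m h, stratum, Set.mem_inter_iff, Set.mem_iInter, Set.mem_iInter,
    ← forall_and]
  simp only [Set.mem_compl_iff, point_mem_reachSet]

variable [IsAlgClosed k]

theorem disjoint_stratum {m m' : Fin r → ℕ} (hmm : m ≠ m') :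
    Disjoint (stratum k m) (stratum k m') := by
  have : Infinite k := IsAlgClosed.instInfinite
  rw [Set.disjoint_iff_inter_eq_empty]
  by_contra hne
  obtain ⟨p, hp, hp'⟩ := exists_point_mem (X := GLVar k r)
    ((isLocallyClosed_stratum m).inter (isLocallyClosed_stratum m'))
    (Set.nonempty_iff_ne_empty.mpr hne)
  obtain ⟨f, hf⟩ := exists_hasInvariantFactors (pointMatrix p).1
  rw [point_mem_stratum p hf] at hp hp'
  have hd : ∀ i, degSeq m i = degSeq m' i := by
    intro i
    by_cases hi : i < r
    · exact (hp ⟨i, hi⟩).symm.trans (hp' ⟨i, hi⟩)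
    · rw [degSeq_of_le m (not_lt.mp hi), degSeq_of_le m' (not_lt.mp hi)]
  apply hmm
  funext i
  have h1 := degSeq_eq_add m i
  have h2 := degSeq_eq_add m' i
  rw [hd, hd] at h1
  omega

/-- A point `x` of the scheme need not be closed. It is replaced by a `k`-point lying in exactly the
same sets `reachSet k r j s` for `j ≤ r` and `s ≤ r + 1`, which are all the sets that occur in the
strata of the types in `types r`. -/
theorem iUnion_stratum : ⋃ m ∈ types r, stratum k m = Set.univ := by
  have : Infinite k := IsAlgClosed.instInfinite
  refine Set.eq_univ_of_forall fun x => ?_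
  let R : Fin (r + 1) × Fin (r + 2) → Set (GLVar k r).scheme := fun a => reachSet k r a.1 a.2
  have hR : ∀ a, IsOpen (R a) := fun a => isOpen_reachSet _ _
  have hW : IsLocallyClosed ((⋂ a, {y | x ∈ R a → y ∈ R a}) ∩ ⋂ a, {y | x ∉ R a → y ∉ R a}) := by
    refine (isOpen_iInter_of_finite fun a => ?_).isLocallyClosed.inter
      (isClosed_iInter fun a => ?_).isLocallyClosed
    · by_cases hx : x ∈ R a
      · simpa [hx] using hR a
      · simp [hx]
    · by_cases hx : x ∈ R a
      · simp [hx]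
      · have : {y | x ∉ R a → y ∉ R a} = (R a)ᶜ := Set.ext fun y => by simp [hx]
        rw [this]
        exact (hR a).isClosed_compl
  obtain ⟨p, hp⟩ := exists_point_mem hW ⟨x, by simp⟩
  have hiff : ∀ j s, j ≤ r → s ≤ r + 1 → (x ∈ reachSet k r j s ↔ Var.point p ∈ reachSet k r j s) := by
    intro j s hj hs
    have h1 := Set.mem_iInter.mp hp.1 (⟨j, by omega⟩, ⟨s, by omega⟩)
    have h2 := Set.mem_iInter.mp hp.2 (⟨j, by omega⟩, ⟨s, by omega⟩)
    exact ⟨h1, fun h => by_contra fun h3 => h2 h3 h⟩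
  obtain ⟨f, hf⟩ := exists_hasInvariantFactors (pointMatrix p).1
  obtain ⟨m, hm, hd⟩ := exists_type hf
  have hpm := (point_mem_stratum p hf).mpr hd
  refine Set.mem_biUnion hm ⟨Set.mem_iInter.mpr fun j => ?_, Set.mem_iInter.mpr fun j => ?_⟩
  · have := degSum_le m hm (j := j) (by omega)
    rw [hiff _ _ (by omega) (by omega)]
    exact Set.mem_iInter.mp hpm.1 j
  · have := degSum_le m hm (j := j) (by omega)
    rw [Set.mem_compl_iff, hiff _ _ (by omega) (by omega)]
    exact Set.mem_iInter.mp hpm.2 j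

end Strata

/-! ### Existence of a presentation -/

section Existence

open Polynomial

/-- The indices of the constant coefficients. -/
def constIndex {r : ℕ} (m : Fin r → ℕ) : Set (Σ j : Fin r, Fin (m j)) := {i | (i.2 : ℕ) = 0}

variable {k : Type u} [Field k] {r : ℕ} {m : Fin r → ℕ}

theorem coeff_zero_fPoly_ne_zero {c : (Σ j : Fin r, Fin (m j)) → k}
    (hc : ∀ i ∈ constIndex m, c i ≠ 0) (i : ℕ) : (fPoly m c i).coeff 0 ≠ 0 := by
  rw [fPoly, coeff_zero_prod, Finset.prod_ne_zero_iff]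
  intro l _
  split_ifs
  · by_cases hm : m l = 0
    · have : gPoly m c l = 1 := by
        refine (gPoly_monic m c l).natDegree_eq_zero.mp ?_
        rw [natDegree_gPoly, hm]
      rw [this]
      simp
    · have h1 := coeff_gPoly m c l ⟨0, Nat.pos_of_ne_zero hm⟩
      rw [h1]
      exact hc ⟨l, ⟨0, Nat.pos_of_ne_zero hm⟩⟩ rfl
  · simp

theorem coords_ne_zero {A : Matrix (Fin r) (Fin r) k} {f : ℕ → k[X]}
    (h : HasInvariantFactors A f) (hA : A.det ≠ 0) (i) (hi : i ∈ constIndex m) :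
    coords m f i ≠ 0 := by
  have h1 := h.det_ne_zero_iff.mp hA i.1
  obtain ⟨g, hg⟩ := h.chain.dvd i.1
  rw [coords, show (i.2 : ℕ) = 0 from hi, hg, mul_divByMonic_cancel_left _ (h.chain.monic _)]
  rw [hg, mul_coeff_zero] at h1
  exact right_ne_zero_of_mul h1

/-- Local coordinates of the invariant factors. -/
theorem exists_local_coords {R : Type u} [CommRing R] [Nontrivial R] [Algebra k R]
    [Infinite k] (A : Matrix (Fin r) (Fin r) R) (D : ∀ j : Fin (r + 1), KrylovDatum k r j (degSum m j))
    (hD : ∀ j, IsUnit ((D j).mat A).det) :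
    ∃ y : (Σ j : Fin r, Fin (m j)) → R, ∀ (φ : R →ₐ[k] k) (f : ℕ → k[X]),
      HasInvariantFactors (A.map φ) f → (∀ i : Fin r, (f i).natDegree = degSeq m i) →
      ∀ i, φ (y i) = coords m f i := by
  -- At `k`-points where the type is `m`, `E j` specializes to `f_0 ⋯ f_{j-1}`, so `F i` specializes
  -- to `f_i`. Exact divisibility over `R` is not needed: division with remainder by a monic
  -- polynomial commutes with base change.
  let E : Fin (r + 1) → R[X] := fun j => (D j).blockPoly A
  have hE : ∀ j, (E j).Monic := fun j => (D j).blockPoly_monic A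
  have hEd : ∀ j, (E j).natDegree = degSum m j := fun j => by
    simp [E, KrylovDatum.blockPoly, Matrix.charpoly_natDegree_eq_dim]
  let F : ℕ → R[X] := fun i => if h : i < r then E ⟨i + 1, by omega⟩ /ₘ E ⟨i, by omega⟩ else 1
  have hF : ∀ i, (F i).Monic := by
    intro i
    by_cases h : i < r
    · simp only [F, dif_pos h]
      rw [Monic, leadingCoeff_divByMonic_of_monic (hE _)]
      · exact hE _
      · rw [degree_eq_natDegree (hE _).ne_zero, degree_eq_natDegree (hE _).ne_zero, hEd, hEd]
        exact_mod_cast degSum_mono m (Nat.le_succ i)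
    · simp only [F, dif_neg h]
      exact monic_one
  refine ⟨coords m F, fun φ f hf hd i => ?_⟩
  have h1 : ∀ j, (E j).map φ.toRingHom = ∏ i : Fin j, f i := by
    intro j
    rw [← hf.blockPoly_eq (HasInvariantFactors.sum_eq_degSum m hd (by omega)).symm (D j) ?_,
      (D j).blockPoly_map φ A (hD j)]
    rw [(D j).det_map φ A]
    exact ((hD j).map φ).ne_zero
  have h2 : ∀ i, (F i).map φ.toRingHom = f i := by
    intro i
    by_cases h : i < r
    · simp only [F, dif_pos h]
      rw [map_divByMonic _ (hE _), h1, h1]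
      simp only
      rw [Fin.prod_univ_castSucc]
      exact mul_divByMonic_cancel_left _ (monic_prod_of_monic Finset.univ (fun l : Fin i => f l)
        fun l _ => hf.chain.monic l)
    · simp only [F, dif_neg h]
      rw [Polynomial.map_one, hf.eq_one i (not_lt.mp h)]
  rw [coords, coords, ← h2, ← h2, ← map_divByMonic _ (hF _), coeff_map]
  rfl

variable {B : Type u} [CommRing B] [Algebra k B] [Algebra.FiniteType k B]
  {x : (Σ j : Fin r, Fin (m j)) → B} (hx : IsUniversal k (constIndex m) x)
  {S : Var k} (ι : S ⟶ GLVar k r)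
  (hι : Set.range (Var.mor ι) = stratum k m)

theorem det_pointMatrix_ne_zero (p : pt k ⟶ GLVar k r) : (pointMatrix p).1.det ≠ 0 :=
  ((Matrix.isUnit_iff_isUnit_det _).mp (pointMatrix p).isUnit).ne_zero

include hι in
theorem natDegree_of_stratum [Infinite k] (p : pt k ⟶ S) {f : ℕ → k[X]}
    (hf : HasInvariantFactors (pointMatrix (p ≫ ι)).1 f) (i : Fin r) :
    (f i).natDegree = degSeq m i :=
  (point_mem_stratum (p ≫ ι) hf).mp (hι.le ⟨Var.point p, rfl⟩) i

theorem pointMatrix_comp {R : Type u} [CommRing R] [Algebra k R] [Algebra.FiniteType k R]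
    {f : Var.spec k R ⟶ GLVar k r} {φ : GLRing k r →ₐ[k] R} (hf : f = specMap φ)
    (p : pt k ⟶ Var.spec k R) :
    (pointMatrix (p ≫ f)).1 = ((uMat k r).map φ).map (evalAt p) := by
  subst hf
  ext i j
  exact DFunLike.congr_fun (evalAt_comp_specMap φ p) _

variable [IsAlgClosed k]

include hx hι in
/-- The normal forms in a stratum. -/
theorem exists_normalForm (hm : m ∈ types r) [_root_.IsReduced B] [IsImmersion (Var.mor ι)] :
    ∃ σ : Var.spec k B ⟶ S, ∀ p : pt k ⟶ Var.spec k B,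
      HasInvariantFactors (pointMatrix (p ≫ σ ≫ ι)).1 (fPoly m fun l => evalAt p (x l)) := by
  have : Infinite k := IsAlgClosed.instInfinite
  have hd : ∑ i : Fin r, degSeq m i = r := by
    exact (degSum_self m).trans (mem_types.mp hm)
  let M : Matrix (Fin r) (Fin r) B := canonicalForm (fun i : Fin r => degSeq m i) hd
    fun i => fPoly m x i
  have hM : ∀ p : pt k ⟶ Var.spec k B,
      HasInvariantFactors (M.map (evalAt p)) (fPoly m fun l => evalAt p (x l)) := by
    intro p
    have h1 : M.map (evalAt p) = canonicalForm (fun i : Fin r => degSeq m i) hd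
        fun i => fPoly m (fun l => evalAt p (x l)) i := by
      refine (canonicalForm_map (evalAt p).toRingHom _ hd _).trans ?_
      congr 1
      funext i
      exact fPoly_map m (evalAt p).toRingHom x i
    rw [h1]
    exact hasInvariantFactors_canonicalForm (isChainOf_fPoly m _) (fun i hi => fPoly_of_le m _ hi) _
      (fun i => natDegree_fPoly m _ i) hd
  -- Invertibility is tested at `k`-points, where it says that the constant terms of the invariant
  -- factors are nonzero; these come from the inverted variables.
  have hdet : IsUnit M.det := by
    refine isUnit_of_evalAt (k := k) fun p => ?_
    rw [AlgHom.map_det]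
    exact (hM p).det_ne_zero_iff.mpr (coeff_zero_fPoly_ne_zero fun l hl =>
      ((hx.isUnit l hl).map (evalAt p)).ne_zero)
  obtain ⟨φ, hφ⟩ := exists_algHom_of_isUnit_det (k := k) M hdet
  let g : Var.spec k B ⟶ GLVar k r := specMap φ
  have hpt : ∀ p : pt k ⟶ Var.spec k B, (pointMatrix (p ≫ g)).1 = M.map (evalAt p) := by
    intro p
    rw [pointMatrix_comp rfl, hφ]
  obtain ⟨σ, hσ⟩ := exists_lift g ι (by
    rw [hι]
    refine range_subset_of_points _ (isLocallyClosed_stratum m) fun p => ?_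
    refine (point_mem_stratum (p ≫ g) ((hpt p).symm ▸ hM p)).mpr fun i => ?_
    exact natDegree_fPoly m _ i)
  refine ⟨σ, fun p => ?_⟩
  rw [hσ, hpt]
  exact hM p

variable [IsReduced S.scheme]

include hx hι in
/-- The quotient morphism of a stratum: the coefficients of the quotients of consecutive
invariant factors. -/
theorem exists_quotient : ∃ π : S ⟶ Var.spec k B, ∀ (p : pt k ⟶ S) (f : ℕ → k[X]),
    HasInvariantFactors (pointMatrix (p ≫ ι)).1 f →
      ∀ l, evalAt (p ≫ π) (x l) = coords m f l := by
  have : Infinite k := IsAlgClosed.instInfinite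
  choose f hf using fun p : pt k ⟶ S => exists_hasInvariantFactors (pointMatrix (p ≫ ι)).1
  choose ψ hψ using fun p : pt k ⟶ S => hx.lift (coords m (f p))
    fun l hl => (coords_ne_zero (hf p) (det_pointMatrix_ne_zero _) l hl).isUnit
  obtain ⟨π, hπ⟩ := exists_glue (S := S) (X := Var.spec k B) (fun p => pointOf (ψ p)) (by
    intro p
    have h1 := (natDegree_eq_degSeq_iff m (hf p)).mp (natDegree_of_stratum ι hι p (hf p))
    choose D hD using fun j => exists_krylovDatum (h1 j).1
    -- On this neighbourhood the Krylov matrices that work at `p` for every `j` remain invertible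
    -- simultaneously.
    obtain ⟨R, _, _, _, j, φ, hj, hp, hφ, hu⟩ := exists_affine_nhd_isUnit ι p
      (∏ j, ((D j).mat (uMat k r)).det) (by
        rw [map_prod, Finset.prod_ne_zero_iff]
        intro a _
        rw [← (D a).det_map]
        exact hD a)
    -- A `k`-point of `Spec R` shows that `R` is nontrivial, as degrees of polynomials over `R`
    -- require.
    obtain ⟨p₀, -⟩ := exists_lift_point j p hp
    have : Nontrivial R := (evalAt p₀).toRingHom.domain_nontrivial
    rw [map_prod] at hu
    have hD' : ∀ a, IsUnit ((D a).mat ((uMat k r).map φ)).det := by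
      intro a
      rw [(D a).det_map]
      exact isUnit_of_dvd_unit (Finset.dvd_prod_of_mem (fun a => φ ((D a).mat (uMat k r)).det) (Finset.mem_univ a)) hu
    obtain ⟨y, hy⟩ := exists_local_coords _ D hD'
    have hy' : ∀ (p' : pt k ⟶ Var.spec k R) l, evalAt p' (y l) = coords m (f (p' ≫ j)) l := by
      intro p' l
      refine hy _ _ ?_ (natDegree_of_stratum ι hι (p' ≫ j) (hf _)) l
      have h2 := hf (p' ≫ j)
      have h3 : (pointMatrix ((p' ≫ j) ≫ ι)).1 = ((uMat k r).map φ).map (evalAt p') := by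
        rw [Category.assoc]
        exact pointMatrix_comp (f := j ≫ ι) hφ p'
      rwa [h3] at h2
    obtain ⟨χ, hχ⟩ := hx.lift y fun l hl => isUnit_of_evalAt fun p' => by
      rw [hy']
      exact coords_ne_zero (hf _) (det_pointMatrix_ne_zero _) l hl
    refine ⟨Var.spec k R, j, specMap χ, hj, hp, fun p' => evalAt_injective ?_⟩
    rw [evalAt_comp_specMap, evalAt_pointOf]
    refine hx.hom_ext _ _ fun l => ?_
    rw [hψ, AlgHom.comp_apply, hχ, hy'])
  refine ⟨π, fun p g hg l => ?_⟩
  rw [hπ, evalAt_pointOf, hψ, (hf p).unique hg]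

include hx hι in
theorem exists_section_fibre (hm : m ∈ types r) [_root_.IsReduced B] [IsImmersion (Var.mor ι)] :
    ∃ (π : S ⟶ Var.spec k B) (σ : Var.spec k B ⟶ S), σ ≫ π = 𝟙 _ ∧
      ∀ (a : pt k ⟶ S) (b : pt k ⟶ GLVar k r), IsConj (pointMatrix (a ≫ ι)) (pointMatrix b) ↔
        ∃ b' : pt k ⟶ S, b' ≫ ι = b ∧ b' ≫ π = a ≫ π := by
  have : Infinite k := IsAlgClosed.instInfinite
  obtain ⟨π, hπ⟩ := exists_quotient hx ι hι
  obtain ⟨σ, hσ⟩ := exists_normalForm hx ι hι hm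
  refine ⟨π, σ, ?_, fun a b => ⟨fun hab => ?_, ?_⟩⟩
  · refine hom_ext_points fun p => evalAt_injective (hx.hom_ext _ _ fun l => ?_)
    rw [Category.comp_id, ← Category.assoc, hπ (p ≫ σ) _ (by rw [Category.assoc]; exact hσ p),
      coords_fPoly]
  · obtain ⟨f, hf⟩ := exists_hasInvariantFactors (pointMatrix (a ≫ ι)).1
    have hb : HasInvariantFactors (pointMatrix b).1 f := hf.congr hab
    obtain ⟨b', rfl⟩ := exists_lift_point ι b (by
      rw [hι, point_mem_stratum b hb]
      exact natDegree_of_stratum ι hι a hf)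
    refine ⟨b', rfl, evalAt_injective (hx.hom_ext _ _ fun l => ?_)⟩
    rw [hπ b' f hb, hπ a f hf]
  · rintro ⟨b', rfl, h⟩
    obtain ⟨f, hf⟩ := exists_hasInvariantFactors (pointMatrix (a ≫ ι)).1
    obtain ⟨g, hg⟩ := exists_hasInvariantFactors (pointMatrix (b' ≫ ι)).1
    have hfg : coords m f = coords m g := by
      funext l
      rw [← hπ a f hf, ← hπ b' g hg, h]
    have e1 := eq_fPoly m hf.chain hf.eq_one (natDegree_of_stratum ι hι a hf)
    have e2 := eq_fPoly m hg.chain hg.eq_one (natDegree_of_stratum ι hι b' hg)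
    rw [hfg, ← e2] at e1
    exact hf.isConj (e1 ▸ hg)

end Existence

/-! ### The class and the dimension of the space of conjugacy classes -/

section Presentation

variable {k : Type u} [Field k] {r : ℕ}

theorem topologicalKrullDim_spec (A : Type u) [CommRing A] [Algebra k A] [Algebra.FiniteType k A] :
    topologicalKrullDim (Var.spec k A).scheme = ringKrullDim A :=
  PrimeSpectrum.topologicalKrullDim_eq_ringKrullDim A

theorem irreducibleSpace_spec (A : Type u) [CommRing A] [IsDomain A] [Algebra k A]
    [Algebra.FiniteType k A] : IrreducibleSpace (Var.spec k A).scheme :=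
  inferInstanceAs (IrreducibleSpace (PrimeSpectrum A))

open Classical in
theorem finprod_constIndex {R : Type*} [CommRing R] (x : R) (m : Fin r → ℕ) :
    (∏ᶠ i : Σ j : Fin r, Fin (m j), if i ∈ constIndex m then x - 1 else x) =
      ∏ j, weight x (m j) := by
  rw [finprod_eq_prod_of_fintype, Fintype.prod_sigma]
  refine Finset.prod_congr rfl fun j _ => ?_
  have : ∀ n : ℕ, (∏ l : Fin n, if (l : ℕ) = 0 then x - 1 else x) = weight x n := by
    intro n
    cases n with
    | zero => simp [weight]
    | succ n =>
      rw [Fin.prod_univ_succ, weight, if_neg (Nat.succ_ne_zero n)]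
      simp only [Fin.val_zero, if_true, Fin.val_succ, Nat.add_eq_zero_iff, one_ne_zero, and_false,
        if_false, Finset.prod_const, Finset.card_univ, Fintype.card_fin, Nat.add_sub_cancel]
      ring
  rw [← this (m j)]
  refine Finset.prod_congr rfl fun l _ => ?_
  have hl : (⟨j, l⟩ : Σ j : Fin r, Fin (m j)) ∈ constIndex m ↔ (l : ℕ) = 0 := Iff.rfl
  by_cases h : (l : ℕ) = 0
  · rw [if_pos (hl.mpr h), if_pos h]
  · rw [if_neg fun h' => h (hl.mp h'), if_neg h]

variable [IsAlgClosed k]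

theorem exists_stratum_quotient {m : Fin r → ℕ} (hm : m ∈ types r) :
    ∃ (S X : Var k) (ι : S ⟶ GLVar k r) (π : S ⟶ X) (σ : X ⟶ S), IsReduced S.scheme ∧
      IsImmersion (Var.mor ι) ∧ Set.range (Var.mor ι) = stratum k m ∧ σ ≫ π = 𝟙 X ∧
      (∀ (a : pt k ⟶ S) (b : pt k ⟶ GLVar k r), IsConj (pointMatrix (a ≫ ι)) (pointMatrix b) ↔
        ∃ b' : pt k ⟶ S, b' ≫ ι = b ∧ b' ≫ π = a ≫ π) ∧
      cls X = ∏ j, weight (q k) (m j) ∧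
      topologicalKrullDim X.scheme = ((∑ j, m j : ℕ) : WithBot ℕ∞) := by
  have : Infinite k := IsAlgClosed.instInfinite
  obtain ⟨B, _, _, _, x, hx, _, hdim, hcls⟩ :=
    exists_isUniversal (k := k) (Σ j : Fin r, Fin (m j)) (constIndex m)
  obtain ⟨S, ι, _, _, hι⟩ := exists_reduced (X := GLVar k r) (isLocallyClosed_stratum m)
  obtain ⟨π, σ, h1, h2⟩ := exists_section_fibre hx ι hι hm
  refine ⟨S, Var.spec k B, ι, π, σ, inferInstance, inferInstance, hι, h1, h2, ?_, ?_⟩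
  · rw [hcls, finprod_constIndex]
  · rw [topologicalKrullDim_spec, hdim]
    simp

/-- The type `(r, 0, …, 0)` of the matrices with a cyclic vector is the one of largest dimension. -/
theorem exists_type_of_dim (r : ℕ) : ∃ m ∈ types r, ∑ j, m j = r := by
  cases r with
  | zero => exact ⟨Fin.elim0, mem_types.mpr (by simp), by simp⟩
  | succ n =>
    refine ⟨Pi.single 0 (n + 1), mem_types.mpr ?_, by simp⟩
    rw [Finset.sum_eq_single 0]
    · simp
    · intro j _ hj
      rw [Pi.single_eq_of_ne hj, mul_zero]
    · simp

/-- The conjugacy classes of `GL_r(k)` have a presentation. -/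
theorem exists_conjQuotient (r : ℕ) : ∃ Q : ConjQuotient k r,
    Q.virtualClass = classSum (q k) r ∧ Q.dim = (r : ℕ) := by
  choose S X ι π σ h1 h2 h3 h4 h5 h6 h7 using
    fun m : types r => exists_stratum_quotient (k := k) m.2
  let e := (types r).equivFin.symm
  let Q : ConjQuotient k r :=
    { n := (types r).card
      S := fun i => S (e i)
      X := fun i => X (e i)
      incl := fun i => ι (e i)
      π := fun i => π (e i)
      σ := fun i => σ (e i)
      isReduced := fun i => h1 (e i)
      isImmersion := fun i => h2 (e i)
      disjoint := fun i j hij => by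
        change Disjoint (Set.range (Var.mor (ι (e i)))) (Set.range (Var.mor (ι (e j))))
        rw [h3, h3]
        exact disjoint_stratum fun h => hij (e.injective (Subtype.ext h))
      cover := by
        rw [← iUnion_stratum, Set.iUnion_congr fun i => h3 (e i),
          e.surjective.iUnion_comp fun m => stratum k m.1, Set.iUnion_subtype]
      section_π := fun i => h4 (e i)
      fibre := fun i => h5 (e i) }
  refine ⟨Q, ?_, ?_⟩
  · change ∑ i, cls (X (e i)) = _
    rw [Equiv.sum_comp e fun m => cls (X m), Finset.sum_congr rfl fun m _ => h6 m, classSum]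
    exact Finset.sum_coe_sort (types r) fun m => ∏ j, weight (q k) (m j)
  · change ⨆ i, topologicalKrullDim (X (e i)).scheme = _
    apply le_antisymm
    · refine iSup_le fun i => ?_
      rw [h7]
      have h8 := mem_types.mp (e i).2
      have h9 : ∑ j, (e i).1 j ≤ r := by
        refine (Finset.sum_le_sum fun j _ => ?_).trans h8.le
        exact Nat.le_mul_of_pos_left _ (Nat.succ_pos _)
      exact_mod_cast h9
    · obtain ⟨m, hm, hs⟩ := exists_type_of_dim r
      refine le_trans (le_of_eq ?_) (le_iSup _ (e.symm ⟨m, hm⟩))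
      rw [h7, Equiv.apply_symm_apply, hs]

end Presentation

/-! ### Convergence -/

section Convergence

open Polynomial

variable {k : Type u} [Field k]

theorem divQ_add (a b : K0Var k) (s : ℕ) : divQ (a + b) s = divQ a s + divQ b s := by
  rw [divQ, divQ, divQ, map_add, add_mul]

theorem divQ_sum {ι : Type*} (t : Finset ι) (a : ι → K0Var k) (s : ℕ) :
    divQ (∑ i ∈ t, a i) s = ∑ i ∈ t, divQ (a i) s := by
  simp only [divQ, map_sum, Finset.sum_mul]

theorem divQ_zsmul (n : ℤ) (a : K0Var k) (s : ℕ) : divQ (n • a) s = n • divQ a s := by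
  simp only [divQ, map_zsmul, smul_mul_assoc]

theorem divQ_q_pow_self (r : ℕ) : divQ (q k ^ r) r = 1 := by
  rw [divQ, map_pow, ← mul_pow, IsLocalization.Away.mul_invSelf, one_pow]

/-- `q ^ j` is the class of an irreducible variety of dimension `j`, namely affine space. -/
theorem divQ_q_pow_mem [Infinite k] {j s : ℕ} {n : ℤ} (h : (j : ℤ) ≤ s + n) :
    divQ (q k ^ j) s ∈ filtration k n := by
  obtain ⟨A, _, _, _, x, -, _, hdim, hcls⟩ := exists_isUniversal (k := k) (Fin j) ∅
  refine AddSubgroup.subset_closure ⟨Var.spec k A, s, j, irreducibleSpace_spec A, ?_, h, ?_⟩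
  · rw [topologicalKrullDim_spec, hdim]
    simp
  · rw [hcls, finprod_eq_prod_of_fintype]
    simp

theorem divQ_aeval_mem [Infinite k] {s : ℕ} {n : ℤ} (G : ℤ[X]) (h : (G.natDegree : ℤ) ≤ s + n) :
    divQ (aeval (q k) G) s ∈ filtration k n := by
  rw [aeval_eq_sum_range, divQ_sum]
  refine AddSubgroup.sum_mem _ fun j hj => ?_
  rw [divQ_zsmul]
  refine AddSubgroup.zsmul_mem _ (divQ_q_pow_mem ?_) _
  have := Finset.mem_range.mp hj
  omega

theorem tendsto_divQ_classSum [Infinite k] :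
    Tendsto (fun r => divQ (classSum (q k) r) r) atTop (𝓝 1) := by
  rw [((filterBasis k).nhds_hasBasis 1).tendsto_right_iff]
  rintro _ ⟨n, rfl⟩
  -- The error has degree at most `r / 2`, and `r / 2 ≤ r + n` as soon as `r ≥ 2 |n|`.
  filter_upwards [eventually_ge_atTop (2 * n.natAbs)] with r hr
  obtain ⟨G, hG, hdeg⟩ := exists_classSum_eq r
  have h1 : classSum (q k) r = q k ^ r + aeval (q k) G := by
    have h2 := classSum_map (aeval (R := ℤ) (q k)).toRingHom X r
    rw [hG] at h2
    simpa using h2.symm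
  refine ⟨divQ (aeval (q k) G) r, divQ_aeval_mem G (by omega), ?_⟩
  rw [h1, divQ_add, divQ_q_pow_self]

theorem motivicallyStable_classSum [Infinite k] :
    MotivicallyStableTo (fun r => classSum (q k) r) (fun r => r) (((1 : Mq k)) : MqHat k) :=
  ((UniformSpace.Completion.continuous_coe (Mq k)).tendsto 1).comp tendsto_divQ_classSum

end Convergence

end MotivicConj

end

/-! ### The main theorem -/

theorem mainTheorem7 {k : Type u} [Field k] [IsAlgClosed k] [CharZero k] :
    ∃ C : ℕ → MotivicConj.K0Var k,
      (∀ r : ℕ, Nonempty (MotivicConj.ConjQuotient k r)) ∧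
      (∀ (r : ℕ) (Q : MotivicConj.ConjQuotient k r), Q.virtualClass = C r ∧ Q.dim = (r : ℕ)) ∧
      MotivicConj.MotivicallyStableTo C (fun r => r)
        (((1 : MotivicConj.Mq k)) : MotivicConj.MqHat k) := by
  refine ⟨fun r => MotivicConj.classSum (MotivicConj.q k) r, fun r => ?_, fun r Q => ?_,
    MotivicConj.motivicallyStable_classSum⟩
  · obtain ⟨Q, -⟩ := MotivicConj.exists_conjQuotient (k := k) r
    exact ⟨Q⟩
  -- Class and dimension are computed on the presentation by types and transferred to `Q` by
  -- independence.
  · obtain ⟨Q', h1, h2⟩ := MotivicConj.exists_conjQuotient (k := k) r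
    exact ⟨(Q.virtualClass_eq Q').trans h1, (Q.dim_eq Q').trans h2⟩
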